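/- Let $\ell_0>0$, write $J=[-\ell_0/2,\ell_0/2]$, $I_-=(-\infty,0]\times J$, $I_+=[0,\infty)\times J$, and for $k\in\mathbb N\cup\{0\}$, $0\le\theta<1$ let $C_\sharp^{k+\theta}$ be the space of all $f\in C^{k+\theta}(J)$ with $f^{(j)}(-\ell_0/2)=f^{(j)}(\ell_0/2)$ for $j=0,\dots,k$, with the norm of $C^{k+\theta}(J)$. Let $\mathscr X$ be the space of all pairs ${\bf f}=(f_1,f_2)\in C(I_-)\times C(I_+)$ for which $e^{-x/2}f_1$ and $e^{-x/2}f_2$ are bounded, with norm $\|{\bf f}\|_{\mathscr X}=\sup_{I_-}|e^{-x/2}f_1|+\sup_{I_+}|e^{-x/2}f_2|$. Consider the functions of $x$ (first component for $x\le 0$, second for $x\ge 0$) $${\bf T}=(e^x,\,1),\qquad {\bf U}=\Big(\tfrac{1-x}{3}e^x,\ \tfrac13\Big),\qquad {\bf V}=\Big(\big(1-\tfrac23x+\tfrac{x^2}{6}\big)e^x,\ 1+\tfrac x3\Big),$$ and the projection $\mathscr P{\bf f}=\Big(\int_{-\infty}^0f_1(x,\cdot)\,dx+\int_0^{\infty}e^{-x}f_2(x,\cdot)\,dx\Big){\bf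 U}$. For $\varepsilon>0$ let $L+\varepsilon A$ be the operator in $\mathscr X$ given by $$(L+\varepsilon A){\bf u}=\big(D_{xx}u_1+\varepsilon D_{\eta\eta}u_1-D_xu_1+e^xu_1(0,\cdot),\ \ D_{xx}u_2+\varepsilon D_{\eta\eta}u_2-D_xu_2\big)$$ on the domain of all ${\bf u}\in\mathscr X$ whose components are twice continuously differentiable with respect to $x$ and with respect to $\eta$ (on $I_-$ and on $I_+$ respectively), such that ${\bf u}_{\eta\eta}\in\mathscr X$ and $(L+\varepsilon A){\bf u}\in\mathscr X$, with $D_x^{j}u_1(0,\cdot)=D_x^{j}u_2(0,\cdot)$ and $D_\eta^{j}u_i(\cdot,-\ell_0/2)=D_\eta^{j}u_i(\cdot,\ell_0/2)$ for $j=0,1$, $i=1,2$. Let $L_\varepsilon$ be its closure in $\mathscr X$, and let $R(0,L_\varepsilon)$ be the inverse of $-L_\varepsilon$ in $(I-\mathscr P)(\mathscr X)$. Set $$\mathscr B_\varepsilon\psi=\psi-\frac{13\varepsilon}{3}\psi_{\eta\eta}+3\varepsilon^2\Big(D_{\eta\eta}R(0,L_\varepsilon)\big[\psi_{\eta\eta}\big({\bf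 V}-{\bf T}-\tfrac43{\bf U}\big)\big]\Big)_1(0,\cdot).$$ Proposition. For every $\varepsilon\in(0,1/2]$ and every $\theta\in(0,1)$, $\mathscr B_\varepsilon$ is a well-defined linear operator from $C_\sharp^{2+\theta}$ to $C_\sharp^{\theta}$ and it is invertible: it maps $C_\sharp^{2+\theta}$ bijectively onto $C_\sharp^{\theta}$, and both $\mathscr B_\varepsilon$ and its inverse are bounded. -/

import Mathlib

open Filter Topology MeasureTheory
open scoped NNReal

noncomputable section

namespace FrontB

/-! ### Derivatives of functions given on a subset of the line -/

/-- `g` is the derivative of `f : S → ℝ` on `S` (one-sided at the points of `S` that are end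
points).  Only the values of `f` on `S` matter, the extension by `0` being irrelevant. -/
def HasDerivOn {S : Set ℝ} (f g : S → ℝ) : Prop :=
  ∀ x : S, HasDerivWithinAt (Function.extend Subtype.val f 0) (g x) S x

/-- The derivative of `f : S → ℝ`, as a function on `S`. -/
def derivOn {S : Set ℝ} (f : S → ℝ) : S → ℝ :=
  fun x => derivWithin (Function.extend Subtype.val f 0) S x

lemma extend_val {S : Set ℝ} (f : S → ℝ) (x : S) :
    Function.extend Subtype.val f 0 (x : ℝ) = f x :=
  Subtype.val_injective.extend_apply f 0 x

lemma HasDerivOn.add {S : Set ℝ} {f f' g g' : S → ℝ} (h : HasDerivOn f f')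
    (k : HasDerivOn g g') : HasDerivOn (f + g) (f' + g') := fun x => by
  refine (HasDerivWithinAt.add (h x) (k x)).congr_of_mem (fun y hy => ?_) x.2
  have e := fun F : S → ℝ => extend_val F ⟨y, hy⟩
  simp only [] at e
  simp [e]

lemma HasDerivOn.smul {S : Set ℝ} {f f' : S → ℝ} (c : ℝ) (h : HasDerivOn f f') :
    HasDerivOn (c • f) (c • f') := fun x => by
  refine ((h x).const_smul c).congr_of_mem (fun y hy => ?_) x.2
  have e := fun F : S → ℝ => extend_val F ⟨y, hy⟩
  simp only [] at e
  simp [e]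

lemma HasDerivOn.zero {S : Set ℝ} : HasDerivOn (0 : S → ℝ) 0 := fun x => by
  refine (hasDerivWithinAt_const (x : ℝ) S (0 : ℝ)).congr_of_mem (fun y hy => ?_) x.2
  have e := fun F : S → ℝ => extend_val F ⟨y, hy⟩
  simp only [] at e
  simp [e]

/-! ### The spaces of periodic Hölder functions -/

/-- The interval `[-ℓ/2, ℓ/2]`. -/
abbrev Cell (ℓ : ℝ) : Set ℝ := Set.Icc (-ℓ / 2) (ℓ / 2)

/-- `f` takes the same value at `-ℓ/2` and at `ℓ/2`. -/
def EndsAgree {ℓ : ℝ} (f : Cell ℓ → ℝ) : Prop :=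
  ∀ a b : Cell ℓ, (a : ℝ) = -ℓ / 2 → (b : ℝ) = ℓ / 2 → f a = f b

/-- The space `C_♯^{k+θ}` of the functions of class `C^{k+θ}` on `[-ℓ/2, ℓ/2]` whose derivatives
of order `0, …, k` take the same value at the two end points (`0 ≤ θ < 1`).  Here `d j` is the
derivative of order `j`. -/
def CSharp (ℓ : ℝ) (k : ℕ) (θ : ℝ≥0) : Submodule ℝ (Cell ℓ → ℝ) where
  carrier := {f | ∃ d : ℕ → Cell ℓ → ℝ, d 0 = f ∧ (∀ j < k, HasDerivOn (d j) (d (j + 1))) ∧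
    Continuous (d k) ∧ MemHolder θ (d k) ∧ ∀ j ≤ k, EndsAgree (d j)}
  zero_mem' := ⟨0, rfl, fun _ _ => HasDerivOn.zero, continuous_const,
    ⟨0, fun x y => by simp⟩,
    fun _ _ _ _ _ _ => rfl⟩
  add_mem' := by
    rintro f g ⟨d, hd, h1, h2, h3, h4⟩ ⟨e, he, k1, k2, k3, k4⟩
    refine ⟨d + e, by simp [hd, he], fun j hj => (h1 j hj).add (k1 j hj), h2.add k2,
      h3.add k3, fun j hj a b ha hb => ?_⟩
    simp [h4 j hj a b ha hb, k4 j hj a b ha hb]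
  smul_mem' := by
    rintro c f ⟨d, hd, h1, h2, h3, h4⟩
    refine ⟨fun j => c • d j, by simp [hd], fun j hj => (h1 j hj).smul c, h2.const_smul c,
      h3.smul, fun j hj a b ha hb => ?_⟩
    simp [h4 j hj a b ha hb]

/-- The norm of `C^{k+θ}([-ℓ/2, ℓ/2])`, `0 < θ < 1`: the sum of the sup norms of the derivatives of
order `0, …, k` and of the `θ`-Hölder seminorm of the derivative of order `k`. -/
def holderNorm {ℓ : ℝ} (k : ℕ) (θ : ℝ≥0) (f : Cell ℓ → ℝ) : ℝ :=
  (∑ j ∈ Finset.range (k + 1), ⨆ η : Cell ℓ, |(derivOn^[j] f) η|)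
    + (nnHolderNorm θ (derivOn^[k] f) : ℝ)

/-! ### The space `𝓧` -/

/-- `I₋ = (-∞, 0] × [-ℓ/2, ℓ/2]`. -/
abbrev StripNeg (ℓ : ℝ) : Type := Set.Iic (0 : ℝ) × Cell ℓ

/-- `I₊ = [0, ∞) × [-ℓ/2, ℓ/2]`. -/
abbrev StripPos (ℓ : ℝ) : Type := Set.Ici (0 : ℝ) × Cell ℓ

/-- `C(I₋) × C(I₊)`. -/
abbrev Pair (ℓ : ℝ) : Type := C(StripNeg ℓ, ℝ) × C(StripPos ℓ, ℝ)

/-- The space `𝓧` of the pairs `(f₁, f₂) ∈ C(I₋) × C(I₊)` such that the functions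
`e^{-x/2} fᵢ(x, η)` are bounded. -/
def XSpace (ℓ : ℝ) : Submodule ℝ (Pair ℓ) where
  carrier := {f | (∃ C : ℝ, ∀ p, |Real.exp (-(p.1 : ℝ) / 2) * f.1 p| ≤ C) ∧
    ∃ C : ℝ, ∀ p, |Real.exp (-(p.1 : ℝ) / 2) * f.2 p| ≤ C}
  zero_mem' := ⟨⟨0, fun p => by simp⟩, ⟨0, fun p => by simp⟩⟩
  add_mem' := by
    rintro f g ⟨⟨A, hA⟩, ⟨B, hB⟩⟩ ⟨⟨A', hA'⟩, ⟨B', hB'⟩⟩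
    refine ⟨⟨A + A', fun p => ?_⟩, ⟨B + B', fun p => ?_⟩⟩
    · have : Real.exp (-(p.1 : ℝ) / 2) * (f + g).1 p =
          Real.exp (-(p.1 : ℝ) / 2) * f.1 p + Real.exp (-(p.1 : ℝ) / 2) * g.1 p := by
        simp [mul_add]
      rw [this]
      exact (abs_add_le _ _).trans (add_le_add (hA p) (hA' p))
    · have : Real.exp (-(p.1 : ℝ) / 2) * (f + g).2 p =
          Real.exp (-(p.1 : ℝ) / 2) * f.2 p + Real.exp (-(p.1 : ℝ) / 2) * g.2 p := by
        simp [mul_add]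
      rw [this]
      exact (abs_add_le _ _).trans (add_le_add (hB p) (hB' p))
  smul_mem' := by
    rintro c f ⟨⟨A, hA⟩, ⟨B, hB⟩⟩
    refine ⟨⟨|c| * A, fun p => ?_⟩, ⟨|c| * B, fun p => ?_⟩⟩
    · have : Real.exp (-(p.1 : ℝ) / 2) * (c • f).1 p =
          c * (Real.exp (-(p.1 : ℝ) / 2) * f.1 p) := by
        simp only [Prod.smul_fst, ContinuousMap.smul_apply, smul_eq_mul]; ring
      rw [this, abs_mul]
      exact mul_le_mul_of_nonneg_left (hA p) (abs_nonneg c)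
    · have : Real.exp (-(p.1 : ℝ) / 2) * (c • f).2 p =
          c * (Real.exp (-(p.1 : ℝ) / 2) * f.2 p) := by
        simp only [Prod.smul_snd, ContinuousMap.smul_apply, smul_eq_mul]; ring
      rw [this, abs_mul]
      exact mul_le_mul_of_nonneg_left (hB p) (abs_nonneg c)

/-- The norm of `𝓧`. -/
def xNorm {ℓ : ℝ} (f : XSpace ℓ) : ℝ :=
  (⨆ p : StripNeg ℓ, |Real.exp (-(p.1 : ℝ) / 2) * f.1.1 p|)
    + ⨆ p : StripPos ℓ, |Real.exp (-(p.1 : ℝ) / 2) * f.1.2 p|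

/-! ### The generalized functions `T`, `U`, `V` (index `1` for `x ≤ 0`, `2` for `x ≥ 0`) -/

def T₁ (x : ℝ) : ℝ := Real.exp x
def T₂ (_x : ℝ) : ℝ := 1
def U₁ (x : ℝ) : ℝ := (1 - x) / 3 * Real.exp x
def U₂ (_x : ℝ) : ℝ := 1 / 3
def V₁ (x : ℝ) : ℝ := (1 - 2 / 3 * x + x ^ 2 / 6) * Real.exp x
def V₂ (x : ℝ) : ℝ := 1 + x / 3

/-! ### The projection `𝓟` and the operator `L + εA` -/

/-- `Q(f)(η) = ∫_{-∞}^0 f₁(x, η) dx + ∫_0^∞ e^{-x} f₂(x, η) dx`. -/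
def Q {ℓ : ℝ} (f : XSpace ℓ) (η : Cell ℓ) : ℝ :=
  (∫ x : Set.Iic (0 : ℝ), f.1.1 (x, η) ∂(volume.comap Subtype.val))
    + ∫ x : Set.Ici (0 : ℝ), Real.exp (-(x : ℝ)) * f.1.2 (x, η) ∂(volume.comap Subtype.val)

/-- `f ∈ (I - 𝓟)(𝓧)`, where `𝓟(f) = Q(f) U`; since `𝓟` is a projection, this is its kernel. -/
def InComplement {ℓ : ℝ} (f : XSpace ℓ) : Prop :=
  (∀ p : StripNeg ℓ, Q f p.2 * U₁ p.1 = 0) ∧ ∀ p : StripPos ℓ, Q f p.2 * U₂ p.1 = 0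

/-- `v = D_x u` on `I₋` and on `I₊`. -/
def HasDx {ℓ : ℝ} (u v : Pair ℓ) : Prop :=
  (∀ η : Cell ℓ, HasDerivOn (fun x : Set.Iic (0 : ℝ) => u.1 (x, η)) fun x => v.1 (x, η)) ∧
    ∀ η : Cell ℓ, HasDerivOn (fun x : Set.Ici (0 : ℝ) => u.2 (x, η)) fun x => v.2 (x, η)

/-- `v = D_η u` on `I₋` and on `I₊`. -/
def HasDeta {ℓ : ℝ} (u v : Pair ℓ) : Prop :=
  (∀ x : Set.Iic (0 : ℝ), HasDerivOn (fun η : Cell ℓ => u.1 (x, η)) fun η => v.1 (x, η)) ∧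
    ∀ x : Set.Ici (0 : ℝ), HasDerivOn (fun η : Cell ℓ => u.2 (x, η)) fun η => v.2 (x, η)

/-- Both components of `u` are periodic in `η`. -/
def PeriodicEta {ℓ : ℝ} (u : Pair ℓ) : Prop :=
  (∀ x : Set.Iic (0 : ℝ), EndsAgree fun η : Cell ℓ => u.1 (x, η)) ∧
    ∀ x : Set.Ici (0 : ℝ), EndsAgree fun η : Cell ℓ => u.2 (x, η)

/-- The point `x = 0` of `(-∞, 0]`. -/
def zeroNeg : Set.Iic (0 : ℝ) := ⟨0, Set.self_mem_Iic⟩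

/-- The point `x = 0` of `[0, ∞)`. -/
def zeroPos : Set.Ici (0 : ℝ) := ⟨0, Set.self_mem_Ici⟩

/-- `u₁(0, ·) = u₂(0, ·)`. -/
def MatchAtZero {ℓ : ℝ} (u : Pair ℓ) : Prop :=
  ∀ η : Cell ℓ, u.1 (zeroNeg, η) = u.2 (zeroPos, η)

/-- `u ∈ D(L + εA)` and `(L + εA) u = f`, where `A = D_ηη` and `L` acts as
`D_xx u₁ - D_x u₁ + u₁(0, ·) e^x` for `x ≤ 0` and as `D_xx u₂ - D_x u₂` for `x ≥ 0`.  The requirement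
that `𝓛 u` belongs to `𝓧` holds because `f` and `D_ηη u` do. -/
def GraphLA {ℓ : ℝ} (ε : ℝ) (u f : XSpace ℓ) : Prop :=
  ∃ ux uxx uη uηη : Pair ℓ,
    HasDx u.1 ux ∧ HasDx ux uxx ∧ HasDeta u.1 uη ∧ HasDeta uη uηη ∧ uηη ∈ XSpace ℓ ∧
    MatchAtZero u.1 ∧ MatchAtZero ux ∧ PeriodicEta u.1 ∧ PeriodicEta uη ∧
    (∀ p : StripNeg ℓ, f.1.1 p =
      uxx.1 p + ε * uηη.1 p - ux.1 p + u.1.1 (zeroNeg, p.2) * Real.exp p.1) ∧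
    ∀ p : StripPos ℓ, f.1.2 p = uxx.2 p + ε * uηη.2 p - ux.2 p

/-- `u ∈ D(L_ε)` and `L_ε u = f`, where `L_ε` is the closure of `L + εA` in `𝓧`. -/
def GraphLEps {ℓ : ℝ} (ε : ℝ) (u f : XSpace ℓ) : Prop :=
  ∃ un fn : ℕ → XSpace ℓ, (∀ n, GraphLA ε (un n) (fn n)) ∧
    Tendsto (fun n => xNorm (un n - u)) atTop (𝓝 0) ∧
    Tendsto (fun n => xNorm (fn n - f)) atTop (𝓝 0)

/-- `u = R(0, L_ε) f`, the inverse of `-L_ε` being taken in `(I - 𝓟)(𝓧)`. -/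
def IsResolventZero {ℓ : ℝ} (ε : ℝ) (f u : XSpace ℓ) : Prop :=
  InComplement f ∧ InComplement u ∧ GraphLEps ε u (-f)

/-! ### The operator `𝓑_ε` -/

/-- `ψ` belongs to the domain of `𝓑_ε` and `𝓑_ε ψ = g`, where
`𝓑_ε ψ = ψ - (13 ε / 3) ψ_ηη + 3 ε² (D_ηη R(0, L_ε)[ψ_ηη (V - T - (4/3) U)])₁(0, ·)`.
Here `ψ₂ = ψ_ηη`, `f = ψ_ηη (V - T - (4/3) U)`, `u = R(0, L_ε) f` and `w₂ = D_ηη u₁(0, ·)`. -/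
def GraphB {ℓ : ℝ} (ε : ℝ) (ψ g : Cell ℓ → ℝ) : Prop :=
  ∃ (ψ₁ ψ₂ w₁ w₂ : Cell ℓ → ℝ) (f u : XSpace ℓ),
    HasDerivOn ψ ψ₁ ∧ HasDerivOn ψ₁ ψ₂ ∧
    (∀ p : StripNeg ℓ, f.1.1 p = ψ₂ p.2 * (V₁ p.1 - T₁ p.1 - 4 / 3 * U₁ p.1)) ∧
    (∀ p : StripPos ℓ, f.1.2 p = ψ₂ p.2 * (V₂ p.1 - T₂ p.1 - 4 / 3 * U₂ p.1)) ∧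
    IsResolventZero ε f u ∧
    HasDerivOn (fun η => u.1.1 (zeroNeg, η)) w₁ ∧ HasDerivOn w₁ w₂ ∧
    ∀ η, g η = ψ η - 13 * ε / 3 * ψ₂ η + 3 * ε ^ 2 * w₂ η

end FrontB

end

/-! On the Fourier mode `exp (2πi n η / ℓ)` the equation `L_ε u = -f` is a second order ODE in `x`,
whose homogeneous solutions are `e^{r x}` and `e^{(1 - r) x}`, where `r ≥ 1` is the root of
`r (r - 1) = ε (2π n / ℓ)²`. For the source `V - T - (4/3) U` it is solved in closed form by `e^x`
and `1` times polynomials and by these exponentials, and the value of the solution at `x = 0` shows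
that `𝓑_ε` is the Fourier multiplier with symbol `3 r (2 r² - 1) / (2 r + 1) ≥ r²`. Hence
`𝓑_ε = 1 - 3 ε D_ηη - ε K D_ηη` with a multiplier `K` of symbol `1 / r + 1 / (2 r + 1)`, and the
second derivative of its inverse is `-(1 - N) / (3 ε)` with `N` of symbol `r / (2 r² - 1)`.

The symbols of `K` and `N` are square summable. By Parseval and Cauchy–Schwarz such a multiplier
acts on continuous functions, and since it commutes with translations it is bounded on Hölder spaces
as well.

The closure `L_ε` is reached only through limits in the weighted norm, and the uniqueness of
`D_ηη u₁(0, ·)` has to survive them. Pairing a mode of `u` with the adjoint solutions `e^{-r x}` on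
`x ≥ 0` and `e^{(r - 1) x}` on `x ≤ 0` bounds the mode of `u₁(0, ·)` by the norm of `L_ε u` when
`r > 1`; the constant mode, for which `r = 1`, disappears on differentiating. -/

noncomputable section

namespace FrontB

open Complex ComplexConjugate AddCircle

section Circle

variable {ℓ : ℝ}

lemma norm_fourier_apply (n : ℤ) (t : AddCircle ℓ) : ‖fourier n t‖ = 1 := by
  rw [fourier_apply]
  exact Circle.norm_coe _

/-- The embedding of the real into the complex continuous functions on the circle. -/
def toComplex : C(AddCircle ℓ, ℝ) →L[ℝ] C(AddCircle ℓ, ℂ) :=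
  ofRealCLM.compLeftContinuous ℝ (AddCircle ℓ)

@[simp] lemma toComplex_apply (F : C(AddCircle ℓ, ℝ)) (t : AddCircle ℓ) :
    toComplex F t = (F t : ℂ) := rfl

/-- The pointwise real part of a complex continuous function on the circle. -/
def reCircle : C(AddCircle ℓ, ℂ) →L[ℝ] C(AddCircle ℓ, ℝ) :=
  reCLM.compLeftContinuous ℝ (AddCircle ℓ)

variable [hℓ : Fact (0 < ℓ)]

lemma integrable_haarAddCircle {E : Type*} [NormedAddCommGroup E] (F : C(AddCircle ℓ, E)) :
    Integrable F (haarAddCircle (T := ℓ)) :=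
  F.continuous.integrable_of_hasCompactSupport (HasCompactSupport.of_compactSpace _)

lemma norm_fourierCoeff_le (F : C(AddCircle ℓ, ℂ)) (n : ℤ) : ‖fourierCoeff F n‖ ≤ ‖F‖ := by
  have h : ‖fourierCoeff F n‖ ≤ ‖F‖ * (haarAddCircle (T := ℓ)).real Set.univ := by
    refine norm_integral_le_of_norm_le_const (Eventually.of_forall fun t => ?_)
    rw [norm_smul, norm_fourier_apply, one_mul]
    exact F.norm_coe_le_norm t
  simpa using h

/-- The `n`-th Fourier coefficient, as a continuous linear functional on `C(AddCircle ℓ, ℂ)`. -/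
def fourierCoeffCLM (n : ℤ) : C(AddCircle ℓ, ℂ) →L[ℂ] ℂ :=
  LinearMap.mkContinuous
    { toFun := fun F => fourierCoeff F n
      map_add' := fun F G =>
        congrFun (fourierCoeff.add (integrable_haarAddCircle F) (integrable_haarAddCircle G)) n
      map_smul' := fun c F => fourierCoeff.const_smul F c n }
    1 fun F => by simpa using norm_fourierCoeff_le F n

lemma fourierCoeffCLM_apply (n : ℤ) (F : C(AddCircle ℓ, ℂ)) :
    fourierCoeffCLM n F = fourierCoeff F n := rfl

lemma fourierCoeffCLM_fourier (m n : ℤ) :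
    fourierCoeffCLM n (fourier m : C(AddCircle ℓ, ℂ)) = if n = m then 1 else 0 := by
  rw [fourierCoeffCLM_apply, fourierCoeff_fourier, Pi.single_apply]

lemma ext_fourierCoeffCLM {F G : C(AddCircle ℓ, ℂ)}
    (h : ∀ n, fourierCoeffCLM n F = fourierCoeffCLM n G) : F = G := by
  have h0 : fourierCoeff (F - G : C(AddCircle ℓ, ℂ)) = 0 := funext fun n => by
    rw [← fourierCoeffCLM_apply, map_sub, h, sub_self, Pi.zero_apply]
  have hsum := hasSum_fourier_series_of_summable (f := F - G) (by rw [h0]; exact summable_zero)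
  simp only [h0, Pi.zero_apply, zero_smul] at hsum
  exact sub_eq_zero.1 (hsum.unique hasSum_zero)

lemma fourierCoeff_conj (F : AddCircle ℓ → ℂ) (n : ℤ) :
    fourierCoeff (fun t => conj (F t)) n = conj (fourierCoeff F (-n)) := by
  simp only [fourierCoeff, ← integral_conj, smul_eq_mul, map_mul, neg_neg, fourier_neg]

/-- The `n`-th Fourier coefficient of a real continuous function on the circle. -/
def coeff (n : ℤ) : C(AddCircle ℓ, ℝ) →L[ℝ] ℂ :=
  (fourierCoeffCLM n).restrictScalars ℝ ∘L toComplex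

lemma coeff_eq_fourierCoeffCLM (n : ℤ) (F : C(AddCircle ℓ, ℝ)) :
    coeff n F = fourierCoeffCLM n (toComplex F) := rfl

lemma coeff_eq_fourierCoeff (n : ℤ) (F : C(AddCircle ℓ, ℝ)) :
    coeff n F = fourierCoeff (fun t => (F t : ℂ)) n := rfl

lemma coeff_smul (c : ℝ) (n : ℤ) (F : C(AddCircle ℓ, ℝ)) : coeff n (c • F) = c * coeff n F := by
  rw [map_smul, real_smul]

lemma ext_coeff {F G : C(AddCircle ℓ, ℝ)} (h : ∀ n, coeff n F = coeff n G) : F = G := by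
  ext t
  simpa using DFunLike.congr_fun (ext_fourierCoeffCLM h) t

lemma coeff_neg (n : ℤ) (F : C(AddCircle ℓ, ℝ)) : coeff (-n) F = conj (coeff n F) := by
  simpa only [conj_ofReal, neg_neg, ← coeff_eq_fourierCoeff] using
    fourierCoeff_conj (fun t => (F t : ℂ)) (-n)

lemma eq_const_of_coeff_eq_zero {F : C(AddCircle ℓ, ℝ)} (h : ∀ n ≠ 0, coeff n F = 0) :
    ∃ c : ℝ, F = ContinuousMap.const _ c := by
  have hreal : conj (coeff 0 F) = coeff 0 F := by rw [← coeff_neg, neg_zero]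
  refine ⟨(coeff 0 F).re, ext_coeff fun n => ?_⟩
  have hconst : toComplex (ContinuousMap.const (AddCircle ℓ) (coeff 0 F).re) =
      coeff 0 F • fourier 0 := by
    ext t
    simp [conj_eq_iff_re.1 hreal]
  rw [coeff_eq_fourierCoeffCLM n (ContinuousMap.const _ _), hconst, map_smul,
    fourierCoeffCLM_fourier]
  rcases eq_or_ne n 0 with rfl | hn
  · simp
  · simp [hn, h n hn]

lemma summable_sq_coeff_and_tsum_le (F : C(AddCircle ℓ, ℝ)) :
    (Summable fun n => ‖coeff n F‖ ^ 2) ∧ ∑' n, ‖coeff n F‖ ^ 2 ≤ ‖F‖ ^ 2 := by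
  have hparseval :=
    hasSum_sq_fourierCoeff (ContinuousMap.toLp (E := ℂ) 2 haarAddCircle ℂ (toComplex F))
  simp only [fourierCoeff_toLp] at hparseval
  refine ⟨hparseval.summable, hparseval.tsum_eq.trans_le ?_⟩
  have hle : ∀ᵐ t ∂(haarAddCircle (T := ℓ)),
      ‖ContinuousMap.toLp (E := ℂ) 2 haarAddCircle ℂ (toComplex F) t‖ ^ 2 ≤ ‖F‖ ^ 2 := by
    filter_upwards [ContinuousMap.coeFn_toLp (E := ℂ) (p := 2) (𝕜 := ℂ) haarAddCircle
      (toComplex F)] with t ht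
    rw [ht, toComplex_apply, norm_real]
    exact pow_le_pow_left₀ (norm_nonneg _) (F.norm_coe_le_norm t) 2
  calc _ ≤ ∫ _ : AddCircle ℓ, ‖F‖ ^ 2 ∂haarAddCircle :=
        integral_mono_of_nonneg (.of_forall fun t => sq_nonneg _) (integrable_const _) hle
    _ = ‖F‖ ^ 2 := by simp

lemma norm_reCircle_le (H : C(AddCircle ℓ, ℂ)) : ‖reCircle H‖ ≤ ‖H‖ :=
  (ContinuousMap.norm_le _ (norm_nonneg _)).2 fun t =>
    (abs_re_le_norm _).trans (H.norm_coe_le_norm t)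

lemma coeff_reCircle (n : ℤ) (H : C(AddCircle ℓ, ℂ)) : coeff n (reCircle H) =
    (fourierCoeffCLM n H + conj (fourierCoeffCLM (-n) H)) / 2 := by
  have hre : (2 : ℂ) • toComplex (reCircle H) = H + star H := by
    ext t
    exact (ofReal_mul 2 _).symm.trans (add_conj (H t)).symm
  have hstar : fourierCoeffCLM n (star H) = conj (fourierCoeffCLM (-n) H) := fourierCoeff_conj H n
  rw [eq_div_iff two_ne_zero, mul_comm, ← smul_eq_mul, coeff_eq_fourierCoeffCLM, ← map_smul, hre,
    map_add, hstar]

lemma exists_coeff_eq {a : ℤ → ℂ} (ha : Summable fun n => ‖a n‖)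
    (hherm : ∀ n, a (-n) = conj (a n)) :
    ∃ F : C(AddCircle ℓ, ℝ), (∀ n, coeff n F = a n) ∧ ‖F‖ ≤ ∑' n, ‖a n‖ := by
  have hnorm : ∀ n, ‖a n • (fourier n : C(AddCircle ℓ, ℂ))‖ = ‖a n‖ := fun n => by
    rw [norm_smul, fourier_norm, mul_one]
  have hsum : Summable fun n => a n • (fourier n : C(AddCircle ℓ, ℂ)) :=
    .of_norm (by simpa only [hnorm] using ha)
  set H : C(AddCircle ℓ, ℂ) := ∑' n, a n • fourier n with hH
  have hcoeff : ∀ n, fourierCoeffCLM n H = a n := fun n => by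
    rw [hH, ContinuousLinearMap.map_tsum _ hsum, tsum_eq_single n fun m hm => by
      rw [map_smul, fourierCoeffCLM_fourier, if_neg hm.symm, smul_zero]]
    simp [fourierCoeffCLM_fourier]
  refine ⟨reCircle H, fun n => ?_, (norm_reCircle_le H).trans ?_⟩
  · rw [coeff_reCircle, hcoeff, hcoeff, hherm, conj_conj, add_self_div_two]
  · refine (norm_tsum_le_tsum_norm (by simpa only [hnorm] using ha)).trans_eq ?_
    simp only [hnorm]

lemma dense_of_smul_fourier_mem {V : Submodule ℝ C(AddCircle ℓ, ℂ)}
    (h : ∀ (c : ℂ) (n : ℤ), c • fourier n ∈ V) : Dense (V : Set C(AddCircle ℓ, ℂ)) := by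
  have hspan : (Submodule.span ℂ (Set.range (fourier (T := ℓ)))).restrictScalars ℝ ≤ V := by
    rw [← Submodule.span_smul_of_span_eq_top (Submodule.span_univ (R := ℝ)), Submodule.span_le]
    rintro _ ⟨c, -, _, ⟨n, rfl⟩, rfl⟩
    exact h c n
  exact (Submodule.dense_iff_topologicalClosure_eq_top.2 span_fourier_closure_eq_top).mono hspan

lemma ext_smul_fourier {E : Type*} [NormedAddCommGroup E] [NormedSpace ℝ E]
    {f g : C(AddCircle ℓ, ℂ) →ₗ[ℝ] E} {A B : ℝ} (hf : ∀ F, ‖f F‖ ≤ A * ‖F‖)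
    (hg : ∀ F, ‖g F‖ ≤ B * ‖F‖) (h : ∀ (c : ℂ) (n : ℤ), f (c • fourier n) = g (c • fourier n)) :
    f = g :=
  DFunLike.coe_injective (Continuous.ext_on
    (dense_of_smul_fourier_mem (V := LinearMap.eqLocus f g) h)
    (f.mkContinuous A hf).continuous (g.mkContinuous B hg).continuous fun _ hF => hF)

end Circle

section Multiplier

variable {ℓ : ℝ} [hℓ : Fact (0 < ℓ)] {κ : ℤ → ℂ} {M : C(AddCircle ℓ, ℝ) →L[ℝ] C(AddCircle ℓ, ℝ)}

/-- `M` is the Fourier multiplier operator with symbol `κ` on the continuous functions. -/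
def IsMultiplier (κ : ℤ → ℂ) (M : C(AddCircle ℓ, ℝ) →L[ℝ] C(AddCircle ℓ, ℝ)) : Prop :=
  ∀ F n, coeff n (M F) = κ n * coeff n F

/-- By Parseval and Cauchy–Schwarz the Fourier series of `M F` converges absolutely. -/
theorem exists_isMultiplier (hκ : Summable fun n => ‖κ n‖ ^ 2)
    (hherm : ∀ n, κ (-n) = conj (κ n)) :
    ∃ M : C(AddCircle ℓ, ℝ) →L[ℝ] C(AddCircle ℓ, ℝ), IsMultiplier κ M := by
  have hbound : ∀ F : C(AddCircle ℓ, ℝ), ∃ G : C(AddCircle ℓ, ℝ),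
      (∀ n, coeff n G = κ n * coeff n F) ∧ ‖G‖ ≤ √(∑' n, ‖κ n‖ ^ 2) * ‖F‖ := fun F => by
    obtain ⟨hsq, hle⟩ := summable_sq_coeff_and_tsum_le F
    obtain ⟨hsum, hcs⟩ := Real.summable_and_inner_le_Lp_mul_Lq_tsum_of_nonneg
      Real.HolderConjugate.two_two (f := fun n => ‖κ n‖) (g := fun n => ‖coeff n F‖)
      (fun n => norm_nonneg _) (fun n => norm_nonneg _) (by simpa using hκ) (by simpa using hsq)
    obtain ⟨G, hG, hGle⟩ := exists_coeff_eq (ℓ := ℓ) (a := fun n => κ n * coeff n F)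
      (by simpa only [norm_mul] using hsum) fun n => by rw [hherm, coeff_neg, map_mul]
    refine ⟨G, hG, hGle.trans ?_⟩
    simp only [Real.rpow_two, ← Real.sqrt_eq_rpow] at hcs
    simp only [norm_mul]
    refine hcs.trans ?_
    gcongr
    exact Real.sqrt_le_iff.2 ⟨norm_nonneg _, hle⟩
  choose G hG hGle using hbound
  exact ⟨LinearMap.mkContinuous
    { toFun := G
      map_add' := fun F F' => ext_coeff fun n => by simp only [hG, map_add, mul_add]
      map_smul' := fun c F => ext_coeff fun n => by
        simp only [hG, coeff_smul, RingHom.id_apply, mul_left_comm] } _ hGle, hG⟩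

lemma coeff_comp_addRight (h : AddCircle ℓ) (F : C(AddCircle ℓ, ℝ)) (n : ℤ) :
    coeff n (F.comp (.addRight h)) = fourier n h * coeff n F := by
  have hshift : ∀ t : AddCircle ℓ, (fourier (-n) (t + -h) : ℂ) = fourier n h * fourier (-n) t :=
    fun t => by simp [fourier_apply, smul_add, toCircle_add, mul_comm]
  simp only [coeff_eq_fourierCoeff, fourierCoeff, smul_eq_mul, ContinuousMap.comp_apply,
    ContinuousMap.coe_addRight]
  rw [← integral_add_right_eq_self _ (-h)]
  simp only [hshift, mul_assoc, neg_add_cancel_right, integral_const_mul]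

lemma IsMultiplier.comp_addRight (hM : IsMultiplier κ M) (h : AddCircle ℓ)
    (F : C(AddCircle ℓ, ℝ)) : M (F.comp (.addRight h)) = (M F).comp (.addRight h) :=
  ext_coeff fun n => by rw [hM, coeff_comp_addRight, coeff_comp_addRight, hM, mul_left_comm]

end Multiplier

section HasDerivOn

variable {S : Set ℝ} {f g h : S → ℝ}

lemma HasDerivOn.unique (hS : UniqueDiffOn ℝ S) (hg : HasDerivOn f g) (hh : HasDerivOn f h) :
    g = h :=
  funext fun x => (hS x x.2).eq_deriv _ (hg x) (hh x)

lemma HasDerivOn.derivOn_eq (hS : UniqueDiffOn ℝ S) (hg : HasDerivOn f g) : derivOn f = g :=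
  funext fun x => (hg x).derivWithin (hS x x.2)

lemma hasDerivOn_iff_of_eqOn {F : ℝ → ℝ} (hF : ∀ x : S, F x = f x) :
    HasDerivOn f g ↔ ∀ x : S, HasDerivWithinAt F (g x) S x := by
  have heq : ∀ x ∈ S, F x = Function.extend Subtype.val f 0 x := fun x hx =>
    (hF ⟨x, hx⟩).trans (extend_val f ⟨x, hx⟩).symm
  exact forall_congr' fun x => ⟨fun h => h.congr_of_mem heq x.2,
    fun h => h.congr_of_mem (fun y hy => (heq y hy).symm) x.2⟩

lemma HasDerivOn.continuous (h : HasDerivOn f g) : Continuous f := by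
  have hcont : ContinuousOn (Function.extend Subtype.val f 0) S := fun x hx =>
    (h ⟨x, hx⟩).continuousWithinAt
  have hdom : S.domRestrict (Function.extend Subtype.val f 0) = f := funext fun x => extend_val f x
  simpa only [hdom] using hcont.domRestrict

lemma HasDerivOn.lipschitzWith (hS : Convex ℝ S) (h : HasDerivOn f g) {C : ℝ≥0}
    (hC : ∀ x, |g x| ≤ C) : LipschitzWith C f := by
  have hdom : S.domRestrict (Function.extend Subtype.val f 0) = f := funext fun x => extend_val f x
  have hf' : ∀ x ∈ S, HasDerivWithinAt (Function.extend Subtype.val f 0)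
      (Function.extend Subtype.val g 0 x) S x := fun x hx => by
    simpa only [← extend_val g ⟨x, hx⟩] using h ⟨x, hx⟩
  rw [← hdom, ← lipschitzOnWith_iff_restrict]
  refine hS.lipschitzOnWith_of_nnnorm_hasDerivWithin_le hf' fun x hx => ?_
  rw [← NNReal.coe_le_coe, coe_nnnorm, extend_val g ⟨x, hx⟩]
  exact hC ⟨x, hx⟩

end HasDerivOn

section Cell

variable {ℓ : ℝ}

/-- The restriction to the cell of a function on the circle. -/
def restr : C(AddCircle ℓ, ℝ) →ₗ[ℝ] (Cell ℓ → ℝ) where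
  toFun F η := F ((η : ℝ) : AddCircle ℓ)
  map_add' _ _ := rfl
  map_smul' _ _ := rfl

lemma restr_apply (F : C(AddCircle ℓ, ℝ)) (η : Cell ℓ) :
    restr F η = F ((η : ℝ) : AddCircle ℓ) := rfl

lemma continuous_restr (F : C(AddCircle ℓ, ℝ)) : Continuous (restr F) :=
  F.continuous.comp ((AddCircle.continuous_mk' ℓ).comp continuous_subtype_val)

lemma neg_half_add : -ℓ / 2 + ℓ = ℓ / 2 := by ring

lemma coe_half_eq : ((ℓ / 2 : ℝ) : AddCircle ℓ) = ((-ℓ / 2 : ℝ) : AddCircle ℓ) := by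
  rw [← neg_half_add, AddCircle.coe_add_period]

lemma endsAgree_restr (F : C(AddCircle ℓ, ℝ)) : EndsAgree (restr F) := fun a b ha hb => by
  rw [restr_apply, restr_apply, ha, hb, coe_half_eq]

variable [hℓ : Fact (0 < ℓ)]

lemma neg_half_le_half : -ℓ / 2 ≤ ℓ / 2 := by
  linarith [hℓ.out]

lemma uniqueDiffOn_cell : UniqueDiffOn ℝ (Cell ℓ) :=
  uniqueDiffOn_Icc (by linarith [hℓ.out])

lemma exists_cell_eq (t : AddCircle ℓ) : ∃ η : Cell ℓ, ((η : ℝ) : AddCircle ℓ) = t := by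
  have ht : t ∈ ((↑) : ℝ → AddCircle ℓ) '' Set.Icc (-ℓ / 2) (-ℓ / 2 + ℓ) := by
    rw [AddCircle.coe_image_Icc_eq]
    exact Set.mem_univ t
  obtain ⟨x, hx, rfl⟩ := ht
  exact ⟨⟨x, by rwa [neg_half_add] at hx⟩, rfl⟩

lemma restr_injective : Function.Injective (restr (ℓ := ℓ)) := fun F G h => by
  ext t
  obtain ⟨η, rfl⟩ := exists_cell_eq t
  exact congrFun h η

lemma exists_restr_eq {f : Cell ℓ → ℝ} (hf : Continuous f) (he : EndsAgree f) :
    ∃ F, restr F = f := by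
  have hc : Continuous (Set.IccExtend (neg_half_le_half (ℓ := ℓ)) f) := hf.Icc_extend'
  have hend : Set.IccExtend (neg_half_le_half (ℓ := ℓ)) f (-ℓ / 2) =
      Set.IccExtend (neg_half_le_half (ℓ := ℓ)) f (-ℓ / 2 + ℓ) := by
    rw [neg_half_add, Set.IccExtend_left, Set.IccExtend_right]
    exact he _ _ rfl rfl
  refine ⟨⟨AddCircle.liftIco ℓ (-ℓ / 2) _, AddCircle.liftIco_continuous hend hc.continuousOn⟩, ?_⟩
  ext η
  rw [restr_apply, ContinuousMap.coe_mk]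
  rcases η.2.2.lt_or_eq with h | h
  · refine (AddCircle.liftIco_coe_apply ⟨η.2.1, by rwa [neg_half_add]⟩).trans ?_
    rw [Set.IccExtend_of_mem _ _ η.2]
  · rw [h, coe_half_eq]
    refine (AddCircle.liftIco_coe_apply ⟨le_rfl, lt_add_of_pos_right _ hℓ.out⟩).trans ?_
    rw [Set.IccExtend_left]
    exact he _ _ rfl h

lemma norm_eq_iSup_restr (F : C(AddCircle ℓ, ℝ)) : ‖F‖ = ⨆ η : Cell ℓ, |restr F η| := by
  have hbdd : BddAbove (Set.range fun η : Cell ℓ => |restr F η|) :=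
    ⟨‖F‖, by rintro _ ⟨η, rfl⟩; exact F.norm_coe_le_norm _⟩
  have : Nonempty (Cell ℓ) := ⟨⟨_, Set.left_mem_Icc.2 neg_half_le_half⟩⟩
  refine le_antisymm ?_ (ciSup_le fun η => F.norm_coe_le_norm _)
  refine (ContinuousMap.norm_le _ (Real.iSup_nonneg fun _ => abs_nonneg _)).2 fun t => ?_
  obtain ⟨η, rfl⟩ := exists_cell_eq t
  exact le_ciSup hbdd η

lemma continuous_fourier_mul_extend (n : ℤ) (g : C(Cell ℓ, ℝ)) :
    Continuous fun t : ℝ => fourier (-n) (t : AddCircle ℓ) *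
      ((g.IccExtend neg_half_le_half t : ℝ) : ℂ) :=
  ((map_continuous (fourier (-n))).comp (AddCircle.continuous_mk' ℓ)).mul
    (continuous_ofReal.comp (map_continuous _))

/-- The `n`-th Fourier coefficient of a continuous function on the cell, whose values at the two end
points may differ. -/
def cellCoeff (n : ℤ) : C(Cell ℓ, ℝ) →L[ℝ] ℂ :=
  LinearMap.mkContinuous
    { toFun := fun g => (1 / ℓ : ℝ) • ∫ t in (-ℓ / 2)..(ℓ / 2),
        fourier (-n) (t : AddCircle ℓ) * ((g.IccExtend neg_half_le_half t : ℝ) : ℂ)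
      map_add' := fun g h => by
        rw [← smul_add, ← intervalIntegral.integral_add
          ((continuous_fourier_mul_extend n g).intervalIntegrable _ _)
          ((continuous_fourier_mul_extend n h).intervalIntegrable _ _)]
        simp only [ContinuousMap.coe_IccExtend, Set.IccExtend, Function.comp_apply,
          ContinuousMap.add_apply, ofReal_add, mul_add]
      map_smul' := fun c g => by
        rw [RingHom.id_apply, smul_comm, ← intervalIntegral.integral_smul c]
        simp only [ContinuousMap.coe_IccExtend, Set.IccExtend, Function.comp_apply,
          ContinuousMap.smul_apply, smul_eq_mul, ofReal_mul, real_smul, mul_left_comm] }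
    1 fun g => by
      have hle := intervalIntegral.norm_integral_le_of_norm_le_const (a := -ℓ / 2) (b := ℓ / 2)
        (f := fun t => fourier (-n) (t : AddCircle ℓ) *
          ((g.IccExtend neg_half_le_half t : ℝ) : ℂ)) (C := ‖g‖) fun t _ => by
            rw [norm_mul, norm_fourier_apply, one_mul, norm_real]
            exact g.norm_coe_le_norm _
      rw [show ℓ / 2 - -ℓ / 2 = ℓ by ring, abs_of_pos hℓ.out] at hle
      rw [LinearMap.coe_mk, AddHom.coe_mk, norm_smul, Real.norm_of_nonneg (by simp [hℓ.out.le]),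
        one_mul, one_div, inv_mul_le_iff₀ hℓ.out, mul_comm]
      exact hle

lemma cellCoeff_eq_integral (n : ℤ) {g : C(Cell ℓ, ℝ)} {G : ℝ → ℝ} (hG : ∀ η : Cell ℓ, G η = g η) :
    cellCoeff n g = (1 / ℓ : ℝ) • ∫ t in (-ℓ / 2)..(ℓ / 2),
      fourier (-n) (t : AddCircle ℓ) * (G t : ℂ) := by
  refine congrArg (fun z : ℂ => (1 / ℓ : ℝ) • z) (intervalIntegral.integral_congr fun t ht => ?_)
  rw [Set.uIcc_of_le neg_half_le_half] at ht
  rw [ContinuousMap.coe_IccExtend, Set.IccExtend_of_mem _ _ ht, hG ⟨t, ht⟩]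

lemma cellCoeff_of_eq_restr (n : ℤ) {g : C(Cell ℓ, ℝ)} {F : C(AddCircle ℓ, ℝ)} (h : g = restr F) :
    cellCoeff n g = coeff n F := by
  rw [cellCoeff_eq_integral n (G := fun t => F t) fun η => by rw [h, restr_apply],
    coeff_eq_fourierCoeff, fourierCoeff_eq_intervalIntegral _ n (-ℓ / 2), neg_half_add]
  simp only [smul_eq_mul]

variable (ℓ) in
/-- The Fourier symbol `2πin/ℓ` of `D_η`. -/
def freq (n : ℤ) : ℂ := 2 * Real.pi * I * n / ℓ

lemma cellCoeff_of_hasDerivOn (n : ℤ) {g g' : C(Cell ℓ, ℝ)} (h : HasDerivOn g g')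
    (he : EndsAgree g) : cellCoeff n g' = freq ℓ n * cellCoeff n g := by
  set E : C(ℝ, ℝ) := g.IccExtend neg_half_le_half with hE
  set E' : C(ℝ, ℝ) := g'.IccExtend neg_half_le_half
  have hEval : ∀ η : Cell ℓ, E η = g η := fun η => Set.IccExtend_of_mem _ _ η.2
  have hEval' : ∀ η : Cell ℓ, E' η = g' η := fun η => Set.IccExtend_of_mem _ _ η.2
  have hderiv : ∀ t ∈ Set.Ioo (-ℓ / 2) (ℓ / 2), HasDerivAt (fun t => (E t : ℂ)) (E' t) t :=
    fun t ht => by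
      have hmem := Set.Ioo_subset_Icc_self ht
      have := (hasDerivOn_iff_of_eqOn hEval).1 h ⟨t, hmem⟩
      rw [← hEval' ⟨t, hmem⟩] at this
      exact (this.hasDerivAt (Icc_mem_nhds ht.1 ht.2)).ofReal_comp
  have hfourier : Continuous fun t : ℝ => (fourier (-n) (t : AddCircle ℓ) : ℂ) :=
    (map_continuous (fourier (-n))).comp (AddCircle.continuous_mk' ℓ)
  have hends : E (ℓ / 2) = E (-ℓ / 2) := by
    rw [hE, ContinuousMap.coe_IccExtend, Set.IccExtend_left, Set.IccExtend_right]
    exact (he _ _ rfl rfl).symm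
  have hparts := intervalIntegral.integral_mul_deriv_eq_deriv_mul_of_hasDerivAt
    (a := -ℓ / 2) (b := ℓ / 2) hfourier.continuousOn
    (continuous_ofReal.comp E.continuous).continuousOn
    (fun t _ => hasDerivAt_fourier_neg ℓ n t)
    (by rwa [min_eq_left neg_half_le_half, max_eq_right neg_half_le_half])
    ((hfourier.const_mul _).intervalIntegrable _ _)
    ((continuous_ofReal.comp E'.continuous).intervalIntegrable _ _)
  simp only [Function.comp_apply] at hparts
  rw [hends, coe_half_eq, sub_self, zero_sub, ← intervalIntegral.integral_neg] at hparts
  rw [cellCoeff_eq_integral n hEval', cellCoeff_eq_integral n hEval, mul_smul_comm,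
    ← intervalIntegral.integral_const_mul]
  refine congrArg _ (hparts.trans (congrArg (intervalIntegral · _ _ _) (funext fun t => ?_)))
  rw [freq]
  ring

lemma coeff_of_hasDerivOn {F G : C(AddCircle ℓ, ℝ)} (h : HasDerivOn (restr F) (restr G)) (n : ℤ) :
    coeff n G = freq ℓ n * coeff n F := by
  have := cellCoeff_of_hasDerivOn n (g := ⟨_, continuous_restr F⟩) (g' := ⟨_, continuous_restr G⟩) h
    (endsAgree_restr F)
  rwa [cellCoeff_of_eq_restr n rfl, cellCoeff_of_eq_restr n rfl] at this

lemma exists_hasDerivOn_restr {G : C(AddCircle ℓ, ℝ)} (hG : coeff 0 G = 0) :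
    ∃ F, HasDerivOn (restr F) (restr G) := by
  have hcont : Continuous fun t : ℝ => G (t : AddCircle ℓ) :=
    G.continuous.comp (AddCircle.continuous_mk' ℓ)
  set P : ℝ → ℝ := fun t => ∫ s in (-ℓ / 2)..t, G (s : AddCircle ℓ) with hP
  have hderiv : HasDerivOn (fun η : Cell ℓ => P η) (restr G) :=
    (hasDerivOn_iff_of_eqOn fun _ => rfl).2 fun η =>
      (intervalIntegral.integral_hasDerivAt_right (hcont.intervalIntegrable _ _)
        (hcont.stronglyMeasurableAtFilter _ _) hcont.continuousAt).hasDerivWithinAt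
  have hmean : P (ℓ / 2) = 0 := by
    rw [coeff_eq_fourierCoeff, fourierCoeff_eq_intervalIntegral _ 0 (-ℓ / 2), neg_half_add] at hG
    simpa [hℓ.out.ne', intervalIntegral.integral_ofReal] using hG
  obtain ⟨F, hF⟩ := exists_restr_eq hderiv.continuous fun a b ha hb => by
    rw [ha, hb, hmean, hP]
    exact intervalIntegral.integral_same
  exact ⟨F, hF ▸ hderiv⟩

theorem hasDerivOn_restr_iff {F G : C(AddCircle ℓ, ℝ)} :
    HasDerivOn (restr F) (restr G) ↔ ∀ n, coeff n G = freq ℓ n * coeff n F := by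
  refine ⟨coeff_of_hasDerivOn, fun h => ?_⟩
  obtain ⟨P, hP⟩ := exists_hasDerivOn_restr (G := G) (by simp [h, freq])
  obtain ⟨c, hc⟩ := eq_const_of_coeff_eq_zero (F := F - P) fun n hn => by
    have hne : freq ℓ n ≠ 0 := by simp [freq, hn, hℓ.out.ne', Real.pi_ne_zero]
    rw [map_sub, sub_eq_zero, ← mul_right_inj' hne, ← h, coeff_of_hasDerivOn hP]
  have hshift : ∀ t : AddCircle ℓ, P t + c = F t := fun t => by
    rw [← sub_add_cancel F P, hc, ContinuousMap.add_apply, ContinuousMap.const_apply, add_comm]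
  refine (hasDerivOn_iff_of_eqOn (F := fun s : ℝ => P s + c) fun η => hshift _).2 fun η => ?_
  exact ((hasDerivOn_iff_of_eqOn (F := fun s : ℝ => P s) fun _ => rfl).1 hP η).add_const c

end Cell

section Holder

lemma holderWith_of_dist_le {X Y : Type*} [PseudoMetricSpace X] [PseudoMetricSpace Y] {C θ : ℝ≥0}
    {f : X → Y} (h : ∀ x y, dist (f x) (f y) ≤ C * dist x y ^ (θ : ℝ)) : HolderWith C θ f :=
  fun x y => by
    rw [edist_nndist, edist_nndist, ← ENNReal.coe_rpow_of_nonneg _ θ.coe_nonneg, ← ENNReal.coe_mul,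
      ENNReal.coe_le_coe, ← NNReal.coe_le_coe]
    exact_mod_cast h x y

variable {ℓ : ℝ} {C θ : ℝ≥0} {F : C(AddCircle ℓ, ℝ)}

lemma holderWith_restr (hF : HolderWith C θ F) : HolderWith C θ (restr F) :=
  holderWith_of_dist_le fun x y => by
    refine hF.dist_le_of_le ?_
    rw [dist_eq_norm, ← AddCircle.coe_sub]
    exact QuotientAddGroup.norm_mk_le_norm

variable [hℓ : Fact (0 < ℓ)]

lemma dist_coe_eq {x y : ℝ} (h : |x - y| ≤ ℓ / 2) :
    dist (x : AddCircle ℓ) (y : AddCircle ℓ) = |x - y| := by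
  rw [dist_eq_norm, ← AddCircle.coe_sub, AddCircle.norm_coe_eq_abs_iff _ hℓ.out.ne',
    abs_of_pos hℓ.out]
  exact h

lemma holderWith_of_restr (hF : HolderWith C θ (restr F)) : HolderWith (2 * C) θ F := by
  have hcell : ∀ x y : Cell ℓ, (x : ℝ) ≤ y → dist (F (x : ℝ)) (F (y : ℝ)) ≤
      2 * C * dist ((x : ℝ) : AddCircle ℓ) ((y : ℝ) : AddCircle ℓ) ^ (θ : ℝ) := fun x y hxy => by
    rcases le_or_gt ((y : ℝ) - x) (ℓ / 2) with hnear | hfar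
    · rw [← abs_of_nonneg (sub_nonneg.2 hxy), abs_sub_comm] at hnear
      rw [dist_coe_eq hnear]
      refine (hF.dist_le x y).trans ?_
      gcongr
      · linarith [C.coe_nonneg]
      · exact le_rfl
    -- The short way from `x` to `y` on the circle passes through the point `-ℓ/2 = ℓ/2`.
    · set d := ℓ - (y - x) with hd
      have hdist : dist ((x : ℝ) : AddCircle ℓ) ((y : ℝ) : AddCircle ℓ) = d := by
        have hd0 : |(x + ℓ : ℝ) - y| = d := by
          rw [abs_of_nonneg (by linarith [x.2.1, y.2.2]), hd]; ring
        rw [← AddCircle.coe_add_period ℓ x, dist_coe_eq (by linarith), hd0]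
      have hleft : dist (F (x : ℝ)) (F (-ℓ / 2 : ℝ)) ≤ C * d ^ (θ : ℝ) :=
        hF.dist_le_of_le (x := x) (y := ⟨-ℓ / 2, Set.left_mem_Icc.2 neg_half_le_half⟩) <| by
          rw [Subtype.dist_eq, Real.dist_eq, abs_of_nonneg (by linarith [x.2.1])]
          linarith [y.2.2]
      have hright : dist (F (-ℓ / 2 : ℝ)) (F (y : ℝ)) ≤ C * d ^ (θ : ℝ) := by
        rw [← coe_half_eq]
        refine hF.dist_le_of_le (x := ⟨ℓ / 2, Set.right_mem_Icc.2 neg_half_le_half⟩) (y := y) ?_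
        rw [Subtype.dist_eq, Real.dist_eq, abs_of_nonneg (by linarith [y.2.2])]
        linarith [x.2.1]
      rw [hdist]
      linarith [dist_triangle (F (x : ℝ)) (F (-ℓ / 2 : ℝ)) (F (y : ℝ))]
  refine holderWith_of_dist_le fun s t => ?_
  obtain ⟨x, rfl⟩ := exists_cell_eq s
  obtain ⟨y, rfl⟩ := exists_cell_eq t
  push_cast
  rcases le_total (x : ℝ) y with h | h
  · exact hcell x y h
  · rw [dist_comm, dist_comm ((x : ℝ) : AddCircle ℓ)]
    exact hcell y x h

/-- A multiplier commutes with translations, hence preserves moduli of continuity. -/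
theorem holderWith_multiplier {κ : ℤ → ℂ} {M : C(AddCircle ℓ, ℝ) →L[ℝ] C(AddCircle ℓ, ℝ)}
    (hM : IsMultiplier κ M) (hF : HolderWith C θ F) : HolderWith (‖M‖₊ * C) θ (M F) :=
  holderWith_of_dist_le fun s t => by
    have htrans : ‖F.comp (.addRight (s - t)) - F‖ ≤ C * dist s t ^ (θ : ℝ) :=
      (ContinuousMap.norm_le _ (by positivity)).2 fun r =>
        hF.dist_le_of_le (by simp [dist_eq_norm])
    calc dist (M F s) (M F t) = ‖(M (F.comp (.addRight (s - t)) - F)) t‖ := by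
          rw [map_sub, hM.comp_addRight, dist_eq_norm]; simp
      _ ≤ ‖M (F.comp (.addRight (s - t)) - F)‖ := ContinuousMap.norm_coe_le_norm _ _
      _ ≤ ‖M‖ * ‖F.comp (.addRight (s - t)) - F‖ := M.le_opNorm _
      _ ≤ ‖M‖ * (C * dist s t ^ (θ : ℝ)) := by gcongr
      _ = (‖M‖₊ * C : ℝ≥0) * dist s t ^ (θ : ℝ) := by push_cast; ring

end Holder

section CSharp

variable {ℓ : ℝ} {k : ℕ} {θ : ℝ≥0} {f : Cell ℓ → ℝ}

lemma mem_cSharp_zero_iff :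
    f ∈ CSharp ℓ 0 θ ↔ Continuous f ∧ MemHolder θ f ∧ EndsAgree f := by
  constructor
  · rintro ⟨d, rfl, -, hc, hθ, he⟩
    exact ⟨hc, hθ, he 0 le_rfl⟩
  · rintro ⟨hc, hθ, he⟩
    exact ⟨fun _ => f, rfl, fun j hj => absurd hj (Nat.not_lt_zero j), hc, hθ, fun _ _ => he⟩

lemma mem_cSharp_succ_iff :
    f ∈ CSharp ℓ (k + 1) θ ↔ EndsAgree f ∧ ∃ f' ∈ CSharp ℓ k θ, HasDerivOn f f' := by
  constructor
  · rintro ⟨d, rfl, hd, hc, hθ, he⟩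
    exact ⟨he 0 (Nat.zero_le _), d 1, ⟨fun j => d (j + 1), rfl,
      fun j hj => hd _ (Nat.succ_lt_succ hj), hc, hθ, fun j hj => he _ (Nat.succ_le_succ hj)⟩,
      hd 0 (Nat.succ_pos k)⟩
  · rintro ⟨he, f', ⟨d, rfl, hd, hc, hθ, hde⟩, hf⟩
    refine ⟨fun j => j.casesOn f d, rfl, fun j hj => ?_, hc, hθ, fun j hj => ?_⟩
    · cases j with
      | zero => exact hf
      | succ j => exact hd j (Nat.lt_of_succ_lt_succ hj)
    · cases j with
      | zero => exact he
      | succ j => exact hde j (Nat.le_of_succ_le_succ hj)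

lemma continuous_of_mem_cSharp (h : f ∈ CSharp ℓ k θ) : Continuous f := by
  cases k with
  | zero => exact (mem_cSharp_zero_iff.1 h).1
  | succ k =>
    obtain ⟨-, f', -, hf⟩ := mem_cSharp_succ_iff.1 h
    exact hf.continuous

lemma memHolder_of_cSharp (g : CSharp ℓ 0 θ) : MemHolder θ (g : Cell ℓ → ℝ) :=
  (mem_cSharp_zero_iff.1 g.2).2.1

lemma endsAgree_of_mem_cSharp (h : f ∈ CSharp ℓ k θ) : EndsAgree f := by
  cases k with
  | zero => exact (mem_cSharp_zero_iff.1 h).2.2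
  | succ k => exact (mem_cSharp_succ_iff.1 h).1

variable [hℓ : Fact (0 < ℓ)]

lemma cSharp_le_range_restr : CSharp ℓ k θ ≤ LinearMap.range (restr (ℓ := ℓ)) := fun _ hf =>
  exists_restr_eq (continuous_of_mem_cSharp hf) (endsAgree_of_mem_cSharp hf)

/-- The function on the circle whose restriction to the cell is a given element of `C_♯^{k+θ}`. -/
def circleLift : CSharp ℓ k θ →ₗ[ℝ] C(AddCircle ℓ, ℝ) :=
  (LinearEquiv.ofInjective restr restr_injective).symm.toLinearMap ∘ₗ
    Submodule.inclusion cSharp_le_range_restr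

@[simp] lemma restr_circleLift (f : CSharp ℓ k θ) : restr (circleLift f) = f :=
  congrArg Subtype.val ((LinearEquiv.ofInjective restr restr_injective).apply_symm_apply
    (Submodule.inclusion cSharp_le_range_restr f))

lemma circleLift_eq_iff {f : CSharp ℓ k θ} {F : C(AddCircle ℓ, ℝ)} :
    circleLift f = F ↔ f = restr F := by
  rw [← restr_injective.eq_iff, restr_circleLift]

lemma circleLift_inclusion {j : ℕ} (h : CSharp ℓ k θ ≤ CSharp ℓ j θ) (f : CSharp ℓ k θ) :
    circleLift (Submodule.inclusion h f) = circleLift f :=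
  circleLift_eq_iff.2 (restr_circleLift f).symm

lemma circleLift_injective : Function.Injective (circleLift (ℓ := ℓ) (k := k) (θ := θ)) :=
  fun f g h => Subtype.ext (by rw [← restr_circleLift f, h, restr_circleLift])

lemma hasDerivOn_derivOn (f : CSharp ℓ (k + 1) θ) :
    HasDerivOn (f : Cell ℓ → ℝ) (derivOn (f : Cell ℓ → ℝ)) := by
  obtain ⟨-, f', -, hf⟩ := mem_cSharp_succ_iff.1 f.2
  rwa [hf.derivOn_eq uniqueDiffOn_cell]

/-- `D_η`, as a linear map from `C_♯^{k+1+θ}` to `C_♯^{k+θ}`. -/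
def derivative : CSharp ℓ (k + 1) θ →ₗ[ℝ] CSharp ℓ k θ where
  toFun f := ⟨derivOn (f : Cell ℓ → ℝ), by
    obtain ⟨-, f', hf', hf⟩ := mem_cSharp_succ_iff.1 f.2
    rwa [hf.derivOn_eq uniqueDiffOn_cell]⟩
  map_add' f g := Subtype.ext <|
    ((hasDerivOn_derivOn f).add (hasDerivOn_derivOn g)).derivOn_eq uniqueDiffOn_cell
  map_smul' c f := Subtype.ext <| ((hasDerivOn_derivOn f).smul c).derivOn_eq uniqueDiffOn_cell

lemma hasDerivOn_derivative (f : CSharp ℓ (k + 1) θ) :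
    HasDerivOn (f : Cell ℓ → ℝ) (derivative f : Cell ℓ → ℝ) :=
  hasDerivOn_derivOn f

lemma coeff_circleLift_derivative (f : CSharp ℓ (k + 1) θ) (n : ℤ) :
    coeff n (circleLift (derivative f)) = freq ℓ n * coeff n (circleLift f) := by
  refine hasDerivOn_restr_iff.1 ?_ n
  rw [restr_circleLift, restr_circleLift]
  exact hasDerivOn_derivative f

lemma abs_le_norm_circleLift (f : CSharp ℓ k θ) (η : Cell ℓ) : |(f : Cell ℓ → ℝ) η| ≤
    ‖circleLift f‖ := by
  rw [← restr_circleLift f]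
  exact (circleLift f).norm_coe_le_norm _

lemma holderWith_of_cSharp_one (hθ : θ ≤ 1) (f : CSharp ℓ 1 θ) :
    HolderWith (‖circleLift (derivative f)‖₊ * ℓ.toNNReal ^ ((1 : ℝ) - θ)) θ
      (f : Cell ℓ → ℝ) := by
  have hlip : LipschitzWith ‖circleLift (derivative f)‖₊ (f : Cell ℓ → ℝ) :=
    (hasDerivOn_derivative f).lipschitzWith (convex_Icc _ _)
      (abs_le_norm_circleLift (derivative f))
  have hdist : ∀ x y : Cell ℓ, edist x y ≤ ℓ.toNNReal := fun x y => by
    rw [edist_nndist, ENNReal.coe_le_coe, ← NNReal.coe_le_coe, coe_nndist,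
      Real.coe_toNNReal _ hℓ.out.le, Subtype.dist_eq]
    exact (Real.dist_le_of_mem_Icc x.2 y.2).trans_eq (by ring)
  simpa using (holderWith_one.2 hlip).of_le hdist hθ

lemma cSharp_succ_le (hθ : θ ≤ 1) : CSharp ℓ (k + 1) θ ≤ CSharp ℓ k θ := by
  induction k with
  | zero => exact fun f hf => mem_cSharp_zero_iff.2 ⟨continuous_of_mem_cSharp hf,
      (holderWith_of_cSharp_one hθ ⟨f, hf⟩).memHolder, endsAgree_of_mem_cSharp hf⟩
  | succ k ih =>
    intro f hf
    obtain ⟨he, f', hf', hd⟩ := mem_cSharp_succ_iff.1 hf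
    exact mem_cSharp_succ_iff.2 ⟨he, f', ih hf', hd⟩

end CSharp

section HolderNorm

variable {ℓ : ℝ} {k : ℕ} {θ : ℝ≥0}

lemma holderNorm_nonneg (f : Cell ℓ → ℝ) : 0 ≤ holderNorm k θ f :=
  add_nonneg (Finset.sum_nonneg fun _ _ => Real.iSup_nonneg fun _ => abs_nonneg _)
    (NNReal.coe_nonneg _)

variable [hℓ : Fact (0 < ℓ)]

lemma holderNorm_zero_eq (g : CSharp ℓ 0 θ) :
    holderNorm 0 θ (g : Cell ℓ → ℝ) = ‖circleLift g‖ + nnHolderNorm θ (g : Cell ℓ → ℝ) := by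
  simp [holderNorm, norm_eq_iSup_restr]

lemma holderNorm_succ_eq (f : CSharp ℓ (k + 1) θ) :
    holderNorm (k + 1) θ (f : Cell ℓ → ℝ) =
      ‖circleLift f‖ + holderNorm k θ (derivative f : Cell ℓ → ℝ) := by
  rw [norm_eq_iSup_restr, restr_circleLift, holderNorm, Finset.sum_range_succ', holderNorm,
    add_comm _ (iSup _), add_assoc]
  rfl

lemma holderNorm_zero_le_one (hθ : θ ≤ 1) (f : CSharp ℓ 1 θ) :
    holderNorm 0 θ (f : Cell ℓ → ℝ) ≤
      max 1 (ℓ ^ (1 - (θ : ℝ))) * holderNorm 1 θ (f : Cell ℓ → ℝ) := by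
  set K : ℝ := max 1 (ℓ ^ (1 - (θ : ℝ)))
  have hlift : ‖circleLift f‖ ≤ K * ‖circleLift f‖ :=
    le_mul_of_one_le_left (norm_nonneg _) (le_max_left _ _)
  have hholder : (nnHolderNorm θ (f : Cell ℓ → ℝ) : ℝ) ≤ K * ‖circleLift (derivative f)‖ := by
    calc (nnHolderNorm θ (f : Cell ℓ → ℝ) : ℝ)
        ≤ ‖circleLift (derivative f)‖ * ℓ ^ (1 - (θ : ℝ)) := by
          have h := NNReal.coe_le_coe.2 (holderWith_of_cSharp_one hθ f).nnholderNorm_le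
          rwa [NNReal.coe_mul, NNReal.coe_rpow, Real.coe_toNNReal _ hℓ.out.le] at h
      _ ≤ K * ‖circleLift (derivative f)‖ := by
          rw [mul_comm]
          gcongr
          exact le_max_right _ _
  have hnonneg : 0 ≤ K * nnHolderNorm θ (derivative f : Cell ℓ → ℝ) := by positivity
  have hincl := holderNorm_zero_eq (Submodule.inclusion (cSharp_succ_le hθ) f)
  rw [circleLift_inclusion] at hincl
  rw [holderNorm_succ_eq, holderNorm_zero_eq]
  refine hincl.trans_le ?_
  rw [Submodule.coe_inclusion]
  linarith

lemma holderNorm_le_succ (hθ : θ ≤ 1) (f : CSharp ℓ (k + 1) θ) :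
    holderNorm k θ (f : Cell ℓ → ℝ) ≤
      max 1 (ℓ ^ (1 - (θ : ℝ))) * holderNorm (k + 1) θ (f : Cell ℓ → ℝ) := by
  induction k with
  | zero => exact holderNorm_zero_le_one hθ f
  | succ k ih =>
    have hincl := holderNorm_succ_eq (Submodule.inclusion (cSharp_succ_le hθ) f)
    rw [circleLift_inclusion] at hincl
    rw [holderNorm_succ_eq f, mul_add]
    exact hincl.trans_le (add_le_add
      (le_mul_of_one_le_left (norm_nonneg _) (le_max_left _ _)) (ih (derivative f)))

/-- The norm of `C_♯^θ`, as a seminorm. -/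
def holderSeminorm (ℓ : ℝ) [Fact (0 < ℓ)] (θ : ℝ≥0) : Seminorm ℝ (CSharp ℓ 0 θ) :=
  .of (fun g => holderNorm 0 θ (g : Cell ℓ → ℝ))
    (fun f g => by
      have hadd : (nnHolderNorm θ (f + g : Cell ℓ → ℝ) : ℝ) ≤ _ := NNReal.coe_le_coe.2
        ((memHolder_of_cSharp f).nnHolderNorm_add_le (memHolder_of_cSharp g))
      rw [NNReal.coe_add] at hadd
      rw [holderNorm_zero_eq (f + g), holderNorm_zero_eq, holderNorm_zero_eq, map_add,
        Submodule.coe_add]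
      linarith [norm_add_le (circleLift f) (circleLift g)])
    fun c g => by
      rw [holderNorm_zero_eq (c • g), holderNorm_zero_eq, map_smul, Submodule.coe_smul, norm_smul,
        (memHolder_of_cSharp g).nnHolderNorm_smul, NNReal.coe_mul, coe_nnnorm, mul_add]

lemma holderSeminorm_apply (g : CSharp ℓ 0 θ) :
    holderSeminorm ℓ θ g = holderNorm 0 θ (g : Cell ℓ → ℝ) := rfl

variable {κ : ℤ → ℂ} {M : C(AddCircle ℓ, ℝ) →L[ℝ] C(AddCircle ℓ, ℝ)}

lemma holderWith_restr_multiplier (hM : IsMultiplier κ M) (g : CSharp ℓ 0 θ) :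
    HolderWith (‖M‖₊ * (2 * nnHolderNorm θ (g : Cell ℓ → ℝ))) θ (restr (M (circleLift g))) :=
  holderWith_restr <| holderWith_multiplier hM <| holderWith_of_restr <| by
    rw [restr_circleLift]
    exact (memHolder_of_cSharp g).holderWith

/-- A multiplier on the continuous functions, restricted to `C_♯^θ`. -/
def cSharpMultiplier (hM : IsMultiplier κ M) : CSharp ℓ 0 θ →ₗ[ℝ] CSharp ℓ 0 θ :=
  (restr ∘ₗ (M : C(AddCircle ℓ, ℝ) →ₗ[ℝ] C(AddCircle ℓ, ℝ)) ∘ₗ circleLift).codRestrict _ fun g =>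
    mem_cSharp_zero_iff.2 ⟨continuous_restr _, (holderWith_restr_multiplier hM g).memHolder,
      endsAgree_restr _⟩

lemma circleLift_cSharpMultiplier (hM : IsMultiplier κ M) (g : CSharp ℓ 0 θ) :
    circleLift (cSharpMultiplier hM g) = M (circleLift g) :=
  circleLift_eq_iff.2 rfl

lemma holderSeminorm_cSharpMultiplier_le (hM : IsMultiplier κ M) (g : CSharp ℓ 0 θ) :
    holderSeminorm ℓ θ (cSharpMultiplier hM g) ≤ 2 * ‖M‖ * holderSeminorm ℓ θ g := by
  have hholder : (nnHolderNorm θ (cSharpMultiplier hM g : Cell ℓ → ℝ) : ℝ) ≤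
      ‖M‖ * (2 * nnHolderNorm θ (g : Cell ℓ → ℝ)) :=
    mod_cast (holderWith_restr_multiplier hM g).nnholderNorm_le
  have hsup := M.le_opNorm (circleLift g)
  simp only [holderSeminorm_apply, holderNorm_zero_eq, circleLift_cSharpMultiplier]
  have : 0 ≤ ‖M‖ * ‖circleLift g‖ := by positivity
  linarith

end HolderNorm

/-- The eigenvalue of `-ε D_ηη` on the `n`-th Fourier mode. -/
def modeEig (ℓ ε : ℝ) (n : ℤ) : ℝ := ε * (2 * Real.pi * n / ℓ) ^ 2

/-- The larger root of `r² - r = μ`. -/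
def charRoot (μ : ℝ) : ℝ := (1 + √(1 + 4 * μ)) / 2

/-- The growth exponent `r` of the `n`-th Fourier mode: `e^{rx}` and `e^{(1-r)x}` are the solutions
of `v'' - v' = μ v`, where `μ` is the eigenvalue of the mode. -/
def modeRoot (ℓ ε : ℝ) (n : ℤ) : ℝ := charRoot (modeEig ℓ ε n)

section CharRoot

variable {μ : ℝ}

lemma charRoot_mul (hμ : 0 ≤ μ) : charRoot μ * (charRoot μ - 1) = μ := by
  rw [charRoot]
  linear_combination Real.sq_sqrt (show 0 ≤ 1 + 4 * μ by linarith) / 4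

lemma one_le_charRoot (hμ : 0 ≤ μ) : 1 ≤ charRoot μ := by
  have : 1 ≤ √(1 + 4 * μ) := Real.one_le_sqrt.2 (by linarith)
  rw [charRoot]
  linarith

lemma one_lt_charRoot (hμ : 0 < μ) : 1 < charRoot μ := by
  refine (one_le_charRoot hμ.le).lt_of_ne fun h => hμ.ne ?_
  rw [← charRoot_mul hμ.le, ← h, sub_self, mul_zero]

end CharRoot

section Modes

variable {ℓ ε : ℝ}

lemma modeEig_eq (n : ℤ) : modeEig ℓ ε n = ε * (2 * Real.pi / ℓ) ^ 2 * (n : ℝ) ^ 2 := by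
  rw [modeEig]
  ring

lemma modeEig_nonneg (hε : 0 < ε) (n : ℤ) : 0 ≤ modeEig ℓ ε n := by
  rw [modeEig]
  positivity

lemma modeEig_pos [hℓ : Fact (0 < ℓ)] (hε : 0 < ε) {n : ℤ} (hn : n ≠ 0) : 0 < modeEig ℓ ε n := by
  have := hℓ.out
  have : (n : ℝ) ≠ 0 := Int.cast_ne_zero.2 hn
  rw [modeEig_eq]
  positivity

lemma modeEig_coe (n : ℤ) : (modeEig ℓ ε n : ℂ) = -(ε * freq ℓ n ^ 2) := by
  simp only [modeEig, freq]
  push_cast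
  linear_combination (ε * (2 * Real.pi * n / ℓ) ^ 2 : ℂ) * Complex.I_sq

lemma modeRoot_mul (hε : 0 < ε) (n : ℤ) :
    modeRoot ℓ ε n * (modeRoot ℓ ε n - 1) = modeEig ℓ ε n :=
  charRoot_mul (modeEig_nonneg hε n)

lemma one_le_modeRoot (hε : 0 < ε) (n : ℤ) : 1 ≤ modeRoot ℓ ε n :=
  one_le_charRoot (modeEig_nonneg hε n)

lemma one_lt_modeRoot [Fact (0 < ℓ)] (hε : 0 < ε) {n : ℤ} (hn : n ≠ 0) : 1 < modeRoot ℓ ε n :=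
  one_lt_charRoot (modeEig_pos hε hn)

lemma modeRoot_neg (n : ℤ) : modeRoot ℓ ε (-n) = modeRoot ℓ ε n := by
  rw [modeRoot, modeRoot, modeEig_eq, modeEig_eq, Int.cast_neg, neg_sq]

lemma freq_neg (n : ℤ) : freq ℓ (-n) = conj (freq ℓ n) := by
  simp only [freq, map_div₀, map_mul, Complex.conj_I, Complex.conj_ofReal, map_ofNat, map_intCast]
  push_cast
  ring

lemma freq_sq (hε : 0 < ε) (n : ℤ) : freq ℓ n ^ 2 = ((-(modeEig ℓ ε n / ε) : ℝ) : ℂ) := by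
  have : (ε : ℂ) ≠ 0 := Complex.ofReal_ne_zero.2 hε.ne'
  push_cast
  rw [modeEig_coe]
  field_simp

lemma norm_freq_le (hε : 0 < ε) (n : ℤ) : ‖freq ℓ n‖ ≤ √(1 / ε) * modeRoot ℓ ε n := by
  have hr := one_le_modeRoot (ℓ := ℓ) hε n
  rw [← sq_le_sq₀ (norm_nonneg _) (by positivity), ← norm_pow, freq_sq hε, Complex.norm_real,
    norm_neg, Real.norm_of_nonneg (div_nonneg (modeEig_nonneg hε n) hε.le), mul_pow,
    Real.sq_sqrt (by positivity), ← modeRoot_mul hε, div_eq_inv_mul, one_div]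
  gcongr
  nlinarith

/-- The multiplier symbol that assigns to the `n`-th Fourier mode the value of `φ` at its growth
exponent. -/
def rootSymbol (ℓ ε : ℝ) (φ : ℝ → ℝ) (n : ℤ) : ℂ := (φ (modeRoot ℓ ε n) : ℝ)

lemma rootSymbol_neg (φ : ℝ → ℝ) (n : ℤ) :
    rootSymbol ℓ ε φ (-n) = conj (rootSymbol ℓ ε φ n) := by
  rw [rootSymbol, rootSymbol, modeRoot_neg, Complex.conj_ofReal]

/-- The symbol of `𝓑_ε`, in terms of the growth exponent `r`. -/
def symbB (r : ℝ) : ℝ := 3 * r * (2 * r ^ 2 - 1) / (2 * r + 1)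

/-- The symbol, in terms of the growth exponent `r`, of the smoothing operator that `𝓑_ε` involves
besides `1 - 3 ε D_ηη`. -/
def symbK (r : ℝ) : ℝ := 1 / r + 1 / (2 * r + 1)

lemma sq_le_symbB {r : ℝ} (hr : 1 ≤ r) : r ^ 2 ≤ symbB r := by
  rw [symbB, le_div_iff₀ (by linarith)]
  nlinarith [sq_nonneg (r - 1), mul_nonneg (zero_le_one.trans hr) (sq_nonneg (r - 1))]

lemma symbB_pos {r : ℝ} (hr : 1 ≤ r) : 0 < symbB r :=
  lt_of_lt_of_le (by positivity) (sq_le_symbB hr)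

lemma symbB_eq {r : ℝ} (hr : 1 ≤ r) :
    symbB r = 1 + 3 * (r * (r - 1)) + r * (r - 1) * symbK r := by
  have : r ≠ 0 := by linarith
  have : 2 * r + 1 ≠ 0 := by linarith
  rw [symbB, symbK]
  field_simp
  ring

lemma freq_sq_mul_inv_symbB (hε : 0 < ε) (n : ℤ) :
    freq ℓ n * (freq ℓ n * rootSymbol ℓ ε (fun r => 1 / symbB r) n) =
      ((-1 / (3 * ε) : ℝ) : ℂ) * (1 - rootSymbol ℓ ε (fun r => r / (2 * r ^ 2 - 1)) n) := by
  have hr := one_le_modeRoot (ℓ := ℓ) hε n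
  rw [← mul_assoc, ← sq, freq_sq hε, ← modeRoot_mul hε, rootSymbol, rootSymbol]
  simp only [← Complex.ofReal_one, ← Complex.ofReal_sub, ← Complex.ofReal_mul, Complex.ofReal_inj]
  have hne : 2 * modeRoot ℓ ε n ^ 2 - 1 ≠ 0 := by nlinarith
  rw [symbB, one_sub_div hne]
  field_simp
  ring

lemma summable_inv_modeEig : Summable fun n : ℤ => 1 / modeEig ℓ ε n :=
  ((Real.summable_one_div_int_pow.2 one_lt_two).mul_left
    (1 / (ε * (2 * Real.pi / ℓ) ^ 2))).congr fun n => by rw [modeEig_eq, one_div_mul_one_div]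

end Modes

section Multipliers

variable {ℓ : ℝ} [hℓ : Fact (0 < ℓ)] {ε C : ℝ}

lemma summable_inv_modeRoot_sq (hε : 0 < ε) : Summable fun n : ℤ => 1 / modeRoot ℓ ε n ^ 2 := by
  refine Summable.of_norm_bounded_eventually (summable_inv_modeEig (ℓ := ℓ) (ε := ε)) ?_
  filter_upwards [(Set.finite_singleton (0 : ℤ)).compl_mem_cofinite] with n hn
  rw [Real.norm_of_nonneg (by positivity)]
  refine one_div_le_one_div_of_le (modeEig_pos hε hn) ?_
  rw [← modeRoot_mul hε]
  nlinarith [one_le_modeRoot (ℓ := ℓ) hε n]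

lemma exists_isMultiplier_of_le (hε : 0 < ε) {κ : ℤ → ℂ} (hκ : ∀ n, ‖κ n‖ ≤ C / modeRoot ℓ ε n)
    (hherm : ∀ n, κ (-n) = conj (κ n)) :
    ∃ M : C(AddCircle ℓ, ℝ) →L[ℝ] C(AddCircle ℓ, ℝ), IsMultiplier κ M :=
  exists_isMultiplier (((summable_inv_modeRoot_sq (ℓ := ℓ) hε).mul_left (C ^ 2)).of_nonneg_of_le
    (fun n => by positivity) fun n => by
      calc ‖κ n‖ ^ 2 ≤ (C / modeRoot ℓ ε n) ^ 2 := by gcongr; exact hκ n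
        _ = C ^ 2 * (1 / modeRoot ℓ ε n ^ 2) := by rw [div_pow, mul_one_div]) hherm

lemma exists_isMultiplier_rootSymbol (hε : 0 < ε) {φ : ℝ → ℝ} (hφ : ∀ r, 1 ≤ r → |φ r| ≤ C / r) :
    ∃ M : C(AddCircle ℓ, ℝ) →L[ℝ] C(AddCircle ℓ, ℝ), IsMultiplier (rootSymbol ℓ ε φ) M :=
  exists_isMultiplier_of_le hε
    (fun n => (Complex.norm_real _).trans_le (hφ _ (one_le_modeRoot hε n))) (rootSymbol_neg φ)

lemma exists_isMultiplier_freq_mul_rootSymbol (hε : 0 < ε) {φ : ℝ → ℝ}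
    (hφ : ∀ r, 1 ≤ r → |φ r| ≤ 1 / r ^ 2) : ∃ M : C(AddCircle ℓ, ℝ) →L[ℝ] C(AddCircle ℓ, ℝ),
      IsMultiplier (fun n => freq ℓ n * rootSymbol ℓ ε φ n) M :=
  exists_isMultiplier_of_le (C := √(1 / ε)) hε (fun n => by
      have hr := one_le_modeRoot (ℓ := ℓ) hε n
      rw [norm_mul, rootSymbol, Complex.norm_real]
      calc ‖freq ℓ n‖ * |φ (modeRoot ℓ ε n)|
          ≤ √(1 / ε) * modeRoot ℓ ε n * (1 / modeRoot ℓ ε n ^ 2) := by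
            gcongr
            exacts [norm_freq_le hε n, hφ _ hr]
        _ = √(1 / ε) / modeRoot ℓ ε n := by field_simp)
    fun n => by rw [freq_neg, rootSymbol_neg, map_mul]

lemma exists_isMultiplier_symbK (hε : 0 < ε) :
    ∃ K : C(AddCircle ℓ, ℝ) →L[ℝ] C(AddCircle ℓ, ℝ), IsMultiplier (rootSymbol ℓ ε symbK) K :=
  exists_isMultiplier_rootSymbol (C := 2) hε fun r hr => by
    have : 1 / (2 * r + 1) ≤ 1 / r := one_div_le_one_div_of_le (by linarith) (by linarith)
    rw [symbK, abs_of_nonneg (by positivity)]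
    linarith [show 2 / r = 1 / r + 1 / r by ring]

lemma abs_inv_symbB_le {r : ℝ} (hr : 1 ≤ r) : |1 / symbB r| ≤ 1 / r ^ 2 := by
  rw [abs_of_pos (one_div_pos.2 (symbB_pos hr))]
  exact one_div_le_one_div_of_le (by positivity) (sq_le_symbB hr)

lemma exists_isMultiplier_inv_symbB (hε : 0 < ε) : ∃ N : C(AddCircle ℓ, ℝ) →L[ℝ] C(AddCircle ℓ, ℝ),
    IsMultiplier (rootSymbol ℓ ε fun r => 1 / symbB r) N :=
  exists_isMultiplier_rootSymbol (C := 1) hε fun r hr => by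
    rw [abs_of_pos (one_div_pos.2 (symbB_pos hr))]
    exact one_div_le_one_div_of_le (by linarith) (by nlinarith [sq_le_symbB hr])

lemma exists_isMultiplier_remainder (hε : 0 < ε) :
    ∃ N₂ : C(AddCircle ℓ, ℝ) →L[ℝ] C(AddCircle ℓ, ℝ),
      IsMultiplier (rootSymbol ℓ ε fun r => r / (2 * r ^ 2 - 1)) N₂ :=
  exists_isMultiplier_rootSymbol (C := 1) hε fun r hr => by
    have : 0 < 2 * r ^ 2 - 1 := by nlinarith
    rw [abs_of_nonneg (by positivity), div_le_div_iff₀ this (by linarith)]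
    nlinarith

end Multipliers

section HalfLine

variable {E : Type*} [NormedAddCommGroup E] [NormedSpace ℝ E] {S : Set ℝ}

lemma norm_sub_le_of_norm_deriv_le_deriv (hS : S.OrdConnected) {f f' : ℝ → E} {b b' : ℝ → ℝ}
    (hf : ∀ x ∈ S, HasDerivWithinAt f (f' x) S x) (hb : ∀ x, HasDerivAt b (b' x) x)
    (hle : ∀ x ∈ S, ‖f' x‖ ≤ b' x) {x y : ℝ} (hx : x ∈ S) (hy : y ∈ S) (hxy : x ≤ y) :
    ‖f y - f x‖ ≤ b y - b x := by
  have hsub : Set.Icc x y ⊆ S := hS.out hx hy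
  refine image_norm_le_of_norm_deriv_right_le_deriv_boundary (f := fun z => f z - f x) (f' := f')
    (B := fun z => b z - b x) (B' := b') (a := x) (b := y)
    (((HasDerivWithinAt.continuousOn hf).mono hsub).sub continuousOn_const) (fun z hz => ?_)
    (by simp) (fun z => (hb z).sub_const _) (fun z hz => hle z (hsub (Set.Ico_subset_Icc_self hz)))
    (Set.right_mem_Icc.2 hxy)
  have hfz := (hf z (hsub (Set.Ico_subset_Icc_self hz))).mono hsub
  refine (hfz.mono_of_mem_nhdsWithin ?_).sub_const _
  exact Icc_mem_nhdsGE_of_mem hz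

lemma hasDerivAt_exp_mul (c x : ℝ) :
    HasDerivAt (fun y => Real.exp (c * y)) (c * Real.exp (c * x)) x := by
  simpa [mul_comm] using ((hasDerivAt_id x).const_mul c).exp

lemma hasDerivAt_const_mul_exp_div {c : ℝ} (hc : c ≠ 0) (A x : ℝ) :
    HasDerivAt (fun y => A / c * Real.exp (c * y)) (A * Real.exp (c * x)) x := by
  refine ((hasDerivAt_exp_mul c x).const_mul (A / c)).congr_deriv ?_
  field_simp

variable {v v₁ v₂ : ℝ → E} {r μ A N : ℝ}

/-- Since `(e^{-x} v')' = e^{-x} (v'' - v')`, the growth of `v'` is controlled by that of the other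
terms of the equation. -/
lemma norm_exp_neg_smul_deriv_sub_le (hS : S.OrdConnected)
    (hv₁ : ∀ x ∈ S, HasDerivWithinAt v₁ (v₂ x) S x)
    (hA : ∀ x ∈ S, ‖v₂ x - v₁ x‖ ≤ A * Real.exp (1 / 2 * x)) {x y : ℝ} (hx : x ∈ S) (hy : y ∈ S)
    (hxy : x ≤ y) : ‖Real.exp (-1 * y) • v₁ y - Real.exp (-1 * x) • v₁ x‖ ≤
      A / (-1 / 2) * Real.exp (-1 / 2 * y) - A / (-1 / 2) * Real.exp (-1 / 2 * x) := by
  refine norm_sub_le_of_norm_deriv_le_deriv hS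
    (fun z hz => (hasDerivAt_exp_mul (-1) z).hasDerivWithinAt.smul (hv₁ z hz))
    (hasDerivAt_const_mul_exp_div (by norm_num) A) (fun z hz => ?_) hx hy hxy
  calc ‖Real.exp (-1 * z) • v₂ z + (-1 * Real.exp (-1 * z)) • v₁ z‖
      = Real.exp (-1 * z) * ‖v₂ z - v₁ z‖ := by
        rw [← Real.norm_of_nonneg (Real.exp_pos (-1 * z)).le, ← norm_smul, Real.norm_of_nonneg
          (Real.exp_pos (-1 * z)).le]
        congr 1
        module
    _ ≤ Real.exp (-1 * z) * (A * Real.exp (1 / 2 * z)) := by gcongr; exact hA z hz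
    _ = A * Real.exp (-1 / 2 * z) := by
        rw [mul_left_comm, ← Real.exp_add]
        ring_nf

lemma norm_deriv_le_of_nonneg (hv₁ : ∀ x ∈ Set.Ici 0, HasDerivWithinAt v₁ (v₂ x) (Set.Ici 0) x)
    (hA : ∀ x ∈ Set.Ici 0, ‖v₂ x - v₁ x‖ ≤ A * Real.exp (1 / 2 * x)) {x : ℝ} (hx : 0 ≤ x) :
    ‖v₁ x‖ ≤ (‖v₁ 0‖ + 2 * A) * Real.exp x := by
  have hA₀ : 0 ≤ A := by simpa using (norm_nonneg _).trans (hA 0 Set.self_mem_Ici)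
  have hsub := norm_exp_neg_smul_deriv_sub_le Set.ordConnected_Ici hv₁ hA Set.self_mem_Ici hx hx
  have hle : ‖Real.exp (-1 * x) • v₁ x‖ ≤ ‖v₁ 0‖ + 2 * A := by
    have hexp : 0 ≤ A * Real.exp (-1 / 2 * x) := by positivity
    rw [mul_zero, mul_zero, Real.exp_zero, one_smul] at hsub
    linarith [norm_le_norm_add_norm_sub' (Real.exp (-1 * x) • v₁ x) (v₁ 0)]
  rwa [norm_smul, Real.norm_of_nonneg (Real.exp_pos _).le, neg_one_mul, Real.exp_neg,
    inv_mul_le_iff₀' (Real.exp_pos x)] at hle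

lemma norm_deriv_le_of_nonpos (hv₁ : ∀ x ∈ Set.Iic 0, HasDerivWithinAt v₁ (v₂ x) (Set.Iic 0) x)
    (hA : ∀ x ∈ Set.Iic 0, ‖v₂ x - v₁ x‖ ≤ A * Real.exp (1 / 2 * x)) {x : ℝ} (hx : x ≤ 0) :
    ‖v₁ x‖ ≤ (‖v₁ 0‖ + 2 * A) * Real.exp (1 / 2 * x) := by
  have hA₀ : 0 ≤ A := by simpa using (norm_nonneg _).trans (hA 0 Set.self_mem_Iic)
  have hsub := norm_exp_neg_smul_deriv_sub_le Set.ordConnected_Iic hv₁ hA hx Set.self_mem_Iic hx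
  have hle : ‖Real.exp (-1 * x) • v₁ x‖ ≤ (‖v₁ 0‖ + 2 * A) * Real.exp (-1 / 2 * x) := by
    have hexp : ‖v₁ 0‖ ≤ ‖v₁ 0‖ * Real.exp (-1 / 2 * x) :=
      le_mul_of_one_le_right (norm_nonneg _) (Real.one_le_exp (by linarith))
    rw [mul_zero, mul_zero, Real.exp_zero, one_smul, norm_sub_rev] at hsub
    linarith [norm_le_norm_add_norm_sub' (Real.exp (-1 * x) • v₁ x) (v₁ 0)]
  rw [norm_smul, Real.norm_of_nonneg (Real.exp_pos _).le, neg_one_mul, Real.exp_neg,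
    inv_mul_le_iff₀ (Real.exp_pos x)] at hle
  refine hle.trans_eq ?_
  rw [mul_left_comm, ← Real.exp_add]
  ring_nf

/-- The pairing of a solution `v` of `v'' - v' - ρ(ρ - 1) v + eˣ w = h` with the adjoint solution
`e^{-ρx}`: its derivative is `e^{-ρx} h`. The argument `v₁` stands for `v'`. -/
def adjointPairing (ρ : ℝ) (v v₁ : ℝ → E) (w : E) (x : ℝ) : E :=
  Real.exp (-ρ * x) • (v₁ x + (ρ - 1) • v x) + (1 / (1 - ρ) * Real.exp ((1 - ρ) * x)) • w

variable {ρ : ℝ} {w : E}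

lemma norm_adjointPairing_sub_le (hS : S.OrdConnected) (hρ : ρ ≠ 1) (hρ' : ρ ≠ 1 / 2)
    (hv : ∀ x ∈ S, HasDerivWithinAt v (v₁ x) S x) (hv₁ : ∀ x ∈ S, HasDerivWithinAt v₁ (v₂ x) S x)
    (hN : ∀ x ∈ S,
      ‖v₂ x - v₁ x - (ρ * (ρ - 1)) • v x + Real.exp x • w‖ ≤ N * Real.exp (1 / 2 * x))
    {x y : ℝ} (hx : x ∈ S) (hy : y ∈ S) (hxy : x ≤ y) :
    ‖adjointPairing ρ v v₁ w y - adjointPairing ρ v v₁ w x‖ ≤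
      N / (1 / 2 - ρ) * Real.exp ((1 / 2 - ρ) * y) -
        N / (1 / 2 - ρ) * Real.exp ((1 / 2 - ρ) * x) := by
  refine norm_sub_le_of_norm_deriv_le_deriv hS
    (fun z hz => (((hasDerivAt_exp_mul (-ρ) z).hasDerivWithinAt.smul
      ((hv₁ z hz).add ((hv z hz).const_smul (ρ - 1)))).add
        ((hasDerivAt_const_mul_exp_div (sub_ne_zero.2 hρ.symm) 1 z).smul_const w).hasDerivWithinAt))
    (hasDerivAt_const_mul_exp_div (sub_ne_zero.2 hρ'.symm) N) (fun z hz => ?_) hx hy hxy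
  have hsplit : Real.exp ((1 - ρ) * z) = Real.exp (-ρ * z) * Real.exp z := by
    rw [← Real.exp_add]; ring_nf
  calc ‖Real.exp (-ρ * z) • (v₂ z + (ρ - 1) • v₁ z) +
        (-ρ * Real.exp (-ρ * z)) • (v₁ z + (ρ - 1) • v z) +
        (1 * Real.exp ((1 - ρ) * z)) • w‖
      = Real.exp (-ρ * z) * ‖v₂ z - v₁ z - (ρ * (ρ - 1)) • v z + Real.exp z • w‖ := by
        conv_rhs => rw [← Real.norm_of_nonneg (Real.exp_pos (-ρ * z)).le, ← norm_smul]
        rw [hsplit]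
        congr 1
        module
    _ ≤ Real.exp (-ρ * z) * (N * Real.exp (1 / 2 * z)) := by gcongr; exact hN z hz
    _ = N * Real.exp ((1 / 2 - ρ) * z) := by
        rw [mul_left_comm, ← Real.exp_add]
        ring_nf

lemma tendsto_exp_mul_atTop {c : ℝ} (hc : c < 0) (D : ℝ) :
    Tendsto (fun x => D * Real.exp (c * x)) atTop (𝓝 0) := by
  simpa using (Real.tendsto_exp_atBot.comp (tendsto_id.const_mul_atTop_of_neg hc)).const_mul D

lemma tendsto_exp_mul_atBot {c : ℝ} (hc : 0 < c) (D : ℝ) :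
    Tendsto (fun x => D * Real.exp (c * x)) atBot (𝓝 0) := by
  simpa using (Real.tendsto_exp_atBot.comp (tendsto_id.const_mul_atBot hc)).const_mul D

lemma norm_adjointPairing_le_of_nonneg {B : ℝ} (hr : 1 < r) (hA₀ : 0 ≤ A) {x : ℝ} (hx : 0 ≤ x)
    (hv : ‖v x‖ ≤ A * Real.exp (1 / 2 * x)) (hv₁ : ‖v₁ x‖ ≤ B * Real.exp x) :
    ‖adjointPairing r v v₁ 0 x‖ ≤ (B + (r - 1) * A) * Real.exp ((1 - r) * x) := by
  have hv' : ‖v x‖ ≤ A * Real.exp x := hv.trans (by gcongr; linarith)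
  calc ‖adjointPairing r v v₁ 0 x‖ ≤ Real.exp (-r * x) * (‖v₁ x‖ + (r - 1) * ‖v x‖) := by
        rw [adjointPairing, smul_zero, add_zero, norm_smul,
          Real.norm_of_nonneg (Real.exp_pos _).le]
        gcongr
        refine (norm_add_le _ _).trans_eq ?_
        rw [norm_smul, Real.norm_of_nonneg (by linarith)]
    _ ≤ Real.exp (-r * x) * (B * Real.exp x + (r - 1) * (A * Real.exp x)) := by
        have : 0 ≤ r - 1 := by linarith
        gcongr
    _ = (B + (r - 1) * A) * Real.exp (-r * x + x) := by
        rw [Real.exp_add]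
        ring
    _ = (B + (r - 1) * A) * Real.exp ((1 - r) * x) := by ring_nf

lemma norm_adjointPairing_le_of_nonpos {B : ℝ} (hr : 1 < r) {x : ℝ} (hx : x ≤ 0)
    (hv : ‖v x‖ ≤ A * Real.exp (1 / 2 * x)) (hv₁ : ‖v₁ x‖ ≤ B * Real.exp (1 / 2 * x)) :
    ‖adjointPairing (1 - r) v v₁ w x‖ ≤ (B + r * A + ‖w‖) * Real.exp ((r - 1 / 2) * x) := by
  have hexp : 1 / r * Real.exp (r * x) ≤ Real.exp ((r - 1 / 2) * x) :=
    (mul_le_of_le_one_left (Real.exp_pos _).le ((div_le_one (by linarith)).2 hr.le)).trans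
      (Real.exp_le_exp.2 (by linarith))
  calc ‖adjointPairing (1 - r) v v₁ w x‖
      ≤ Real.exp ((r - 1) * x) * (‖v₁ x‖ + r * ‖v x‖) + 1 / r * Real.exp (r * x) * ‖w‖ := by
        have hr₀ : 0 ≤ r := by linarith
        rw [adjointPairing, neg_sub, sub_sub_cancel]
        refine (norm_add_le _ _).trans ?_
        rw [norm_smul, norm_smul, Real.norm_of_nonneg (Real.exp_pos _).le,
          Real.norm_of_nonneg (mul_nonneg (by positivity) (Real.exp_pos _).le)]
        gcongr
        refine (norm_add_le _ _).trans_eq ?_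
        rw [norm_smul, sub_sub_cancel_left, norm_neg, Real.norm_of_nonneg hr₀]
    _ ≤ Real.exp ((r - 1) * x) * (B * Real.exp (1 / 2 * x) + r * (A * Real.exp (1 / 2 * x))) +
          Real.exp ((r - 1 / 2) * x) * ‖w‖ := by gcongr
    _ = (B + r * A) * Real.exp ((r - 1) * x + 1 / 2 * x) + Real.exp ((r - 1 / 2) * x) * ‖w‖ := by
        rw [Real.exp_add]
        ring
    _ = (B + r * A + ‖w‖) * Real.exp ((r - 1 / 2) * x) := by ring_nf

lemma norm_sub_le_of_norm_sub_smul_add_le {v₀ : E} {μ t : ℝ} (hμ : 0 ≤ μ) {a : ℝ}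
    {y z : E} (hv : ‖v₀‖ ≤ A * t) (hN : ‖z - y - μ • v₀ + a • w‖ ≤ N * t) (ha : |a| ≤ t) :
    ‖z - y‖ ≤ (N + μ * A + ‖w‖) * t := by
  calc ‖z - y‖ = ‖(z - y - μ • v₀ + a • w) + μ • v₀ + -(a • w)‖ := by congr 1; abel
    _ ≤ ‖z - y - μ • v₀ + a • w‖ + μ * ‖v₀‖ + |a| * ‖w‖ := by
        refine norm_add₃_le.trans_eq ?_
        rw [norm_neg, norm_smul, norm_smul, Real.norm_of_nonneg hμ, Real.norm_eq_abs]
    _ ≤ N * t + μ * (A * t) + t * ‖w‖ := by gcongr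
    _ = (N + μ * A + ‖w‖) * t := by ring

lemma norm_adjointPairing_zero_le_of_nonneg (hr : 1 < r)
    (hv : ∀ x ∈ Set.Ici 0, HasDerivWithinAt v (v₁ x) (Set.Ici 0) x)
    (hv₁ : ∀ x ∈ Set.Ici 0, HasDerivWithinAt v₁ (v₂ x) (Set.Ici 0) x)
    (hA : ∀ x ∈ Set.Ici 0, ‖v x‖ ≤ A * Real.exp (1 / 2 * x))
    (hN : ∀ x ∈ Set.Ici 0, ‖v₂ x - v₁ x - (r * (r - 1)) • v x‖ ≤ N * Real.exp (1 / 2 * x)) :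
    ‖adjointPairing r v v₁ 0 0‖ ≤ 2 * N := by
  have hN₀ : 0 ≤ N := by simpa using (norm_nonneg _).trans (hN 0 Set.self_mem_Ici)
  have hA₀ : 0 ≤ A := by simpa using (norm_nonneg _).trans (hA 0 Set.self_mem_Ici)
  have hN' : ∀ x ∈ Set.Ici (0 : ℝ),
      ‖v₂ x - v₁ x - (r * (r - 1)) • v x + Real.exp x • (0 : E)‖ ≤ N * Real.exp (1 / 2 * x) := by
    simpa using hN
  obtain ⟨B, hB⟩ : ∃ B, ∀ x, 0 ≤ x → ‖v₁ x‖ ≤ B * Real.exp x :=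
    ⟨_, fun x => norm_deriv_le_of_nonneg hv₁ fun z hz => norm_sub_le_of_norm_sub_smul_add_le
      (μ := r * (r - 1)) (w := (0 : E)) (a := 0) (N := N) (by nlinarith) (hA z hz)
      (by simpa using hN z hz) (by simp [Real.exp_nonneg])⟩
  have hvar : ∀ x, 0 ≤ x → ‖adjointPairing r v v₁ 0 x - adjointPairing r v v₁ 0 0‖ ≤ 2 * N :=
    fun x hx => by
    refine (norm_adjointPairing_sub_le Set.ordConnected_Ici hr.ne' (by linarith) hv hv₁ hN'
      Set.self_mem_Ici hx hx).trans ?_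
    have hq : N / (r - 1 / 2) ≤ 2 * N := (div_le_iff₀ (by linarith)).2 (by nlinarith)
    have hq₀ : 0 ≤ N / (r - 1 / 2) * Real.exp (-(r - 1 / 2) * x) :=
      mul_nonneg (div_nonneg hN₀ (by linarith)) (Real.exp_pos _).le
    rw [← neg_sub r, div_neg, mul_zero, Real.exp_zero]
    linarith
  refine ge_of_tendsto (x := atTop (α := ℝ))
    (by simpa only [zero_add] using
      (tendsto_exp_mul_atTop (sub_neg.2 hr) (B + (r - 1) * A)).add_const (2 * N))
    ((eventually_ge_atTop 0).mono fun x hx => ?_)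
  exact (norm_le_norm_add_norm_sub _ _).trans (add_le_add
    (norm_adjointPairing_le_of_nonneg hr hA₀ hx (hA x hx) (hB x hx)) (hvar x hx))

lemma norm_adjointPairing_zero_le_of_nonpos (hr : 1 < r)
    (hv : ∀ x ∈ Set.Iic 0, HasDerivWithinAt v (v₁ x) (Set.Iic 0) x)
    (hv₁ : ∀ x ∈ Set.Iic 0, HasDerivWithinAt v₁ (v₂ x) (Set.Iic 0) x)
    (hA : ∀ x ∈ Set.Iic 0, ‖v x‖ ≤ A * Real.exp (1 / 2 * x))
    (hN : ∀ x ∈ Set.Iic 0,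
      ‖v₂ x - v₁ x - (r * (r - 1)) • v x + Real.exp x • w‖ ≤ N * Real.exp (1 / 2 * x)) :
    ‖adjointPairing (1 - r) v v₁ w 0‖ ≤ 2 * N := by
  have hN₀ : 0 ≤ N := by simpa using (norm_nonneg _).trans (hN 0 Set.self_mem_Iic)
  have hN' : ∀ x ∈ Set.Iic (0 : ℝ), ‖v₂ x - v₁ x - ((1 - r) * (1 - r - 1)) • v x +
      Real.exp x • w‖ ≤ N * Real.exp (1 / 2 * x) := by
    rwa [show (1 - r) * (1 - r - 1) = r * (r - 1) by ring]
  obtain ⟨B, hB⟩ : ∃ B, ∀ x, x ≤ 0 → ‖v₁ x‖ ≤ B * Real.exp (1 / 2 * x) :=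
    ⟨_, fun x => norm_deriv_le_of_nonpos hv₁ fun z hz => norm_sub_le_of_norm_sub_smul_add_le
      (μ := r * (r - 1)) (by nlinarith) (hA z hz) (hN z hz) (by
        rw [abs_of_pos (Real.exp_pos z), Real.exp_le_exp]
        linarith [Set.mem_Iic.1 hz])⟩
  have hvar : ∀ x, x ≤ 0 →
      ‖adjointPairing (1 - r) v v₁ w 0 - adjointPairing (1 - r) v v₁ w x‖ ≤ 2 * N :=
    fun x hx => by
    refine (norm_adjointPairing_sub_le Set.ordConnected_Iic (by linarith) (by linarith) hv hv₁ hN'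
      hx Set.self_mem_Iic hx).trans ?_
    have hq : N / (r - 1 / 2) ≤ 2 * N := (div_le_iff₀ (by linarith)).2 (by nlinarith)
    have hq₀ : 0 ≤ N / (r - 1 / 2) * Real.exp ((r - 1 / 2) * x) :=
      mul_nonneg (div_nonneg hN₀ (by linarith)) (Real.exp_pos _).le
    rw [show 1 / 2 - (1 - r) = r - 1 / 2 by ring, mul_zero, Real.exp_zero]
    linarith
  refine ge_of_tendsto (x := atBot (α := ℝ))
    (by simpa only [zero_add] using (tendsto_exp_mul_atBot (by linarith : 0 < r - 1 / 2)
      (B + r * A + ‖w‖)).add_const (2 * N))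
    ((eventually_le_atBot 0).mono fun x hx => ?_)
  exact (norm_le_norm_add_norm_sub' _ (adjointPairing (1 - r) v v₁ w x)).trans (add_le_add
    (norm_adjointPairing_le_of_nonpos hr hx (hA x hx) (hB x hx)) (hvar x hx))

/-- The two pairings determine `v(0)`: their difference does not involve `v'(0)`. -/
lemma adjointPairing_sub_adjointPairing {v' v₁' : ℝ → E} (hr : r ≠ 0) (hv : v' 0 = v 0)
    (hv₁ : v₁' 0 = v₁ 0) : adjointPairing r v' v₁' 0 0 - adjointPairing (1 - r) v v₁ (v 0) 0 =
      ((r - 1) * (2 * r + 1) / r) • v 0 := by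
  have h : (r - 1) * (2 * r + 1) / r = 2 * r - 1 - 1 / r := by
    field_simp
    ring
  simp only [adjointPairing, mul_zero, Real.exp_zero, one_smul, smul_zero, add_zero, mul_one, h,
    sub_sub_cancel, hv, hv₁]
  module

end HalfLine

section XSpace

variable {ℓ : ℝ}

/-- The function `e^{-x/2} f₁`, whose sup norm is the first summand of the norm of `𝓧`. -/
def weightedNeg : XSpace ℓ →ₗ[ℝ] BoundedContinuousFunction (StripNeg ℓ) ℝ where
  toFun f := .ofNormedAddCommGroup (fun p => Real.exp (-(p.1 : ℝ) / 2) * f.1.1 p) (by fun_prop)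
    f.2.1.choose f.2.1.choose_spec
  map_add' f g := by ext p; exact mul_add _ _ _
  map_smul' c f := by ext p; exact mul_left_comm _ _ _

/-- The function `e^{-x/2} f₂`, whose sup norm is the second summand of the norm of `𝓧`. -/
def weightedPos : XSpace ℓ →ₗ[ℝ] BoundedContinuousFunction (StripPos ℓ) ℝ where
  toFun f := .ofNormedAddCommGroup (fun p => Real.exp (-(p.1 : ℝ) / 2) * f.1.2 p) (by fun_prop)
    f.2.2.choose f.2.2.choose_spec
  map_add' f g := by ext p; exact mul_add _ _ _
  map_smul' c f := by ext p; exact mul_left_comm _ _ _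

/-- The norm of `𝓧`, as a seminorm. -/
def xSeminorm (ℓ : ℝ) : Seminorm ℝ (XSpace ℓ) :=
  (normSeminorm ℝ _).comp weightedNeg + (normSeminorm ℝ _).comp weightedPos

lemma xSeminorm_apply (f : XSpace ℓ) : xSeminorm ℓ f = ‖weightedNeg f‖ + ‖weightedPos f‖ := rfl

lemma xNorm_eq_xSeminorm (f : XSpace ℓ) : xNorm f = xSeminorm ℓ f := by
  rw [xSeminorm_apply, BoundedContinuousFunction.norm_eq_iSup_norm,
    BoundedContinuousFunction.norm_eq_iSup_norm]
  rfl

lemma abs_exp_mul_le_iff {x y B : ℝ} :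
    |Real.exp (-x / 2) * y| ≤ B ↔ |y| ≤ B * Real.exp (1 / 2 * x) := by
  rw [abs_mul, abs_of_pos (Real.exp_pos _), neg_div, Real.exp_neg,
    inv_mul_le_iff₀' (Real.exp_pos _), one_div_mul_eq_div]

lemma abs_neg_le (f : XSpace ℓ) (p : StripNeg ℓ) :
    |f.1.1 p| ≤ xSeminorm ℓ f * Real.exp (1 / 2 * p.1) :=
  abs_exp_mul_le_iff.1 (((weightedNeg f).norm_coe_le_norm p).trans
    (le_add_of_nonneg_right (apply_nonneg _ _)))

lemma abs_pos_le (f : XSpace ℓ) (p : StripPos ℓ) :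
    |f.1.2 p| ≤ xSeminorm ℓ f * Real.exp (1 / 2 * p.1) :=
  abs_exp_mul_le_iff.1 (((weightedPos f).norm_coe_le_norm p).trans
    (le_add_of_nonneg_left (apply_nonneg _ _)))

lemma xSeminorm_le {f : XSpace ℓ} {A B : ℝ} (hA : 0 ≤ A) (hB : 0 ≤ B)
    (hfA : ∀ p, |f.1.1 p| ≤ A * Real.exp (1 / 2 * p.1))
    (hfB : ∀ p, |f.1.2 p| ≤ B * Real.exp (1 / 2 * p.1)) : xSeminorm ℓ f ≤ A + B :=
  add_le_add
    ((BoundedContinuousFunction.norm_le hA).2 fun p => abs_exp_mul_le_iff.2 (hfA p))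
    ((BoundedContinuousFunction.norm_le hB).2 fun p => abs_exp_mul_le_iff.2 (hfB p))

/-- The isomorphism of `𝓧` with a Banach space of pairs of bounded continuous functions, given by
the multiplication by `e^{-x/2}`. -/
def weightedEquiv : XSpace ℓ ≃ₗ[ℝ] BoundedContinuousFunction (StripNeg ℓ) ℝ ×
    BoundedContinuousFunction (StripPos ℓ) ℝ where
  __ := weightedNeg.prod weightedPos
  invFun w := ⟨(⟨fun p => Real.exp (p.1 / 2) * w.1 p, by fun_prop⟩,
      ⟨fun p => Real.exp (p.1 / 2) * w.2 p, by fun_prop⟩),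
    ⟨‖w.1‖, fun p => by simpa [← mul_assoc, ← Real.exp_add, neg_div] using w.1.norm_coe_le_norm p⟩,
    ⟨‖w.2‖, fun p => by simpa [← mul_assoc, ← Real.exp_add, neg_div] using w.2.norm_coe_le_norm p⟩⟩
  left_inv f := Subtype.ext (Prod.ext
    (by ext p; simp [weightedNeg, ← mul_assoc, ← Real.exp_add, neg_div])
    (by ext p; simp [weightedPos, ← mul_assoc, ← Real.exp_add, neg_div]))
  right_inv w := Prod.ext
    (by ext p; simp [weightedNeg, ← mul_assoc, ← Real.exp_add, neg_div])
    (by ext p; simp [weightedPos, ← mul_assoc, ← Real.exp_add, neg_div])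

lemma norm_weightedEquiv_le (f : XSpace ℓ) : ‖weightedEquiv f‖ ≤ xSeminorm ℓ f :=
  max_le_add_of_nonneg (norm_nonneg _) (norm_nonneg _)

lemma xSeminorm_le_norm_weightedEquiv (f : XSpace ℓ) : xSeminorm ℓ f ≤ 2 * ‖weightedEquiv f‖ :=
  (add_le_add (norm_fst_le (weightedEquiv f)) (norm_snd_le (weightedEquiv f))).trans_eq
    (two_mul _).symm

lemma HasDx.add {u v u' v' : Pair ℓ} (h : HasDx u v) (h' : HasDx u' v') : HasDx (u + u') (v + v') :=
  ⟨fun η => (h.1 η).add (h'.1 η), fun η => (h.2 η).add (h'.2 η)⟩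

lemma HasDx.smul {u v : Pair ℓ} (c : ℝ) (h : HasDx u v) : HasDx (c • u) (c • v) :=
  ⟨fun η => (h.1 η).smul c, fun η => (h.2 η).smul c⟩

lemma HasDeta.add {u v u' v' : Pair ℓ} (h : HasDeta u v) (h' : HasDeta u' v') :
    HasDeta (u + u') (v + v') :=
  ⟨fun η => (h.1 η).add (h'.1 η), fun η => (h.2 η).add (h'.2 η)⟩

lemma HasDeta.smul {u v : Pair ℓ} (c : ℝ) (h : HasDeta u v) : HasDeta (c • u) (c • v) :=
  ⟨fun η => (h.1 η).smul c, fun η => (h.2 η).smul c⟩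

lemma EndsAgree.add {f g : Cell ℓ → ℝ} (hf : EndsAgree f) (hg : EndsAgree g) :
    EndsAgree (f + g) := fun a b ha hb => congrArg₂ (· + ·) (hf a b ha hb) (hg a b ha hb)

lemma EndsAgree.smul {f : Cell ℓ → ℝ} (c : ℝ) (hf : EndsAgree f) : EndsAgree (c • f) :=
  fun a b ha hb => congrArg (c * ·) (hf a b ha hb)

lemma PeriodicEta.add {u v : Pair ℓ} (hu : PeriodicEta u) (hv : PeriodicEta v) :
    PeriodicEta (u + v) := ⟨fun x => (hu.1 x).add (hv.1 x), fun x => (hu.2 x).add (hv.2 x)⟩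

lemma PeriodicEta.smul {u : Pair ℓ} (c : ℝ) (hu : PeriodicEta u) : PeriodicEta (c • u) :=
  ⟨fun x => (hu.1 x).smul c, fun x => (hu.2 x).smul c⟩

lemma MatchAtZero.add {u v : Pair ℓ} (hu : MatchAtZero u) (hv : MatchAtZero v) :
    MatchAtZero (u + v) := fun η => congrArg₂ (· + ·) (hu η) (hv η)

lemma MatchAtZero.smul {u : Pair ℓ} (c : ℝ) (hu : MatchAtZero u) : MatchAtZero (c • u) :=
  fun η => congrArg (c * ·) (hu η)

/-- The graph of `L + εA`, as a subspace of `𝓧 × 𝓧`. -/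
def graphLA (ℓ ε : ℝ) : Submodule ℝ (XSpace ℓ × XSpace ℓ) where
  carrier := {p | GraphLA ε p.1 p.2}
  zero_mem' := ⟨0, 0, 0, 0, ⟨fun _ => .zero, fun _ => .zero⟩, ⟨fun _ => .zero, fun _ => .zero⟩,
    ⟨fun _ => .zero, fun _ => .zero⟩, ⟨fun _ => .zero, fun _ => .zero⟩, zero_mem _,
    fun _ => rfl, fun _ => rfl, ⟨fun _ _ _ _ _ => rfl, fun _ _ _ _ _ => rfl⟩,
    ⟨fun _ _ _ _ _ => rfl, fun _ _ _ _ _ => rfl⟩, fun _ => by simp, fun _ => by simp⟩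
  add_mem' := by
    rintro ⟨u, f⟩ ⟨u', f'⟩
      ⟨ux, uxx, uη, uηη, hx, hxx, hη, hηη, hX, hm, hmx, hp, hpη, hneg, hpos⟩
      ⟨vx, vxx, vη, vηη, kx, kxx, kη, kηη, kX, km, kmx, kp, kpη, kneg, kpos⟩
    refine ⟨ux + vx, uxx + vxx, uη + vη, uηη + vηη, hx.add kx, hxx.add kxx, hη.add kη,
      hηη.add kηη, add_mem hX kX, hm.add km, hmx.add kmx, hp.add kp, hpη.add kpη,
      fun p => (congrArg₂ (· + ·) (hneg p) (kneg p)).trans ?_,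
      fun p => (congrArg₂ (· + ·) (hpos p) (kpos p)).trans ?_⟩
    · simp only [Prod.fst_add, Submodule.coe_add, ContinuousMap.add_apply]
      ring
    · simp only [Prod.snd_add, ContinuousMap.add_apply]
      ring
  smul_mem' := by
    rintro c ⟨u, f⟩ ⟨ux, uxx, uη, uηη, hx, hxx, hη, hηη, hX, hm, hmx, hp, hpη, hneg, hpos⟩
    refine ⟨c • ux, c • uxx, c • uη, c • uηη, hx.smul c, hxx.smul c, hη.smul c, hηη.smul c,
      Submodule.smul_mem _ c hX, hm.smul c, hmx.smul c, hp.smul c, hpη.smul c,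
      fun p => (congrArg (c * ·) (hneg p)).trans ?_, fun p => (congrArg (c * ·) (hpos p)).trans ?_⟩
    · simp only [Prod.smul_fst, Submodule.coe_smul, ContinuousMap.smul_apply, smul_eq_mul]
      ring
    · simp only [Prod.smul_snd, ContinuousMap.smul_apply, smul_eq_mul]
      ring

lemma GraphLA.sub {ε : ℝ} {u f u' f' : XSpace ℓ} (h : GraphLA ε u f) (h' : GraphLA ε u' f') :
    GraphLA ε (u - u') (f - f') :=
  (graphLA ℓ ε).sub_mem (x := (u, f)) (y := (u', f')) h h'

lemma tendsto_xSeminorm_sub_sub {un un' : ℕ → XSpace ℓ} {u u' : XSpace ℓ}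
    (h : Tendsto (fun n => xSeminorm ℓ (un n - u)) atTop (𝓝 0))
    (h' : Tendsto (fun n => xSeminorm ℓ (un' n - u')) atTop (𝓝 0)) :
    Tendsto (fun n => xSeminorm ℓ (un n - un' n - (u - u'))) atTop (𝓝 0) := by
  refine squeeze_zero (fun _ => apply_nonneg _ _) (fun n => ?_) (by simpa using h.add h')
  rw [sub_sub_sub_comm]
  exact map_sub_le_add _ _ _

lemma GraphLEps.sub {ε : ℝ} {u f u' f' : XSpace ℓ} (h : GraphLEps ε u f)
    (h' : GraphLEps ε u' f') : GraphLEps ε (u - u') (f - f') := by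
  obtain ⟨un, fn, hg, hu, hf⟩ := h
  obtain ⟨un', fn', hg', hu', hf'⟩ := h'
  simp only [xNorm_eq_xSeminorm] at hu hf hu' hf'
  refine ⟨fun n => un n - un' n, fun n => fn n - fn' n, fun n => (hg n).sub (hg' n), ?_, ?_⟩ <;>
    simp only [xNorm_eq_xSeminorm]
  · exact tendsto_xSeminorm_sub_sub hu hu'
  · exact tendsto_xSeminorm_sub_sub hf hf'

end XSpace

section Slice

variable {S : Set ℝ} {K : Type*} [TopologicalSpace K]

/-- The partial function `w(x, ·)`, extended by `0` to the `x` outside `S`. -/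
def slice (w : C(S × K, ℝ)) : ℝ → C(K, ℝ) := Function.extend Subtype.val w.curry 0

lemma slice_coe (w : C(S × K, ℝ)) (x : S) : slice w x = w.curry x :=
  Subtype.val_injective.extend_apply _ _ x

lemma slice_coe_apply (w : C(S × K, ℝ)) (x : S) (k : K) : slice w x k = w (x, k) := by
  rw [slice_coe, ContinuousMap.curry_apply]

/-- Continuity of `u'` makes the partial derivative uniform in the compact variable. -/
lemma hasDerivWithinAt_slice [CompactSpace K] (hS : S.OrdConnected) {u u' : C(S × K, ℝ)}
    (h : ∀ k, HasDerivOn (fun x => u (x, k)) fun x => u' (x, k)) :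
    ∀ x ∈ S, HasDerivWithinAt (slice u) (slice u' x) S x := fun x hx => by
  rw [hasDerivWithinAt_iff_isLittleO, Asymptotics.isLittleO_iff]
  intro c hc
  have hnear : ∀ᶠ y in 𝓝[S] x, ‖slice u' y - slice u' x‖ ≤ c := by
    have hcont : Tendsto (fun y : S => ‖u'.curry y - u'.curry ⟨x, hx⟩‖) (𝓝 ⟨x, hx⟩) (𝓝 0) :=
      tendsto_iff_norm_sub_tendsto_zero.1 (u'.curry.continuous.tendsto _)
    rw [nhdsWithin_eq_map_subtype_coe hx, eventually_map]
    filter_upwards [hcont.eventually_le_const hc] with y hy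
    rwa [slice_coe, ← Subtype.coe_mk x hx, slice_coe]
  obtain ⟨δ, hδ, hball⟩ := Metric.mem_nhdsWithin_iff.1 hnear
  filter_upwards [inter_mem_nhdsWithin S (Metric.ball_mem_nhds x hδ)] with y hy
  refine (ContinuousMap.norm_le _ (by positivity)).2 fun k => ?_
  have hconvex : Convex ℝ (S ∩ Metric.ball x δ) := hS.convex.inter (convex_ball x δ)
  have hmean := hconvex.norm_image_sub_le_of_norm_hasDerivWithin_le
    (f := fun z => slice u z k - z * slice u' x k) (f' := fun z => slice u' z k - slice u' x k)
    (C := c) (fun z hz => ?_)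
    (fun z hz => ((slice u' z - slice u' x).norm_coe_le_norm k).trans (hball ⟨hz.2, hz.1⟩))
    ⟨hx, Metric.mem_ball_self hδ⟩ hy
  · refine le_of_eq_of_le (congrArg norm ?_) hmean
    simp only [ContinuousMap.sub_apply, ContinuousMap.smul_apply, smul_eq_mul]
    ring
  · have hderiv := (hasDerivOn_iff_of_eqOn (F := fun z => slice u z k)
      fun z => slice_coe_apply u z k).1 (h k) ⟨z, hz.1⟩
    rw [← slice_coe_apply] at hderiv
    simpa only [one_mul, id_eq] using
      (hderiv.mono Set.inter_subset_left).fun_sub ((hasDerivWithinAt_id z _).mul_const _)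

lemma hasDerivWithinAt_comp_slice [CompactSpace K] {E : Type*} [NormedAddCommGroup E]
    [NormedSpace ℝ E] (L : C(K, ℝ) →L[ℝ] E) (hS : S.OrdConnected) {u u' : C(S × K, ℝ)}
    (h : ∀ k, HasDerivOn (fun x => u (x, k)) fun x => u' (x, k)) :
    ∀ x ∈ S, HasDerivWithinAt (fun x => L (slice u x)) (L (slice u' x)) S x := fun x hx =>
  L.hasFDerivAt.comp_hasDerivWithinAt x (hasDerivWithinAt_slice hS h x hx)

end Slice

section Uniqueness

variable {ℓ : ℝ}

/-- The function `u₁(0, ·)`. -/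
def trace : XSpace ℓ →ₗ[ℝ] C(Cell ℓ, ℝ) where
  toFun u := u.1.1.curry zeroNeg
  map_add' _ _ := rfl
  map_smul' _ _ := rfl

lemma trace_apply (u : XSpace ℓ) (η : Cell ℓ) : trace u η = u.1.1 (zeroNeg, η) := rfl

lemma norm_slice_neg_le (u : XSpace ℓ) (x : Set.Iic (0 : ℝ)) :
    ‖slice u.1.1 x‖ ≤ xSeminorm ℓ u * Real.exp (1 / 2 * x) := by
  refine (ContinuousMap.norm_le _ (by positivity)).2 fun η => ?_
  rw [slice_coe_apply]
  exact abs_neg_le u _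

lemma norm_slice_pos_le (u : XSpace ℓ) (x : Set.Ici (0 : ℝ)) :
    ‖slice u.1.2 x‖ ≤ xSeminorm ℓ u * Real.exp (1 / 2 * x) := by
  refine (ContinuousMap.norm_le _ (by positivity)).2 fun η => ?_
  rw [slice_coe_apply]
  exact abs_pos_le u _

lemma slice_zero_neg (u : XSpace ℓ) : slice u.1.1 0 = trace u := slice_coe u.1.1 zeroNeg

lemma norm_trace_le (u : XSpace ℓ) : ‖trace u‖ ≤ xSeminorm ℓ u := by
  simpa only [show ((zeroNeg : Set.Iic (0 : ℝ)) : ℝ) = 0 from rfl, slice_zero_neg, mul_zero,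
    Real.exp_zero, mul_one] using norm_slice_neg_le u zeroNeg

lemma tendsto_trace {u : XSpace ℓ} {un : ℕ → XSpace ℓ}
    (h : Tendsto (fun n => xNorm (un n - u)) atTop (𝓝 0)) :
    Tendsto (fun n => trace (un n)) atTop (𝓝 (trace u)) := by
  refine tendsto_iff_norm_sub_tendsto_zero.2 (squeeze_zero (fun _ => norm_nonneg _) (fun n => ?_) h)
  rw [← map_sub, xNorm_eq_xSeminorm]
  exact norm_trace_le _

lemma GraphLEps.endsAgree_trace {ε : ℝ} {u f : XSpace ℓ} (h : GraphLEps ε u f) :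
    EndsAgree (trace u) := fun a b ha hb => by
  obtain ⟨un, fn, hg, hu, -⟩ := h
  have htrace := tendsto_trace hu
  have heval (c : Cell ℓ) : Tendsto (fun n => trace (un n) c) atTop (𝓝 (trace u c)) :=
    ((ContinuousEvalConst.continuous_eval_const c).tendsto _).comp htrace
  refine tendsto_nhds_unique (heval a) ((heval b).congr fun n => ?_)
  obtain ⟨ux, uxx, uη, uηη, -, -, -, -, -, -, -, hp, -⟩ := hg n
  exact (hp.1 zeroNeg a b ha hb).symm

variable [hℓ : Fact (0 < ℓ)]

lemma cellCoeff_slice_hasDeta {S : Set ℝ} {ε : ℝ} (hε : 0 < ε) {u uη uηη : C(S × Cell ℓ, ℝ)}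
    {x : S} (h : HasDerivOn (fun η => u (x, η)) fun η => uη (x, η))
    (hη : HasDerivOn (fun η => uη (x, η)) fun η => uηη (x, η))
    (hp : EndsAgree fun η => u (x, η)) (hpη : EndsAgree fun η => uη (x, η)) (n : ℤ) :
    cellCoeff n (ε • slice uηη x) =
      -((modeRoot ℓ ε n * (modeRoot ℓ ε n - 1)) • cellCoeff n (slice u x)) := by
  rw [map_smul, slice_coe, slice_coe,
    cellCoeff_of_hasDerivOn n (g := uη.curry x) (g' := uηη.curry x) hη hpη,
    cellCoeff_of_hasDerivOn n (g := u.curry x) (g' := uη.curry x) h hp, modeRoot_mul hε,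
    Complex.real_smul, Complex.real_smul, modeEig_coe]
  ring

lemma cellCoeff_slice_equation {S : Set ℝ} {ε a : ℝ} (hε : 0 < ε)
    {u ux uxx uη uηη f : C(S × Cell ℓ, ℝ)} {w : C(Cell ℓ, ℝ)} {x : S}
    (h : HasDerivOn (fun η => u (x, η)) fun η => uη (x, η))
    (hη : HasDerivOn (fun η => uη (x, η)) fun η => uηη (x, η))
    (hp : EndsAgree fun η => u (x, η)) (hpη : EndsAgree fun η => uη (x, η))
    (hf : ∀ η, f (x, η) = uxx (x, η) + ε * uηη (x, η) - ux (x, η) + w η * a) (n : ℤ) :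
    cellCoeff n (slice uxx x) - cellCoeff n (slice ux x) -
        (modeRoot ℓ ε n * (modeRoot ℓ ε n - 1)) • cellCoeff n (slice u x) + a • cellCoeff n w =
      cellCoeff n (slice f x) := by
  have heq : slice f x = slice uxx x + ε • slice uηη x - slice ux x + a • w := by
    ext η
    simp only [ContinuousMap.add_apply, ContinuousMap.sub_apply, ContinuousMap.smul_apply,
      slice_coe_apply, smul_eq_mul, hf, mul_comm a]
  rw [heq, map_add, map_sub, map_add, cellCoeff_slice_hasDeta hε h hη hp hpη, map_smul]
  ring

lemma norm_cellCoeff_le_of_norm_le (n : ℤ) {g : C(Cell ℓ, ℝ)} {A t : ℝ} (hg : ‖g‖ ≤ A * t) :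
    ‖cellCoeff n g‖ ≤ ‖cellCoeff (ℓ := ℓ) n‖ * A * t :=
  ((cellCoeff n).le_of_opNorm_le_of_le le_rfl hg).trans_eq (mul_assoc _ _ _).symm

lemma norm_adjointPairing_cellCoeff_pos_le {ε : ℝ} (hε : 0 < ε) {n : ℤ} (hn : n ≠ 0)
    {u f : XSpace ℓ} {ux uxx uη uηη : Pair ℓ} (hux : HasDx u.1 ux) (huxx : HasDx ux uxx)
    (huη : HasDeta u.1 uη) (huηη : HasDeta uη uηη) (hp : PeriodicEta u.1) (hpη : PeriodicEta uη)
    (hf : ∀ p, f.1.2 p = uxx.2 p + ε * uηη.2 p - ux.2 p) :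
    ‖adjointPairing (modeRoot ℓ ε n) (fun x => cellCoeff n (slice u.1.2 x))
        (fun x => cellCoeff n (slice ux.2 x)) 0 0‖ ≤
      2 * (‖cellCoeff (ℓ := ℓ) n‖ * xSeminorm ℓ f) :=
  norm_adjointPairing_zero_le_of_nonneg (one_lt_modeRoot hε hn)
    (hasDerivWithinAt_comp_slice (cellCoeff n) Set.ordConnected_Ici hux.2)
    (hasDerivWithinAt_comp_slice (cellCoeff n) Set.ordConnected_Ici huxx.2)
    (fun x hx => norm_cellCoeff_le_of_norm_le n (norm_slice_pos_le u ⟨x, hx⟩)) fun x hx => by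
      have heq := cellCoeff_slice_equation hε (f := f.1.2) (w := 0) (a := 0) (huη.2 ⟨x, hx⟩)
        (huηη.2 ⟨x, hx⟩) (hp.2 ⟨x, hx⟩) (hpη.2 ⟨x, hx⟩)
        (fun η => by simpa using hf (⟨x, hx⟩, η)) n
      rw [zero_smul, add_zero] at heq
      exact (congrArg norm heq).trans_le
        (norm_cellCoeff_le_of_norm_le n (norm_slice_pos_le f ⟨x, hx⟩))

lemma norm_adjointPairing_cellCoeff_neg_le {ε : ℝ} (hε : 0 < ε) {n : ℤ} (hn : n ≠ 0)
    {u f : XSpace ℓ} {ux uxx uη uηη : Pair ℓ} (hux : HasDx u.1 ux) (huxx : HasDx ux uxx)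
    (huη : HasDeta u.1 uη) (huηη : HasDeta uη uηη) (hp : PeriodicEta u.1) (hpη : PeriodicEta uη)
    (hf : ∀ p, f.1.1 p =
      uxx.1 p + ε * uηη.1 p - ux.1 p + u.1.1 (zeroNeg, p.2) * Real.exp p.1) :
    ‖adjointPairing (1 - modeRoot ℓ ε n) (fun x => cellCoeff n (slice u.1.1 x))
        (fun x => cellCoeff n (slice ux.1 x)) (cellCoeff n (slice u.1.1 0)) 0‖ ≤
      2 * (‖cellCoeff (ℓ := ℓ) n‖ * xSeminorm ℓ f) :=
  norm_adjointPairing_zero_le_of_nonpos (w := cellCoeff n (slice u.1.1 0)) (one_lt_modeRoot hε hn)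
    (hasDerivWithinAt_comp_slice (cellCoeff n) Set.ordConnected_Iic hux.1)
    (hasDerivWithinAt_comp_slice (cellCoeff n) Set.ordConnected_Iic huxx.1)
    (fun x hx => norm_cellCoeff_le_of_norm_le n (norm_slice_neg_le u ⟨x, hx⟩))
    fun x hx => by
      have heq := cellCoeff_slice_equation hε (f := f.1.1) (uxx := uxx.1) (ux := ux.1)
        (w := trace u) (a := Real.exp x) (huη.1 ⟨x, hx⟩) (huηη.1 ⟨x, hx⟩) (hp.1 ⟨x, hx⟩)
        (hpη.1 ⟨x, hx⟩) (fun η => hf (⟨x, hx⟩, η)) n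
      rw [slice_zero_neg]
      exact (congrArg norm heq).trans_le
        (norm_cellCoeff_le_of_norm_le n (norm_slice_neg_le f ⟨x, hx⟩))

lemma GraphLA.norm_cellCoeff_trace_le {ε : ℝ} (hε : 0 < ε) {n : ℤ} (hn : n ≠ 0) {u f : XSpace ℓ}
    (h : GraphLA ε u f) : (modeRoot ℓ ε n - 1) * (2 * modeRoot ℓ ε n + 1) / modeRoot ℓ ε n *
      ‖cellCoeff n (trace u)‖ ≤ 4 * (‖cellCoeff (ℓ := ℓ) n‖ * xSeminorm ℓ f) := by
  obtain ⟨ux, uxx, uη, uηη, hux, huxx, huη, huηη, -, hm, hmx, hp, hpη, hneg, hpos⟩ := h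
  have hr : 1 < modeRoot ℓ ε n := one_lt_modeRoot hε hn
  have hslice {v : Pair ℓ} (hv : MatchAtZero v) : slice v.2 0 = slice v.1 0 :=
    ContinuousMap.ext fun η => ((slice_coe_apply v.2 zeroPos η).trans (hv η).symm).trans
      (slice_coe_apply v.1 zeroNeg η).symm
  have hdiff := norm_sub_le_of_le
    (norm_adjointPairing_cellCoeff_pos_le hε hn hux huxx huη huηη hp hpη hpos)
    (norm_adjointPairing_cellCoeff_neg_le hε hn hux huxx huη huηη hp hpη hneg)
  rw [adjointPairing_sub_adjointPairing (v := fun x => cellCoeff n (slice u.1.1 x)) (by linarith)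
    (congrArg (cellCoeff n) (hslice hm)) (congrArg (cellCoeff n) (hslice hmx)), norm_smul,
    Real.norm_of_nonneg (div_nonneg (mul_nonneg (by linarith) (by linarith)) (by linarith)),
    slice_zero_neg] at hdiff
  linarith

lemma GraphLEps.cellCoeff_trace_eq_zero {ε : ℝ} (hε : 0 < ε) {n : ℤ} (hn : n ≠ 0)
    {u : XSpace ℓ} (h : GraphLEps ε u 0) : cellCoeff n (trace u) = 0 := by
  obtain ⟨un, fn, hg, hu, hf⟩ := h
  simp only [sub_zero, xNorm_eq_xSeminorm] at hf
  have hr : 1 < modeRoot ℓ ε n := one_lt_modeRoot hε hn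
  have hlim := ((((cellCoeff n).continuous.tendsto _).comp (tendsto_trace hu)).norm).const_mul
    ((modeRoot ℓ ε n - 1) * (2 * modeRoot ℓ ε n + 1) / modeRoot ℓ ε n)
  have hzero := (hf.const_mul ‖cellCoeff (ℓ := ℓ) n‖).const_mul 4
  have hle := le_of_tendsto_of_tendsto' hlim hzero fun k => (hg k).norm_cellCoeff_trace_le hε hn
  rw [mul_zero, mul_zero] at hle
  refine norm_le_zero_iff.1 (nonpos_of_mul_nonpos_right hle ?_)
  exact div_pos (mul_pos (by linarith) (by linarith)) (by linarith)

lemma GraphLEps.trace_eq_add_const {ε : ℝ} (hε : 0 < ε) {u u' f : XSpace ℓ} (h : GraphLEps ε u f)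
    (h' : GraphLEps ε u' f) : ∃ c : ℝ, ∀ η, trace u η = trace u' η + c := by
  have hsub : GraphLEps ε (u - u') 0 := sub_self f ▸ h.sub h'
  obtain ⟨G, hG⟩ := exists_restr_eq (trace (u - u')).continuous hsub.endsAgree_trace
  obtain ⟨c, hc⟩ := eq_const_of_coeff_eq_zero (F := G) fun n hn => by
    rw [← cellCoeff_of_eq_restr n (g := trace (u - u')) hG.symm,
      hsub.cellCoeff_trace_eq_zero hε hn]
  refine ⟨c, fun η => ?_⟩
  have : trace (u - u') η = c := by rw [← hG, hc, restr_apply]; rfl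
  rw [map_sub, ContinuousMap.sub_apply] at this
  linarith

lemma HasDerivOn.congr_add_const {S : Set ℝ} {f f' g : S → ℝ} {c : ℝ} (h : HasDerivOn f g)
    (hc : ∀ x, f' x = f x + c) : HasDerivOn f' g :=
  (hasDerivOn_iff_of_eqOn fun x => by rw [extend_val, hc]).2 fun x => (h x).add_const c

lemma GraphB.unique {ε : ℝ} (hε : 0 < ε) {ψ g g' : Cell ℓ → ℝ} (h : GraphB ε ψ g)
    (h' : GraphB ε ψ g') : g = g' := by
  obtain ⟨ψ₁, ψ₂, w₁, w₂, f, u, hψ, hψ₁, hf₁, hf₂, hu, hw, hw₁, hg⟩ := h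
  obtain ⟨ψ₁', ψ₂', w₁', w₂', f', u', hψ', hψ₁', hf₁', hf₂', hu', hw', hw₁', hg'⟩ := h'
  obtain rfl := hψ.unique uniqueDiffOn_cell hψ'
  obtain rfl := hψ₁.unique uniqueDiffOn_cell hψ₁'
  have hff' : f = f' := Subtype.ext (Prod.ext (ContinuousMap.ext fun p => by rw [hf₁, hf₁'])
    (ContinuousMap.ext fun p => by rw [hf₂, hf₂']))
  subst hff'
  obtain ⟨c, hc⟩ := GraphLEps.trace_eq_add_const hε hu.2.2 hu'.2.2
  obtain rfl := (hw'.congr_add_const hc).unique uniqueDiffOn_cell hw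
  obtain rfl := hw₁.unique uniqueDiffOn_cell hw₁'
  ext η
  rw [hg, hg']

end Uniqueness

section Profiles

/-- The functions `(a x² + b x + d) e^x + k e^{r x}`, which contain the first components of the
source `V - T - (4/3) U` and of the solution in each Fourier mode. -/
def negFun (a b d k r : ℝ) : C(ℝ, ℝ) :=
  ⟨fun x => (a * x ^ 2 + b * x + d) * Real.exp x + k * Real.exp (r * x), by fun_prop⟩

/-- The functions `α x + β + k e^{s x}`, which contain the second components of the source
`V - T - (4/3) U` and of the solution in each Fourier mode. -/
def posFun (α β k s : ℝ) : C(ℝ, ℝ) :=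
  ⟨fun x => α * x + β + k * Real.exp (s * x), by fun_prop⟩

variable {a b d k r α β s x : ℝ}

lemma negFun_apply : negFun a b d k r x =
    (a * x ^ 2 + b * x + d) * Real.exp x + k * Real.exp (r * x) := rfl

lemma posFun_apply : posFun α β k s x = α * x + β + k * Real.exp (s * x) := rfl

lemma hasDerivAt_negFun (x : ℝ) :
    HasDerivAt (negFun a b d k r) (negFun a (2 * a + b) (b + d) (k * r) r x) x := by
  have hpoly : HasDerivAt (fun x : ℝ => a * x ^ 2 + b * x + d) (a * (2 * x) + b) x := by
    simpa using (((hasDerivAt_pow 2 x).const_mul a).add ((hasDerivAt_id x).const_mul b)).add_const d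
  refine ((hpoly.mul (Real.hasDerivAt_exp x)).add
    ((hasDerivAt_exp_mul r x).const_mul k)).congr_deriv ?_
  rw [negFun_apply]
  ring

lemma hasDerivAt_posFun (x : ℝ) :
    HasDerivAt (posFun α β k s) (posFun 0 α (k * s) s x) x := by
  refine ((((hasDerivAt_id x).const_mul α).add_const β).add
    ((hasDerivAt_exp_mul s x).const_mul k)).congr_deriv ?_
  rw [posFun_apply]
  ring

lemma neg_mul_exp_half_le (x : ℝ) : -x * Real.exp (1 / 2 * x) ≤ 2 := by
  have h := mul_le_mul_of_nonneg_right (Real.add_one_le_exp (-(1 / 2 * x)))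
    (Real.exp_pos (1 / 2 * x)).le
  rw [← Real.exp_add, neg_add_cancel, Real.exp_zero] at h
  linarith [Real.exp_pos (1 / 2 * x)]

lemma sq_mul_exp_half_le (hx : x ≤ 0) : x ^ 2 * Real.exp (1 / 2 * x) ≤ 8 := by
  have h := mul_le_mul_of_nonneg_right
    (Real.quadratic_le_exp_of_nonneg (show 0 ≤ -(1 / 2 * x) by linarith))
    (Real.exp_pos (1 / 2 * x)).le
  rw [← Real.exp_add, neg_add_cancel, Real.exp_zero] at h
  nlinarith [Real.exp_pos (1 / 2 * x)]

lemma abs_quadratic_mul_exp_half_le (hx : x ≤ 0) :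
    |a * x ^ 2 + b * x + d| * Real.exp (1 / 2 * x) ≤ 8 * |a| + 2 * |b| + |d| := by
  have hexp : Real.exp (1 / 2 * x) ≤ 1 := Real.exp_le_one_iff.2 (by linarith)
  calc |a * x ^ 2 + b * x + d| * Real.exp (1 / 2 * x)
      ≤ (|a| * x ^ 2 + |b| * -x + |d|) * Real.exp (1 / 2 * x) := by
        gcongr
        refine (abs_add_three _ _ _).trans_eq ?_
        rw [abs_mul, abs_mul, abs_of_nonneg (sq_nonneg x), abs_of_nonpos hx]
    _ = |a| * (x ^ 2 * Real.exp (1 / 2 * x)) + |b| * (-x * Real.exp (1 / 2 * x)) +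
          |d| * Real.exp (1 / 2 * x) := by ring
    _ ≤ |a| * 8 + |b| * 2 + |d| * 1 := by
        gcongr
        exacts [sq_mul_exp_half_le hx, neg_mul_exp_half_le x]
    _ = 8 * |a| + 2 * |b| + |d| := by ring

lemma abs_negFun_le (hr : 1 ≤ r) (hx : x ≤ 0) :
    |negFun a b d k r x| ≤ (8 * |a| + 2 * |b| + |d| + |k|) * Real.exp (1 / 2 * x) := by
  have hexp : Real.exp (r * x) ≤ Real.exp (1 / 2 * x) := Real.exp_le_exp.2 (by nlinarith)
  calc |negFun a b d k r x|
      ≤ |a * x ^ 2 + b * x + d| * Real.exp x + |k| * Real.exp (r * x) := by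
        refine (abs_add_le _ _).trans_eq ?_
        rw [abs_mul, abs_mul, Real.abs_exp, Real.abs_exp]
    _ ≤ |a * x ^ 2 + b * x + d| * Real.exp (1 / 2 * x) * Real.exp (1 / 2 * x) +
          |k| * Real.exp (1 / 2 * x) := by
        rw [mul_assoc, ← Real.exp_add, ← add_mul, add_halves, one_mul]
        gcongr
    _ ≤ (8 * |a| + 2 * |b| + |d|) * Real.exp (1 / 2 * x) + |k| * Real.exp (1 / 2 * x) := by
        gcongr
        exact abs_quadratic_mul_exp_half_le hx
    _ = _ := by ring

lemma abs_posFun_le (hs : s ≤ 0) (hx : 0 ≤ x) :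
    |posFun α β k s x| ≤ (2 * |α| + |β| + |k|) * Real.exp (1 / 2 * x) := by
  have hlin := Real.add_one_le_exp (1 / 2 * x)
  calc |posFun α β k s x| ≤ |α| * x + |β| * 1 + |k| * Real.exp (s * x) := by
        refine (abs_add_three _ _ _).trans_eq ?_
        rw [abs_mul, abs_mul, abs_of_nonneg hx, Real.abs_exp, mul_one]
    _ ≤ |α| * (2 * Real.exp (1 / 2 * x)) + |β| * Real.exp (1 / 2 * x) +
          |k| * Real.exp (1 / 2 * x) := by
        gcongr
        · linarith
        · linarith
        · nlinarith
    _ = _ := by ring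

lemma integrableOn_Iic_of_abs_le {φ : ℝ → ℝ} (hφ : Continuous φ) {A : ℝ}
    (h : ∀ x ≤ 0, |φ x| ≤ A * Real.exp (1 / 2 * x)) : IntegrableOn φ (Set.Iic 0) :=
  ((integrableOn_exp_mul_Iic (by norm_num) 0).const_mul A).mono' hφ.aestronglyMeasurable
    ((ae_restrict_mem measurableSet_Iic).mono h)

lemma abs_exp_neg_mul_le {A y : ℝ} (h : |y| ≤ A * Real.exp (1 / 2 * x)) :
    |Real.exp (-x) * y| ≤ A * Real.exp (-(1 / 2) * x) := by
  rw [abs_mul, Real.abs_exp]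
  refine (mul_le_mul_of_nonneg_left h (Real.exp_pos _).le).trans_eq ?_
  rw [mul_left_comm, ← Real.exp_add]
  ring_nf

lemma integrableOn_Ici_of_abs_le {φ : ℝ → ℝ} (hφ : Continuous φ) {A : ℝ}
    (h : ∀ x, 0 ≤ x → |φ x| ≤ A * Real.exp (1 / 2 * x)) :
    IntegrableOn (fun x => Real.exp (-x) * φ x) (Set.Ici 0) :=
  (((integrableOn_Ici_iff_integrableOn_Ioi).2
    (integrableOn_exp_mul_Ioi (by norm_num) 0)).const_mul A).mono' (by fun_prop)
    ((ae_restrict_mem measurableSet_Ici).mono fun x hx => abs_exp_neg_mul_le (h x hx))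

lemma integral_negFun (hr : 1 ≤ r) :
    ∫ x in Set.Iic (0 : ℝ), negFun a b d k r x = d - b + 2 * a + k / r := by
  have hr₀ : r ≠ 0 := by positivity
  have hlim : Tendsto (negFun a (b - 2 * a) (d - b + 2 * a) (k / r) r) atBot (𝓝 0) :=
    squeeze_zero_norm' ((eventually_le_atBot 0).mono fun x hx => abs_negFun_le hr hx)
      (tendsto_exp_mul_atBot (by norm_num) _)
  rw [integral_Iic_of_hasDerivAt_of_tendsto'
    (fun x _ => (hasDerivAt_negFun x).congr_deriv (by
      simp only [negFun_apply]
      field_simp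
      ring))
    (integrableOn_Iic_of_abs_le (negFun a b d k r).continuous fun x hx => abs_negFun_le hr hx) hlim]
  simp [negFun_apply]

lemma integral_posFun (hs : s ≤ 0) :
    ∫ x in Set.Ici (0 : ℝ), Real.exp (-x) * posFun α β k s x = α + β + k / (1 - s) := by
  have hs₁ : 1 - s ≠ 0 := by linarith
  have hderiv (x : ℝ) :
      HasDerivAt (fun x => -(Real.exp (-x) * posFun α (α + β) (k / (1 - s)) s x))
        (Real.exp (-x) * posFun α β k s x) x := by
    refine ((hasDerivAt_neg x).exp.mul (hasDerivAt_posFun x)).neg.congr_deriv ?_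
    simp only [posFun_apply]
    field_simp
    ring
  have hlim : Tendsto (fun x => -(Real.exp (-x) * posFun α (α + β) (k / (1 - s)) s x)) atTop
      (𝓝 0) := by
    refine squeeze_zero_norm' ((eventually_ge_atTop 0).mono fun x hx => ?_)
      (tendsto_exp_mul_atTop (c := -(1 / 2)) (by norm_num)
        (2 * |α| + |α + β| + |k / (1 - s)|))
    rw [norm_neg]
    exact abs_exp_neg_mul_le (abs_posFun_le hs hx)
  rw [integral_Ici_eq_integral_Ioi, integral_Ioi_of_hasDerivAt_of_tendsto' (fun x _ => hderiv x)
    ((integrableOn_Ici_of_abs_le (posFun α β k s).continuous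
      fun x hx => abs_posFun_le hs hx).mono_set Set.Ioi_subset_Ici_self) hlim]
  simp [posFun_apply]

end Profiles

section ModeSolution

/-- The first component of `V - T - (4/3) U`. -/
def sourceNeg : C(ℝ, ℝ) := negFun (1 / 6) (-2 / 9) (-4 / 9) 0 1

/-- The second component of `V - T - (4/3) U`. -/
def sourcePos : C(ℝ, ℝ) := posFun (1 / 3) (-4 / 9) 0 0

lemma sourceNeg_apply (x : ℝ) : sourceNeg x = V₁ x - T₁ x - 4 / 3 * U₁ x := by
  rw [sourceNeg, negFun_apply, V₁, T₁, U₁]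
  ring

lemma sourcePos_apply (x : ℝ) : sourcePos x = V₂ x - T₂ x - 4 / 3 * U₂ x := by
  rw [sourcePos, posFun_apply, V₂, T₂, U₂]
  ring

lemma integral_sourceNeg_add_integral_sourcePos :
    (∫ x in Set.Iic (0 : ℝ), sourceNeg x) +
      ∫ x in Set.Ici (0 : ℝ), Real.exp (-x) * sourcePos x = 0 := by
  rw [sourceNeg, sourcePos, integral_negFun le_rfl, integral_posFun le_rfl]
  norm_num

/-- The value at `x = 0` of the solution in a mode with characteristic root `r`; it is determined by
the continuity of the derivative of the solution at `x = 0`. -/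
def traceSymb (r : ℝ) : ℝ := -(8 * r + 3) / (9 * r ^ 2 * (2 * r + 1))

/-- The coefficient of `x e^x` in the solution for `x ≤ 0`, where `m` is the inverse of the
eigenvalue `r (r - 1)` of the mode. -/
def linCoeff (m : ℝ) : ℝ := m * (m / 3 - 2 / 9)

/-- The coefficient of `e^x` in the solution for `x ≤ 0`, where `m` is the inverse of the eigenvalue
`r (r - 1)` of the mode. -/
def constCoeffNeg (m r : ℝ) : ℝ := m * (m / 3 + linCoeff m - 4 / 9 + traceSymb r)

/-- The constant term of the solution for `x ≥ 0`, where `m` is the inverse of the eigenvalue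
`r (r - 1)` of the mode. -/
def constCoeffPos (m : ℝ) : ℝ := -(m * (4 / 9 + m / 3))

/-- The first component of the solution for the source `V - T - (4/3) U` in a mode with
characteristic root `r`, where `m` is the inverse of the eigenvalue `r (r - 1)`. -/
def profNeg (m r : ℝ) : C(ℝ, ℝ) :=
  negFun (m / 6) (linCoeff m) (constCoeffNeg m r) (traceSymb r - constCoeffNeg m r) r

/-- The second component of the solution for the source `V - T - (4/3) U` in a mode with
characteristic root `r`, where `m` is the inverse of the eigenvalue `r (r - 1)`. -/
def profPos (m r : ℝ) : C(ℝ, ℝ) :=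
  posFun (m / 3) (constCoeffPos m) (traceSymb r - constCoeffPos m) (1 - r)

variable {m r t : ℝ}

lemma profNeg_zero : profNeg m r 0 = traceSymb r := by
  simp [profNeg, negFun_apply]

lemma profPos_zero : profPos m r 0 = traceSymb r := by
  simp [profPos, posFun_apply]

lemma deriv_profNeg_zero_eq_deriv_profPos_zero (hr : 1 < r) (hm : m * (r * (r - 1)) = 1) :
    linCoeff m + constCoeffNeg m r + (traceSymb r - constCoeffNeg m r) * r =
      m / 3 + (traceSymb r - constCoeffPos m) * (1 - r) := by
  obtain rfl : m = 1 / (r * (r - 1)) := eq_one_div_of_mul_eq_one_left hm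
  have : r ≠ 0 := by positivity
  have : r - 1 ≠ 0 := by linarith
  have : 2 * r + 1 ≠ 0 := by positivity
  simp only [linCoeff, constCoeffNeg, constCoeffPos, traceSymb]
  field_simp
  ring

lemma integral_profNeg_add_integral_profPos (hr : 1 < r) (hm : m * (r * (r - 1)) = 1) :
    (∫ x in Set.Iic (0 : ℝ), profNeg m r x) +
      ∫ x in Set.Ici (0 : ℝ), Real.exp (-x) * profPos m r x = 0 := by
  rw [profNeg, profPos, integral_negFun hr.le, integral_posFun (by linarith), sub_sub_cancel]
  obtain rfl : m = 1 / (r * (r - 1)) := eq_one_div_of_mul_eq_one_left hm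
  have : r ≠ 0 := by positivity
  have : r - 1 ≠ 0 := by linarith
  have : 2 * r + 1 ≠ 0 := by positivity
  simp only [linCoeff, constCoeffNeg, constCoeffPos, traceSymb]
  field_simp
  ring

lemma abs_traceSymb_le (hr : 1 ≤ r) : |traceSymb r| ≤ 1 / r ^ 2 := by
  have hr₀ : 0 < r := by positivity
  rw [traceSymb, abs_div, abs_neg, abs_of_pos (by positivity), abs_of_pos (by positivity),
    div_le_div_iff₀ (by positivity) (by positivity)]
  nlinarith [pow_pos hr₀ 2, pow_pos hr₀ 3]

lemma abs_linCoeff_le (hm : 0 ≤ m) (ht : m ≤ t) : |linCoeff m| ≤ m * (1 + t) := by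
  rw [linCoeff, abs_mul, abs_of_nonneg hm]
  gcongr
  rw [abs_le]
  constructor <;> linarith

lemma abs_constCoeffPos_le (hm : 0 ≤ m) (ht : m ≤ t) : |constCoeffPos m| ≤ m * (1 + t) := by
  rw [constCoeffPos, abs_neg, abs_mul, abs_of_nonneg hm, abs_of_nonneg (by positivity)]
  gcongr
  exacts [by norm_num, by linarith]

lemma abs_constCoeffNeg_le (hm : 0 ≤ m) (ht : m ≤ t) (htr : |traceSymb r| ≤ m) :
    |constCoeffNeg m r| ≤ m * (1 + 3 * t + t ^ 2) := by
  have hlin := abs_le.1 (abs_linCoeff_le hm ht)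
  have hmt : m * (1 + t) ≤ t * (1 + t) := by
    gcongr
    linarith
  have htr := abs_le.1 htr
  rw [constCoeffNeg, abs_mul, abs_of_nonneg hm]
  gcongr
  rw [abs_le]
  constructor <;> linarith

lemma abs_profNeg_le (hr : 1 ≤ r) (hm : 0 ≤ m) (ht : m ≤ t) (htr : |traceSymb r| ≤ m) {x : ℝ}
    (hx : x ≤ 0) : |profNeg m r x| ≤ m * (13 * (2 + t) ^ 2) * Real.exp (1 / 2 * x) := by
  have hlin := abs_linCoeff_le hm ht
  have hconst := abs_constCoeffNeg_le hm ht htr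
  have hsub := abs_sub (traceSymb r) (constCoeffNeg m r)
  refine (abs_negFun_le hr hx).trans ?_
  gcongr
  rw [abs_of_nonneg (show 0 ≤ m / 6 by positivity)]
  nlinarith [mul_nonneg hm (hm.trans ht), mul_nonneg hm (sq_nonneg t)]

lemma abs_profPos_le (hr : 1 ≤ r) (hm : 0 ≤ m) (ht : m ≤ t) (htr : |traceSymb r| ≤ m) {x : ℝ}
    (hx : 0 ≤ x) : |profPos m r x| ≤ m * (13 * (2 + t) ^ 2) * Real.exp (1 / 2 * x) := by
  have hconst := abs_constCoeffPos_le hm ht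
  have hsub := abs_sub (traceSymb r) (constCoeffPos m)
  refine (abs_posFun_le (by linarith) hx).trans ?_
  gcongr
  rw [abs_of_nonneg (show 0 ≤ m / 3 by positivity)]
  nlinarith [mul_nonneg hm (hm.trans ht), mul_nonneg hm (sq_nonneg t)]

end ModeSolution

section Tensor

variable {ℓ : ℝ} {φ χ φ' χ' φ'' χ'' : C(ℝ, ℝ)} {A B : ℝ}

/-- The pair `(φ(x) q(η), χ(x) q(η))`, as a linear function of `q`. -/
def tensor (φ χ : C(ℝ, ℝ)) : C(Cell ℓ, ℝ) →ₗ[ℝ] Pair ℓ where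
  toFun q := (⟨fun p => φ p.1 * q p.2, by fun_prop⟩, ⟨fun p => χ p.1 * q p.2, by fun_prop⟩)
  map_add' q q' := Prod.ext (by ext p; exact mul_add _ _ _) (by ext p; exact mul_add _ _ _)
  map_smul' c q := Prod.ext (by ext p; exact mul_left_comm _ _ _)
    (by ext p; exact mul_left_comm _ _ _)

lemma tensor_neg_apply (q : C(Cell ℓ, ℝ)) (p : StripNeg ℓ) :
    (tensor φ χ q).1 p = φ p.1 * q p.2 := rfl

lemma tensor_pos_apply (q : C(Cell ℓ, ℝ)) (p : StripPos ℓ) :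
    (tensor φ χ q).2 p = χ p.1 * q p.2 := rfl

lemma hasDx_tensor (q : C(Cell ℓ, ℝ)) (hφ : ∀ x, HasDerivAt φ (φ' x) x)
    (hχ : ∀ x, HasDerivAt χ (χ' x) x) : HasDx (tensor φ χ q) (tensor φ' χ' q) :=
  ⟨fun η => (hasDerivOn_iff_of_eqOn (F := fun x => φ x * q η) fun _ => rfl).2
      fun x => ((hφ x).mul_const (q η)).hasDerivWithinAt,
    fun η => (hasDerivOn_iff_of_eqOn (F := fun x => χ x * q η) fun _ => rfl).2
      fun x => ((hχ x).mul_const (q η)).hasDerivWithinAt⟩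

lemma hasDeta_tensor (φ χ : C(ℝ, ℝ)) {q q' : C(Cell ℓ, ℝ)} (h : HasDerivOn q q') :
    HasDeta (tensor φ χ q) (tensor φ χ q') :=
  ⟨fun x => h.smul (φ x), fun x => h.smul (χ x)⟩

lemma periodicEta_tensor (φ χ : C(ℝ, ℝ)) {q : C(Cell ℓ, ℝ)} (h : EndsAgree q) :
    PeriodicEta (tensor φ χ q) := ⟨fun x => h.smul (φ x), fun x => h.smul (χ x)⟩

lemma matchAtZero_tensor (q : C(Cell ℓ, ℝ)) (h : φ 0 = χ 0) : MatchAtZero (tensor φ χ q) :=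
  fun η => congrArg (· * q η) h

lemma abs_mul_apply_le {a b e : ℝ} (h : |a| ≤ b * e) (q : C(Cell ℓ, ℝ)) (η : Cell ℓ) :
    |a * q η| ≤ b * ‖q‖ * e := by
  rw [abs_mul, mul_right_comm]
  exact mul_le_mul h (q.norm_coe_le_norm η) (abs_nonneg _) ((abs_nonneg a).trans h)

lemma tensor_mem (hφ : ∀ x ≤ 0, |φ x| ≤ A * Real.exp (1 / 2 * x))
    (hχ : ∀ x, 0 ≤ x → |χ x| ≤ B * Real.exp (1 / 2 * x)) (q : C(Cell ℓ, ℝ)) :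
    tensor φ χ q ∈ XSpace ℓ :=
  ⟨⟨A * ‖q‖, fun p => abs_exp_mul_le_iff.2 (abs_mul_apply_le (hφ _ p.1.2) q p.2)⟩,
    ⟨B * ‖q‖, fun p => abs_exp_mul_le_iff.2 (abs_mul_apply_le (hχ _ p.1.2) q p.2)⟩⟩

/-- `tensor φ χ` as a map into `𝓧`, for profiles that are `O(e^{x/2})`. -/
def xTensor (hφ : ∀ x ≤ 0, |φ x| ≤ A * Real.exp (1 / 2 * x))
    (hχ : ∀ x, 0 ≤ x → |χ x| ≤ B * Real.exp (1 / 2 * x)) : C(Cell ℓ, ℝ) →ₗ[ℝ] XSpace ℓ :=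
  (tensor φ χ).codRestrict (XSpace ℓ) (tensor_mem hφ hχ)

lemma xSeminorm_xTensor_le (hφ : ∀ x ≤ 0, |φ x| ≤ A * Real.exp (1 / 2 * x))
    (hχ : ∀ x, 0 ≤ x → |χ x| ≤ B * Real.exp (1 / 2 * x)) (q : C(Cell ℓ, ℝ)) :
    xSeminorm ℓ (xTensor hφ hχ q) ≤ (A + B) * ‖q‖ := by
  have hA : 0 ≤ A := by simpa using (abs_nonneg _).trans (hφ 0 le_rfl)
  have hB : 0 ≤ B := by simpa using (abs_nonneg _).trans (hχ 0 le_rfl)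
  rw [add_mul]
  exact xSeminorm_le (by positivity) (by positivity)
    (fun p => abs_mul_apply_le (hφ _ p.1.2) q p.2) fun p => abs_mul_apply_le (hχ _ p.1.2) q p.2

lemma graphLA_of_eq_tensor {ε μ : ℝ} {q q₁ q₂ : C(Cell ℓ, ℝ)} {g h : C(ℝ, ℝ)} {u f : XSpace ℓ}
    (hu : u.1 = tensor φ χ q) (hf : f.1 = tensor g h q) (hq : HasDerivOn q q₁)
    (hq₁ : HasDerivOn q₁ q₂) (hqe : EndsAgree q) (hqe₁ : EndsAgree q₁)
    (hμ : ∀ η, ε * q₂ η = -(μ * q η)) (hmem : tensor φ χ q₂ ∈ XSpace ℓ)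
    (hφ : ∀ x, HasDerivAt φ (φ' x) x) (hφ' : ∀ x, HasDerivAt φ' (φ'' x) x)
    (hχ : ∀ x, HasDerivAt χ (χ' x) x) (hχ' : ∀ x, HasDerivAt χ' (χ'' x) x)
    (h₀ : φ 0 = χ 0) (h₀' : φ' 0 = χ' 0)
    (hg : ∀ x, φ'' x - φ' x - μ * φ x + φ 0 * Real.exp x = g x)
    (hh : ∀ x, χ'' x - χ' x - μ * χ x = h x) : GraphLA ε u f := by
  rw [GraphLA, hu, hf]
  refine ⟨tensor φ' χ' q, tensor φ'' χ'' q, tensor φ χ q₁, tensor φ χ q₂, hasDx_tensor q hφ hχ,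
    hasDx_tensor q hφ' hχ', hasDeta_tensor φ χ hq, hasDeta_tensor φ χ hq₁, hmem,
    matchAtZero_tensor q h₀, matchAtZero_tensor q h₀', periodicEta_tensor φ χ hqe,
    periodicEta_tensor φ χ hqe₁, fun p => ?_, fun p => ?_⟩
  · simp only [tensor_neg_apply, ← hg, show ((zeroNeg : Set.Iic (0 : ℝ)) : ℝ) = 0 from rfl]
    linear_combination -φ p.1 * hμ p.2
  · simp only [tensor_pos_apply, ← hh]
    linear_combination -χ p.1 * hμ p.2

variable {m r : ℝ}

lemma negFun_equation {a b d k : ℝ} (x : ℝ) :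
    negFun a (2 * a + (2 * a + b)) (2 * a + b + (b + d)) (k * r * r) r x -
        negFun a (2 * a + b) (b + d) (k * r) r x - r * (r - 1) * negFun a b d k r x =
      negFun (-(r * (r - 1) * a)) (2 * a - r * (r - 1) * b) (2 * a + b - r * (r - 1) * d) 0 1
        x := by
  simp only [negFun_apply]
  ring

lemma posFun_equation {α β k : ℝ} (x : ℝ) :
    posFun 0 0 (k * (1 - r) * (1 - r)) (1 - r) x - posFun 0 α (k * (1 - r)) (1 - r) x -
        r * (r - 1) * posFun α β k (1 - r) x =
      posFun (-(r * (r - 1) * α)) (-(r * (r - 1) * β) - α) 0 0 x := by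
  simp only [posFun_apply]
  ring

lemma graphLA_prof {ε : ℝ} (hr : 1 < r) (hm : m * (r * (r - 1)) = 1) {q q₁ q₂ : C(Cell ℓ, ℝ)}
    (hq : HasDerivOn q q₁) (hq₁ : HasDerivOn q₁ q₂) (hqe : EndsAgree q) (hqe₁ : EndsAgree q₁)
    (hμ : ∀ η, ε * q₂ η = -(r * (r - 1) * q η))
    (hmem : tensor (profNeg m r) (profPos m r) q₂ ∈ XSpace ℓ)
    {u f : XSpace ℓ} (hu : u.1 = tensor (profNeg m r) (profPos m r) q)
    (hf : f.1 = tensor (-sourceNeg) (-sourcePos) q) : GraphLA ε u f := by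
  refine graphLA_of_eq_tensor hu hf hq hq₁ hqe hqe₁ hμ hmem hasDerivAt_negFun hasDerivAt_negFun
    hasDerivAt_posFun hasDerivAt_posFun (profNeg_zero.trans profPos_zero.symm) ?_ (fun x => ?_)
    fun x => ?_
  · have := deriv_profNeg_zero_eq_deriv_profPos_zero hr hm
    simp only [negFun_apply, posFun_apply, mul_zero, Real.exp_zero]
    linarith
  · rw [profNeg_zero, profNeg, negFun_equation, ContinuousMap.neg_apply, sourceNeg]
    simp only [negFun_apply, constCoeffNeg, linCoeff]
    linear_combination (-(x ^ 2 / 6) - x * (m / 3 - 2 / 9) - (m / 3 + m * (m / 3 - 2 / 9) - 4 / 9 +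
      traceSymb r)) * Real.exp x * hm
  · rw [profPos, posFun_equation, ContinuousMap.neg_apply, sourcePos]
    simp only [posFun_apply, constCoeffPos]
    linear_combination (-(x / 3) + (4 / 9 + m / 3)) * hm

end Tensor

section Mean

variable {ℓ : ℝ}

lemma integrable_exp_half_Iic : Integrable (fun x : Set.Iic (0 : ℝ) => Real.exp (1 / 2 * x))
    (volume.comap Subtype.val) :=
  (integrableOn_iff_comap_subtypeVal measurableSet_Iic).1
    (integrableOn_exp_mul_Iic (by norm_num) 0)

lemma integrable_exp_neg_half_Ici :
    Integrable (fun x : Set.Ici (0 : ℝ) => Real.exp (-(1 / 2) * x)) (volume.comap Subtype.val) :=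
  (integrableOn_iff_comap_subtypeVal measurableSet_Ici).1
    ((integrableOn_Ici_iff_integrableOn_Ioi).2 (integrableOn_exp_mul_Ioi (by norm_num) 0))

lemma integrable_neg (f : XSpace ℓ) (η : Cell ℓ) :
    Integrable (fun x : Set.Iic (0 : ℝ) => f.1.1 (x, η)) (volume.comap Subtype.val) :=
  (integrable_exp_half_Iic.const_mul (xSeminorm ℓ f)).mono'
    (Continuous.aestronglyMeasurable (by fun_prop)) (ae_of_all _ fun x => abs_neg_le f (x, η))

lemma integrable_pos (f : XSpace ℓ) (η : Cell ℓ) :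
    Integrable (fun x : Set.Ici (0 : ℝ) => Real.exp (-(x : ℝ)) * f.1.2 (x, η))
      (volume.comap Subtype.val) :=
  (integrable_exp_neg_half_Ici.const_mul (xSeminorm ℓ f)).mono'
    (Continuous.aestronglyMeasurable (by fun_prop))
    (ae_of_all _ fun x => abs_exp_neg_mul_le (abs_pos_le f (x, η)))

/-- The functional `f ↦ Q(f)(η)` on `𝓧`. -/
def meanAt (η : Cell ℓ) : XSpace ℓ →ₗ[ℝ] ℝ where
  toFun f := Q f η
  map_add' f g := by
    simp only [Q, Submodule.coe_add, Prod.fst_add, Prod.snd_add, ContinuousMap.add_apply, mul_add,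
      integral_add (integrable_neg f η) (integrable_neg g η),
      integral_add (integrable_pos f η) (integrable_pos g η)]
    ring
  map_smul' c f := by
    simp only [Q, Submodule.coe_smul, Prod.smul_fst, Prod.smul_snd, ContinuousMap.smul_apply,
      smul_eq_mul, mul_left_comm _ c, integral_const_mul, RingHom.id_apply]
    ring

lemma meanAt_apply (f : XSpace ℓ) (η : Cell ℓ) : meanAt η f = Q f η := rfl

lemma abs_meanAt_le (η : Cell ℓ) (f : XSpace ℓ) : |meanAt η f| ≤ 4 * xSeminorm ℓ f := by
  have hneg := norm_integral_le_of_norm_le (f := fun x : Set.Iic (0 : ℝ) => f.1.1 (x, η))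
    (integrable_exp_half_Iic.const_mul (xSeminorm ℓ f))
    (ae_of_all _ fun x => abs_neg_le f (x, η))
  have hpos := norm_integral_le_of_norm_le
    (f := fun x : Set.Ici (0 : ℝ) => Real.exp (-(x : ℝ)) * f.1.2 (x, η))
    (integrable_exp_neg_half_Ici.const_mul (xSeminorm ℓ f))
    (ae_of_all _ fun x => abs_exp_neg_mul_le (abs_pos_le f (x, η)))
  rw [integral_const_mul, integral_subtype_comap measurableSet_Iic fun x => Real.exp (1 / 2 * x),
    integral_exp_mul_Iic (by norm_num)] at hneg
  rw [integral_const_mul,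
    integral_subtype_comap measurableSet_Ici fun x => Real.exp (-(1 / 2) * x),
    integral_Ici_eq_integral_Ioi, integral_exp_mul_Ioi (by norm_num)] at hpos
  refine (abs_add_le _ _).trans ((add_le_add hneg hpos).trans_eq ?_)
  rw [mul_zero, mul_zero, Real.exp_zero]
  ring

lemma meanAt_of_eq_tensor {φ χ : C(ℝ, ℝ)} {q : C(Cell ℓ, ℝ)} {f : XSpace ℓ}
    (hf : f.1 = tensor φ χ q) (η : Cell ℓ) : meanAt η f = ((∫ x in Set.Iic (0 : ℝ), φ x) +
      ∫ x in Set.Ici (0 : ℝ), Real.exp (-x) * χ x) * q η := by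
  rw [meanAt_apply, Q, hf]
  simp only [tensor_neg_apply, tensor_pos_apply, ← mul_assoc, integral_mul_const]
  rw [integral_subtype_comap measurableSet_Iic φ,
    integral_subtype_comap measurableSet_Ici fun x => Real.exp (-x) * χ x, add_mul]

lemma inComplement_of_meanAt_eq_zero {f : XSpace ℓ} (h : ∀ η, meanAt η f = 0) : InComplement f :=
  ⟨fun p => mul_eq_zero_of_left (h p.2) _, fun p => mul_eq_zero_of_left (h p.2) _⟩

end Mean

section Series

variable {ι E F : Type*} [SeminormedAddCommGroup E] [NormedSpace ℝ E] [NormedAddCommGroup F]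
  [NormedSpace ℝ F] [CompleteSpace F] {T : ι → E →ₗ[ℝ] F} {b : ι → ℝ}

/-- The sum of a series of linear maps whose operator norms are summable. -/
def tsumLinear (hb : Summable b) (hT : ∀ i x, ‖T i x‖ ≤ b i * ‖x‖) : E →ₗ[ℝ] F where
  toFun x := ∑' i, T i x
  map_add' x y := by
    have hs (x : E) : Summable fun i => T i x := .of_norm_bounded (hb.mul_right ‖x‖) fun i => hT i x
    simp only [map_add, (hs x).tsum_add (hs y)]
  map_smul' c x := by
    simp only [map_smul, RingHom.id_apply, tsum_const_smul'']

lemma norm_tsumLinear_le (hb : Summable b) (hT : ∀ i x, ‖T i x‖ ≤ b i * ‖x‖) (x : E) :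
    ‖tsumLinear hb hT x‖ ≤ (∑' i, b i) * ‖x‖ :=
  tsum_of_norm_bounded (hb.hasSum.mul_right ‖x‖) fun i => hT i x

end Series

section FourierProj

variable {ℓ : ℝ}

/-- The real part of a function on the circle, as a function on the cell. -/
def reCell : C(AddCircle ℓ, ℂ) →ₗ[ℝ] C(Cell ℓ, ℝ) where
  toFun F := ⟨fun η => (F ((η : ℝ) : AddCircle ℓ)).re, Complex.continuous_re.comp
    (F.continuous.comp ((AddCircle.continuous_mk' ℓ).comp continuous_subtype_val))⟩
  map_add' F G := by ext η; simp
  map_smul' c F := by ext η; simp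

lemma reCell_apply (F : C(AddCircle ℓ, ℂ)) (η : Cell ℓ) :
    reCell F η = (F ((η : ℝ) : AddCircle ℓ)).re := rfl

lemma endsAgree_reCell (F : C(AddCircle ℓ, ℂ)) : EndsAgree (reCell F) :=
  endsAgree_restr (reCircle F)

lemma hasDerivOn_reCell_fourier (c : ℂ) (n : ℤ) :
    HasDerivOn (reCell (c • (fourier n : C(AddCircle ℓ, ℂ))))
      (reCell ((c * freq ℓ n) • (fourier n : C(AddCircle ℓ, ℂ)))) := by
  refine (hasDerivOn_iff_of_eqOn
    (F := fun s : ℝ => (c * fourier n (s : AddCircle ℓ)).re) fun _ => rfl).2 fun x => ?_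
  have h := Complex.reCLM.hasFDerivAt.comp_hasDerivAt (x : ℝ)
    ((hasDerivAt_fourier ℓ n x).const_mul c)
  refine (h.congr_deriv ?_).hasDerivWithinAt
  rw [reCell_apply, freq, ContinuousMap.smul_apply, smul_eq_mul, mul_assoc c]
  rfl

variable [hℓ : Fact (0 < ℓ)] {ε : ℝ}

lemma norm_reCell_le (F : C(AddCircle ℓ, ℂ)) : ‖reCell F‖ ≤ ‖F‖ :=
  (ContinuousMap.norm_le _ (norm_nonneg _)).2 fun _ =>
    (Complex.abs_re_le_norm _).trans (F.norm_coe_le_norm _)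

/-- The projection of a function onto its `n`-th Fourier mode. -/
def fourierProj (n : ℤ) : C(AddCircle ℓ, ℂ) →L[ℝ] C(AddCircle ℓ, ℂ) :=
  ((fourierCoeffCLM n).smulRight (fourier n : C(AddCircle ℓ, ℂ))).restrictScalars ℝ

lemma fourierProj_apply (n : ℤ) (F : C(AddCircle ℓ, ℂ)) :
    fourierProj n F = fourierCoeffCLM n F • fourier n := rfl

lemma norm_fourierProj_le (n : ℤ) (F : C(AddCircle ℓ, ℂ)) : ‖fourierProj n F‖ ≤ ‖F‖ := by
  rw [fourierProj_apply, norm_smul, fourier_norm, mul_one]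
  exact norm_fourierCoeff_le F n

lemma fourierProj_smul_fourier (k : ℤ) (c : ℂ) (n : ℤ) :
    fourierProj k (c • (fourier n : C(AddCircle ℓ, ℂ))) = if k = n then c • fourier n else 0 := by
  rw [fourierProj_apply, map_smul, fourierCoeffCLM_fourier]
  split_ifs with h
  · rw [h, smul_eq_mul, mul_one]
  · rw [smul_zero, zero_smul]

/-- The projection of a function onto the functions of mean zero. -/
def meanFree : C(AddCircle ℓ, ℂ) →L[ℝ] C(AddCircle ℓ, ℂ) := .id ℝ _ - fourierProj 0

lemma meanFree_apply (F : C(AddCircle ℓ, ℂ)) : meanFree F = F - fourierProj 0 F := rfl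

lemma norm_meanFree_le (F : C(AddCircle ℓ, ℂ)) : ‖meanFree F‖ ≤ 2 * ‖F‖ := by
  rw [meanFree_apply, two_mul]
  exact (norm_sub_le _ _).trans (add_le_add_right (norm_fourierProj_le 0 F) _)

lemma meanFree_smul_fourier_zero (c : ℂ) :
    meanFree (c • (fourier 0 : C(AddCircle ℓ, ℂ))) = 0 := by
  rw [meanFree_apply, fourierProj_smul_fourier, if_pos rfl, sub_self]

lemma meanFree_smul_fourier (c : ℂ) {n : ℤ} (hn : n ≠ 0) :
    meanFree (c • (fourier n : C(AddCircle ℓ, ℂ))) = c • fourier n := by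
  rw [meanFree_apply, fourierProj_smul_fourier, if_neg hn.symm, sub_zero]

lemma meanFree_toComplex {F : C(AddCircle ℓ, ℝ)} (h : coeff 0 F = 0) :
    meanFree (toComplex F) = toComplex F := by
  rw [meanFree_apply, fourierProj_apply, ← coeff_eq_fourierCoeffCLM, h, zero_smul, sub_zero]

/-- A symbol depending only on the characteristic root takes the same value at `n` and `-n`, so the
multiplier acts as a scalar on the real part of the `n`-th mode. -/
lemma IsMultiplier.apply_reCircle_fourier {φ : ℝ → ℝ}
    {M : C(AddCircle ℓ, ℝ) →L[ℝ] C(AddCircle ℓ, ℝ)} (hM : IsMultiplier (rootSymbol ℓ ε φ) M)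
    (c : ℂ) (n : ℤ) :
    M (reCircle (c • fourier n)) = φ (modeRoot ℓ ε n) • reCircle (c • fourier n) :=
  ext_coeff fun k => by
    rw [hM, coeff_smul, coeff_reCircle, map_smul, map_smul, fourierCoeffCLM_fourier,
      fourierCoeffCLM_fourier, rootSymbol]
    by_cases hk : k = n
    · rw [hk]
    by_cases hk' : -k = n
    · rw [← hk', modeRoot_neg]
    · simp [hk, hk']

end FourierProj

section Solution

variable {ℓ ε : ℝ}

/-- The first component of the solution in the `n`-th Fourier mode. -/
def modeNeg (ℓ ε : ℝ) (n : ℤ) : C(ℝ, ℝ) := profNeg (1 / modeEig ℓ ε n) (modeRoot ℓ ε n)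

/-- The second component of the solution in the `n`-th Fourier mode. -/
def modePos (ℓ ε : ℝ) (n : ℤ) : C(ℝ, ℝ) := profPos (1 / modeEig ℓ ε n) (modeRoot ℓ ε n)

/-- The bound of `abs_profNeg_le` and `abs_profPos_le` for the `n`-th Fourier mode. -/
def modeBound (ℓ ε : ℝ) (n : ℤ) : ℝ := 1 / modeEig ℓ ε n * (13 * (2 + 1 / modeEig ℓ ε 1) ^ 2)

lemma summable_modeBound :
    Summable fun n : {n : ℤ // n ≠ 0} => modeBound ℓ ε n + modeBound ℓ ε n :=
  have h : Summable (modeBound ℓ ε) := summable_inv_modeEig.mul_right _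
  (h.add h).subtype {n : ℤ | n ≠ 0}

variable [hℓ : Fact (0 < ℓ)]

lemma one_div_modeEig_le (hε : 0 < ε) {n : ℤ} (hn : n ≠ 0) :
    1 / modeEig ℓ ε n ≤ 1 / modeEig ℓ ε 1 := by
  refine one_div_le_one_div_of_le (modeEig_pos hε one_ne_zero) ?_
  have : (1 : ℝ) ≤ (n : ℝ) ^ 2 := by
    rw [one_le_sq_iff_one_le_abs]
    exact_mod_cast Int.one_le_abs hn
  rw [modeEig_eq, modeEig_eq, Int.cast_one, one_pow]
  gcongr

lemma abs_traceSymb_modeRoot_le (hε : 0 < ε) {n : ℤ} (hn : n ≠ 0) :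
    |traceSymb (modeRoot ℓ ε n)| ≤ 1 / modeEig ℓ ε n := by
  refine (abs_traceSymb_le (one_le_modeRoot hε n)).trans
    (one_div_le_one_div_of_le (modeEig_pos hε hn) ?_)
  rw [← modeRoot_mul hε]
  nlinarith [one_le_modeRoot (ℓ := ℓ) hε n]

lemma modeBound_nonneg (hε : 0 < ε) {n : ℤ} (hn : n ≠ 0) : 0 ≤ modeBound ℓ ε n := by
  have := modeEig_pos (ℓ := ℓ) hε hn
  rw [modeBound]
  positivity

lemma abs_modeNeg_le (hε : 0 < ε) {n : ℤ} (hn : n ≠ 0) (x : ℝ) (hx : x ≤ 0) :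
    |modeNeg ℓ ε n x| ≤ modeBound ℓ ε n * Real.exp (1 / 2 * x) :=
  abs_profNeg_le (one_le_modeRoot hε n) (one_div_pos.2 (modeEig_pos hε hn)).le
    (one_div_modeEig_le hε hn) (abs_traceSymb_modeRoot_le hε hn) hx

lemma abs_modePos_le (hε : 0 < ε) {n : ℤ} (hn : n ≠ 0) (x : ℝ) (hx : 0 ≤ x) :
    |modePos ℓ ε n x| ≤ modeBound ℓ ε n * Real.exp (1 / 2 * x) :=
  abs_profPos_le (one_le_modeRoot hε n) (one_div_pos.2 (modeEig_pos hε hn)).le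
    (one_div_modeEig_le hε hn) (abs_traceSymb_modeRoot_le hε hn) hx

lemma one_div_modeEig_mul (hε : 0 < ε) {n : ℤ} (hn : n ≠ 0) :
    1 / modeEig ℓ ε n * (modeRoot ℓ ε n * (modeRoot ℓ ε n - 1)) = 1 := by
  rw [modeRoot_mul hε, one_div_mul_cancel (modeEig_pos hε hn).ne']

/-- The solution in the `n`-th Fourier mode as a function of the source. -/
def modeTensor (hε : 0 < ε) {n : ℤ} (hn : n ≠ 0) : C(Cell ℓ, ℝ) →ₗ[ℝ] XSpace ℓ :=
  xTensor (abs_modeNeg_le (ℓ := ℓ) hε hn) (abs_modePos_le (ℓ := ℓ) hε hn)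

lemma coe_modeTensor (hε : 0 < ε) {n : ℤ} (hn : n ≠ 0) (q : C(Cell ℓ, ℝ)) :
    (modeTensor hε hn q).1 = tensor (modeNeg ℓ ε n) (modePos ℓ ε n) q := rfl

/-- The contribution of the `n`-th Fourier mode to the solution, with values in the Banach space to
which `𝓧` is isomorphic, where the contributions can be summed. -/
def modeOperator (hε : 0 < ε) (n : {n : ℤ // n ≠ 0}) : C(AddCircle ℓ, ℂ) →ₗ[ℝ]
    BoundedContinuousFunction (StripNeg ℓ) ℝ × BoundedContinuousFunction (StripPos ℓ) ℝ :=
  weightedEquiv.toLinearMap ∘ₗ modeTensor hε n.2 ∘ₗ reCell ∘ₗ (fourierProj n.1).toLinearMap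

lemma modeOperator_apply (hε : 0 < ε) (n : {n : ℤ // n ≠ 0}) (F : C(AddCircle ℓ, ℂ)) :
    modeOperator hε n F = weightedEquiv (modeTensor hε n.2 (reCell (fourierProj n.1 F))) := rfl

lemma norm_modeOperator_le (hε : 0 < ε) (n : {n : ℤ // n ≠ 0}) (F : C(AddCircle ℓ, ℂ)) :
    ‖modeOperator hε n F‖ ≤ (modeBound ℓ ε n + modeBound ℓ ε n) * ‖F‖ := by
  have := modeBound_nonneg (ℓ := ℓ) hε n.2
  refine (norm_weightedEquiv_le _).trans ((xSeminorm_xTensor_le (abs_modeNeg_le hε n.2)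
    (abs_modePos_le hε n.2) _).trans ?_)
  gcongr
  exact (norm_reCell_le _).trans (norm_fourierProj_le _ F)

/-- The solution operator of the resolvent equation with the source `sourceOp`. -/
def solution (hε : 0 < ε) : C(AddCircle ℓ, ℂ) →ₗ[ℝ] XSpace ℓ :=
  weightedEquiv.symm.toLinearMap ∘ₗ tsumLinear summable_modeBound (norm_modeOperator_le hε)

lemma weightedEquiv_solution (hε : 0 < ε) (F : C(AddCircle ℓ, ℂ)) :
    weightedEquiv (solution hε F) = ∑' n, modeOperator hε n F :=
  weightedEquiv.apply_symm_apply _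

lemma exists_xSeminorm_solution_le (hε : 0 < ε) :
    ∃ C, ∀ F : C(AddCircle ℓ, ℂ), xSeminorm ℓ (solution hε F) ≤ C * ‖F‖ := by
  refine ⟨2 * ∑' n : {n : ℤ // n ≠ 0}, (modeBound ℓ ε n + modeBound ℓ ε n), fun F => ?_⟩
  refine (xSeminorm_le_norm_weightedEquiv _).trans ?_
  rw [weightedEquiv_solution, mul_assoc]
  gcongr
  exact norm_tsumLinear_le summable_modeBound (norm_modeOperator_le hε) F

lemma modeOperator_smul_fourier_of_ne (hε : 0 < ε) {k : {n : ℤ // n ≠ 0}} {n : ℤ} (c : ℂ)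
    (hk : k.1 ≠ n) : modeOperator hε k (c • (fourier n : C(AddCircle ℓ, ℂ))) = 0 := by
  rw [modeOperator_apply, fourierProj_smul_fourier, if_neg hk, map_zero, map_zero, map_zero]

lemma solution_smul_fourier_zero (hε : 0 < ε) (c : ℂ) :
    solution hε (c • (fourier 0 : C(AddCircle ℓ, ℂ))) = 0 :=
  weightedEquiv.injective <| by
    rw [weightedEquiv_solution, map_zero]
    exact (tsum_congr fun k => modeOperator_smul_fourier_of_ne hε c k.2).trans tsum_zero

lemma solution_smul_fourier (hε : 0 < ε) (c : ℂ) {n : ℤ} (hn : n ≠ 0) :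
    solution hε (c • (fourier n : C(AddCircle ℓ, ℂ))) =
      modeTensor hε hn (reCell (c • fourier n)) :=
  weightedEquiv.injective <| by
    rw [weightedEquiv_solution, tsum_eq_single (⟨n, hn⟩ : {n : ℤ // n ≠ 0}) fun k hk =>
      modeOperator_smul_fourier_of_ne hε c (Subtype.coe_ne_coe.2 hk), modeOperator_apply,
      fourierProj_smul_fourier, if_pos rfl]

lemma abs_sourceNeg_le (x : ℝ) (hx : x ≤ 0) : |sourceNeg x| ≤ 20 / 9 * Real.exp (1 / 2 * x) :=
  (abs_negFun_le le_rfl hx).trans_eq (by norm_num [abs_of_nonneg])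

lemma abs_sourcePos_le (x : ℝ) (hx : 0 ≤ x) : |sourcePos x| ≤ 10 / 9 * Real.exp (1 / 2 * x) :=
  (abs_posFun_le le_rfl hx).trans_eq (by norm_num [abs_of_nonneg])

/-- The function `V - T - (4/3) U` times the real part of `F` minus its mean. -/
def sourceOp : C(AddCircle ℓ, ℂ) →ₗ[ℝ] XSpace ℓ :=
  xTensor abs_sourceNeg_le abs_sourcePos_le ∘ₗ reCell ∘ₗ meanFree.toLinearMap

lemma coe_sourceOp (F : C(AddCircle ℓ, ℂ)) :
    (sourceOp F).1 = tensor sourceNeg sourcePos (reCell (meanFree F)) := rfl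

lemma xSeminorm_sourceOp_le (F : C(AddCircle ℓ, ℂ)) :
    xSeminorm ℓ (sourceOp F) ≤ 20 / 3 * ‖F‖ :=
  (xSeminorm_xTensor_le abs_sourceNeg_le abs_sourcePos_le (reCell (meanFree F))).trans <| by
    linarith [(norm_reCell_le (meanFree F)).trans (norm_meanFree_le F)]

lemma meanAt_sourceOp (η : Cell ℓ) (F : C(AddCircle ℓ, ℂ)) : meanAt η (sourceOp F) = 0 := by
  rw [meanAt_of_eq_tensor (coe_sourceOp F), integral_sourceNeg_add_integral_sourcePos, zero_mul]

lemma sourceOp_smul_fourier_zero (c : ℂ) :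
    sourceOp (c • (fourier 0 : C(AddCircle ℓ, ℂ))) = 0 := by
  rw [sourceOp, LinearMap.comp_apply, LinearMap.comp_apply, ContinuousLinearMap.coe_coe,
    meanFree_smul_fourier_zero, map_zero, map_zero]

lemma graphLA_solution_smul_fourier (hε : 0 < ε) (c : ℂ) {n : ℤ} (hn : n ≠ 0) :
    GraphLA ε (solution hε (c • (fourier n : C(AddCircle ℓ, ℂ)))) (-sourceOp (c • fourier n)) := by
  have hμ (η : Cell ℓ) :
      ε * reCell ((c * freq ℓ n * freq ℓ n) • (fourier n : C(AddCircle ℓ, ℂ))) η =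
        -(modeRoot ℓ ε n * (modeRoot ℓ ε n - 1) *
        reCell (c • (fourier n : C(AddCircle ℓ, ℂ))) η) := by
    have h : freq ℓ n * freq ℓ n = ((-(modeEig ℓ ε n / ε) : ℝ) : ℂ) := by rw [← sq, freq_sq hε]
    have h' : (c * freq ℓ n * freq ℓ n) • (fourier n : C(AddCircle ℓ, ℂ)) =
        (-(modeEig ℓ ε n / ε)) • c • (fourier n : C(AddCircle ℓ, ℂ)) := by
      rw [mul_assoc, h, mul_comm, mul_smul]
      rfl
    rw [h', map_smul, modeRoot_mul hε, ContinuousMap.smul_apply, smul_eq_mul]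
    field_simp
  refine graphLA_prof (one_lt_modeRoot hε hn) (one_div_modeEig_mul hε hn)
    (hasDerivOn_reCell_fourier c n) (hasDerivOn_reCell_fourier (c * freq ℓ n) n)
    (endsAgree_reCell _) (endsAgree_reCell _) hμ
    (tensor_mem (abs_modeNeg_le hε hn) (abs_modePos_le hε hn) _) ?_ ?_
  · rw [solution_smul_fourier hε c hn]
    rfl
  · ext p <;> simp [coe_sourceOp, meanFree_smul_fourier c hn, tensor_neg_apply, tensor_pos_apply]

lemma graphLEps_solution (hε : 0 < ε) (F : C(AddCircle ℓ, ℂ)) :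
    GraphLEps ε (solution hε F) (-sourceOp F) := by
  let V := (graphLA ℓ ε).comap ((solution hε).prod (-sourceOp))
  have hV (c : ℂ) (n : ℤ) : c • (fourier n : C(AddCircle ℓ, ℂ)) ∈ V := by
    rcases eq_or_ne n 0 with rfl | hn
    · suffices (solution hε (c • fourier 0), -sourceOp (c • fourier 0)) ∈ graphLA ℓ ε from this
      rw [solution_smul_fourier_zero, sourceOp_smul_fourier_zero, neg_zero]
      exact zero_mem (graphLA ℓ ε)
    · exact graphLA_solution_smul_fourier hε c hn
  obtain ⟨C, hC⟩ := exists_xSeminorm_solution_le (ℓ := ℓ) hε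
  obtain ⟨Fn, hFn, hlim⟩ := mem_closure_iff_seq_limit.1 (dense_of_smul_fourier_mem hV F)
  have hlim' : Tendsto (fun n => ‖Fn n - F‖) atTop (𝓝 0) := tendsto_iff_norm_sub_tendsto_zero.1 hlim
  refine ⟨fun n => solution hε (Fn n), fun n => -sourceOp (Fn n), hFn, ?_, ?_⟩
  · refine squeeze_zero (fun n => ?_) (fun n => ?_) (by simpa using hlim'.const_mul C)
    · rw [xNorm_eq_xSeminorm]
      exact apply_nonneg _ _
    · rw [xNorm_eq_xSeminorm, ← map_sub]
      exact hC _
  · refine squeeze_zero (fun n => ?_) (fun n => ?_) (by simpa using hlim'.const_mul (20 / 3))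
    · rw [xNorm_eq_xSeminorm]
      exact apply_nonneg _ _
    · rw [xNorm_eq_xSeminorm, neg_sub_neg, ← map_sub, norm_sub_rev]
      exact xSeminorm_sourceOp_le _

lemma meanAt_solution (hε : 0 < ε) (η : Cell ℓ) (F : C(AddCircle ℓ, ℂ)) :
    meanAt η (solution hε F) = 0 := by
  obtain ⟨C, hC⟩ := exists_xSeminorm_solution_le (ℓ := ℓ) hε
  refine LinearMap.congr_fun (f := meanAt η ∘ₗ solution hε) (g := 0)
    (ext_smul_fourier (A := 4 * C) (B := 0) (fun F => ?_) (fun F => by simp) fun c n => ?_) F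
  · rw [mul_assoc]
    exact (abs_meanAt_le η _).trans (mul_le_mul_of_nonneg_left (hC F) zero_le_four)
  · rw [LinearMap.comp_apply, LinearMap.zero_apply]
    rcases eq_or_ne n 0 with rfl | hn
    · rw [solution_smul_fourier_zero, map_zero]
    · rw [solution_smul_fourier hε c hn, meanAt_of_eq_tensor (coe_modeTensor hε hn _), modeNeg,
        modePos, integral_profNeg_add_integral_profPos (one_lt_modeRoot hε hn)
        (one_div_modeEig_mul hε hn), zero_mul]

lemma isResolventZero_solution (hε : 0 < ε) (F : C(AddCircle ℓ, ℂ)) :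
    IsResolventZero ε (sourceOp F) (solution hε F) :=
  ⟨inComplement_of_meanAt_eq_zero fun η => meanAt_sourceOp η F,
    inComplement_of_meanAt_eq_zero fun η => meanAt_solution hε η F, graphLEps_solution hε F⟩

lemma trace_solution (hε : 0 < ε) {M : C(AddCircle ℓ, ℝ) →L[ℝ] C(AddCircle ℓ, ℝ)}
    (hM : IsMultiplier (rootSymbol ℓ ε traceSymb) M) (F : C(AddCircle ℓ, ℂ)) (η : Cell ℓ) :
    trace (solution hε F) η = restr (M (reCircle (meanFree F))) η := by
  obtain ⟨C, hC⟩ := exists_xSeminorm_solution_le (ℓ := ℓ) hε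
  refine LinearMap.congr_fun
    (f := LinearMap.proj η ∘ₗ ContinuousMap.coeFnLinearMap ℝ ∘ₗ trace ∘ₗ solution hε)
    (g := LinearMap.proj η ∘ₗ restr ∘ₗ (M ∘L reCircle ∘L meanFree).toLinearMap)
    (ext_smul_fourier (A := C) (B := ‖M ∘L reCircle ∘L meanFree‖) (fun F => ?_) (fun F => ?_)
      fun c n => ?_) F
  · exact ((trace _).norm_coe_le_norm η).trans ((norm_trace_le _).trans (hC F))
  · exact (ContinuousMap.norm_coe_le_norm _ _).trans ((M ∘L reCircle ∘L meanFree).le_opNorm F)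
  · suffices trace (solution hε (c • fourier n)) η =
        restr (M (reCircle (meanFree (c • fourier n)))) η from this
    rcases eq_or_ne n 0 with rfl | hn
    · simp [solution_smul_fourier_zero, meanFree_smul_fourier_zero]
    · rw [solution_smul_fourier hε c hn, trace_apply, coe_modeTensor, tensor_neg_apply,
        meanFree_smul_fourier c hn, hM.apply_reCircle_fourier]
      exact congrArg (· * reCell (c • fourier n) η) profNeg_zero

end Solution

section Graph

variable {ℓ ε : ℝ}

lemma freq_sq_mul_traceSymb (hε : 0 < ε) (n : ℤ) :
    freq ℓ n * (freq ℓ n * rootSymbol ℓ ε traceSymb n) =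
      ((4 / (9 * ε) : ℝ) : ℂ) - ((1 / (3 * ε) : ℝ) : ℂ) * rootSymbol ℓ ε symbK n := by
  have hr := one_le_modeRoot (ℓ := ℓ) hε n
  rw [← mul_assoc, ← sq, freq_sq hε, ← modeRoot_mul hε, rootSymbol, rootSymbol]
  simp only [← Complex.ofReal_sub, ← Complex.ofReal_mul, Complex.ofReal_inj]
  rw [traceSymb, symbK]
  field_simp
  ring

variable [hℓ : Fact (0 < ℓ)]

lemma exists_trace_multipliers (hε : 0 < ε) : ∃ M M₁ : C(AddCircle ℓ, ℝ) →L[ℝ] C(AddCircle ℓ, ℝ),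
    IsMultiplier (rootSymbol ℓ ε traceSymb) M ∧
      IsMultiplier (fun n => freq ℓ n * rootSymbol ℓ ε traceSymb n) M₁ := by
  obtain ⟨M, hM⟩ := exists_isMultiplier_rootSymbol (ℓ := ℓ) (C := 1) hε fun r hr =>
    (abs_traceSymb_le hr).trans
      (one_div_le_one_div_of_le (by linarith) (le_self_pow₀ hr two_ne_zero))
  obtain ⟨M₁, hM₁⟩ := exists_isMultiplier_freq_mul_rootSymbol (ℓ := ℓ) hε fun r hr =>
    abs_traceSymb_le hr
  exact ⟨M, M₁, hM, hM₁⟩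

lemma coe_sourceOp_toComplex {F : C(AddCircle ℓ, ℝ)} (h : coeff 0 F = 0) :
    (sourceOp (toComplex F)).1 = tensor sourceNeg sourcePos (reCell (toComplex F)) := by
  rw [coe_sourceOp, meanFree_toComplex h]

lemma trace_solution_toComplex (hε : 0 < ε) {M : C(AddCircle ℓ, ℝ) →L[ℝ] C(AddCircle ℓ, ℝ)}
    (hM : IsMultiplier (rootSymbol ℓ ε traceSymb) M) {F : C(AddCircle ℓ, ℝ)} (h : coeff 0 F = 0) :
    (fun η => (solution hε (toComplex F)).1.1 (zeroNeg, η)) = restr (M F) := by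
  ext η
  rw [← trace_apply, trace_solution hε hM, meanFree_toComplex h]
  rfl

lemma graphB_restr (hε : 0 < ε) {K : C(AddCircle ℓ, ℝ) →L[ℝ] C(AddCircle ℓ, ℝ)}
    (hK : IsMultiplier (rootSymbol ℓ ε symbK) K) {F F₁ F₂ : C(AddCircle ℓ, ℝ)}
    (h₁ : HasDerivOn (restr F) (restr F₁)) (h₂ : HasDerivOn (restr F₁) (restr F₂)) :
    GraphB ε (restr F) (restr (F - (3 * ε) • F₂ - ε • K F₂)) := by
  obtain ⟨M, M₁, hM, hM₁⟩ := exists_trace_multipliers (ℓ := ℓ) hε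
  have hmean : coeff 0 F₂ = 0 := by rw [hasDerivOn_restr_iff.1 h₂]; simp [freq]
  have hderiv : HasDerivOn (restr (M F₂)) (restr (M₁ F₂)) :=
    hasDerivOn_restr_iff.2 fun n => by rw [hM₁, hM, mul_assoc]
  have hderiv₂ : HasDerivOn (restr (M₁ F₂))
      (restr ((4 / (9 * ε)) • F₂ - (1 / (3 * ε)) • K F₂)) :=
    hasDerivOn_restr_iff.2 fun n => by
      rw [hM₁, ← mul_assoc, freq_sq_mul_traceSymb hε, map_sub, coeff_smul, coeff_smul, hK]
      ring
  refine ⟨restr F₁, restr F₂, restr (M₁ F₂), restr ((4 / (9 * ε)) • F₂ - (1 / (3 * ε)) • K F₂),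
    sourceOp (toComplex F₂), solution hε (toComplex F₂), h₁, h₂, fun p => ?_, fun p => ?_,
    isResolventZero_solution hε _, ?_, hderiv₂, fun η => ?_⟩
  · rw [coe_sourceOp_toComplex hmean, tensor_neg_apply, sourceNeg_apply, mul_comm]
    rfl
  · rw [coe_sourceOp_toComplex hmean, tensor_pos_apply, sourcePos_apply, mul_comm]
    rfl
  · rwa [trace_solution_toComplex hε hM hmean]
  · simp only [restr_apply, ContinuousMap.sub_apply, ContinuousMap.smul_apply, smul_eq_mul]
    field_simp
    ring

end Graph

section Inverse

variable {ℓ : ℝ} [hℓ : Fact (0 < ℓ)] {ε : ℝ} {θ : ℝ≥0} {κ : ℤ → ℂ}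
  {K N N₁ N₂ : C(AddCircle ℓ, ℝ) →L[ℝ] C(AddCircle ℓ, ℝ)}

/-- The operator `1 - 3 ε D_ηη - ε K D_ηη` from `C_♯^{2+θ}` to `C_♯^θ`; it is `𝓑_ε` when `K` has the
symbol `symbK`. -/
def operatorB (ε : ℝ) (hθ : θ ≤ 1) (hK : IsMultiplier κ K) : CSharp ℓ 2 θ →ₗ[ℝ] CSharp ℓ 0 θ :=
  Submodule.inclusion ((cSharp_succ_le hθ).trans (cSharp_succ_le hθ)) -
    (3 * ε) • derivative ∘ₗ derivative - ε • cSharpMultiplier hK ∘ₗ derivative ∘ₗ derivative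

lemma circleLift_operatorB (hθ : θ ≤ 1) (hK : IsMultiplier κ K) (ψ : CSharp ℓ 2 θ) :
    circleLift (operatorB ε hθ hK ψ) = circleLift ψ -
      (3 * ε) • circleLift (derivative (derivative ψ)) -
        ε • K (circleLift (derivative (derivative ψ))) := by
  simp only [operatorB, LinearMap.sub_apply, LinearMap.smul_apply, LinearMap.comp_apply, map_sub,
    map_smul, circleLift_inclusion, circleLift_cSharpMultiplier]

lemma coeff_circleLift_operatorB (hε : 0 < ε) (hθ : θ ≤ 1)
    (hK : IsMultiplier (rootSymbol ℓ ε symbK) K) (ψ : CSharp ℓ 2 θ) (n : ℤ) :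
    coeff n (circleLift (operatorB ε hθ hK ψ)) =
      rootSymbol ℓ ε symbB n * coeff n (circleLift ψ) := by
  have hsymb : rootSymbol ℓ ε symbB n =
      1 - 3 * ε * freq ℓ n ^ 2 - ε * rootSymbol ℓ ε symbK n * freq ℓ n ^ 2 := by
    rw [freq_sq hε, rootSymbol, rootSymbol, symbB_eq (one_le_modeRoot hε n), modeRoot_mul hε]
    have : (ε : ℂ) ≠ 0 := Complex.ofReal_ne_zero.2 hε.ne'
    push_cast
    field_simp
    ring
  rw [circleLift_operatorB, map_sub, map_sub, coeff_smul, coeff_smul, hK,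
    coeff_circleLift_derivative, coeff_circleLift_derivative, hsymb]
  push_cast
  ring

lemma graphB_operatorB (hε : 0 < ε) (hθ : θ ≤ 1) (hK : IsMultiplier (rootSymbol ℓ ε symbK) K)
    (ψ : CSharp ℓ 2 θ) : GraphB ε (ψ : Cell ℓ → ℝ) (operatorB ε hθ hK ψ : Cell ℓ → ℝ) := by
  have h := graphB_restr hε hK (F := circleLift ψ) (F₁ := circleLift (derivative ψ))
    (F₂ := circleLift (derivative (derivative ψ)))
    (by simpa only [restr_circleLift] using hasDerivOn_derivative ψ)
    (by simpa only [restr_circleLift] using hasDerivOn_derivative (derivative ψ))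
  rwa [← circleLift_operatorB hθ hK, restr_circleLift, restr_circleLift] at h

lemma exists_holderNorm_operatorB_le (hε : 0 < ε) (hθ : θ ≤ 1) (hK : IsMultiplier κ K) :
    ∃ C, ∀ ψ : CSharp ℓ 2 θ, holderNorm 0 θ (operatorB ε hθ hK ψ : Cell ℓ → ℝ) ≤
      C * holderNorm 2 θ (ψ : Cell ℓ → ℝ) := by
  refine ⟨max 1 (ℓ ^ (1 - (θ : ℝ))) ^ 2 + 3 * ε + ε * (2 * ‖K‖), fun ψ => ?_⟩
  set D := derivative (derivative ψ)
  set c := max 1 (ℓ ^ (1 - (θ : ℝ)))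
  have hD : holderSeminorm ℓ θ D ≤ holderNorm 2 θ (ψ : Cell ℓ → ℝ) := by
    rw [holderNorm_succ_eq, holderNorm_succ_eq, holderSeminorm_apply]
    linarith [norm_nonneg (circleLift ψ), norm_nonneg (circleLift (derivative ψ))]
  have hincl : holderSeminorm ℓ θ (Submodule.inclusion
      ((cSharp_succ_le hθ).trans (cSharp_succ_le hθ)) ψ) ≤
        c ^ 2 * holderNorm 2 θ (ψ : Cell ℓ → ℝ) := by
    rw [sq, mul_assoc]
    exact (holderNorm_le_succ hθ (Submodule.inclusion (cSharp_succ_le hθ) ψ)).trans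
      (mul_le_mul_of_nonneg_left (holderNorm_le_succ hθ ψ) (by positivity))
  calc holderSeminorm ℓ θ (operatorB ε hθ hK ψ)
      ≤ holderSeminorm ℓ θ (Submodule.inclusion
          ((cSharp_succ_le hθ).trans (cSharp_succ_le hθ)) ψ) +
        holderSeminorm ℓ θ ((3 * ε) • D) + holderSeminorm ℓ θ (ε • cSharpMultiplier hK D) :=
        (map_sub_le_add _ _ _).trans (add_le_add_left (map_sub_le_add _ _ _) _)
    _ = holderSeminorm ℓ θ (Submodule.inclusion
          ((cSharp_succ_le hθ).trans (cSharp_succ_le hθ)) ψ) +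
        3 * ε * holderSeminorm ℓ θ D + ε * holderSeminorm ℓ θ (cSharpMultiplier hK D) := by
        rw [map_smul_eq_mul, map_smul_eq_mul, Real.norm_of_nonneg (by positivity : 0 ≤ 3 * ε),
          Real.norm_of_nonneg hε.le]
    _ ≤ c ^ 2 * holderNorm 2 θ (ψ : Cell ℓ → ℝ) + 3 * ε * holderNorm 2 θ (ψ : Cell ℓ → ℝ) +
          ε * (2 * ‖K‖ * holderNorm 2 θ (ψ : Cell ℓ → ℝ)) := by
        gcongr
        exact (holderSeminorm_cSharpMultiplier_le hK D).trans (by gcongr)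
    _ = _ := by ring

/-- Extends `T : C_♯^θ → C_♯^{k+θ}` to a map into `C_♯^{k+1+θ}` whose derivative is `T`, given a
primitive of `T` as an operator on the continuous functions. -/
def primitive {k : ℕ} (N : C(AddCircle ℓ, ℝ) →L[ℝ] C(AddCircle ℓ, ℝ))
    (T : CSharp ℓ 0 θ →ₗ[ℝ] CSharp ℓ k θ)
    (hT : ∀ g n, coeff n (circleLift (T g)) = freq ℓ n * coeff n (N (circleLift g))) :
    CSharp ℓ 0 θ →ₗ[ℝ] CSharp ℓ (k + 1) θ :=
  (restr ∘ₗ N.toLinearMap ∘ₗ circleLift).codRestrict _ fun g => mem_cSharp_succ_iff.2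
    ⟨endsAgree_restr _, T g, (T g).2, by
      rw [← restr_circleLift (T g)]
      exact hasDerivOn_restr_iff.2 (hT g)⟩

section Primitive

variable {k : ℕ} {T : CSharp ℓ 0 θ →ₗ[ℝ] CSharp ℓ k θ}
  (hT : ∀ g n, coeff n (circleLift (T g)) = freq ℓ n * coeff n (N (circleLift g)))

lemma circleLift_primitive (g : CSharp ℓ 0 θ) :
    circleLift (primitive N T hT g) = N (circleLift g) :=
  circleLift_eq_iff.2 rfl

lemma derivative_primitive (g : CSharp ℓ 0 θ) : derivative (primitive N T hT g) = T g :=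
  circleLift_injective <| ext_coeff fun n => by
    rw [coeff_circleLift_derivative, circleLift_primitive, hT]

lemma holderNorm_primitive_le {C : ℝ} {g : CSharp ℓ 0 θ}
    (hC : holderNorm k θ (T g : Cell ℓ → ℝ) ≤ C * holderNorm 0 θ (g : Cell ℓ → ℝ)) :
    holderNorm (k + 1) θ (primitive N T hT g : Cell ℓ → ℝ) ≤
      (‖N‖ + C) * holderNorm 0 θ (g : Cell ℓ → ℝ) := by
  have hsup : ‖circleLift g‖ ≤ holderNorm 0 θ (g : Cell ℓ → ℝ) := by
    rw [holderNorm_zero_eq]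
    exact le_add_of_nonneg_right (NNReal.coe_nonneg _)
  rw [holderNorm_succ_eq, derivative_primitive, circleLift_primitive, add_mul]
  exact add_le_add ((N.le_opNorm _).trans (by gcongr)) hC

end Primitive

/-- The second derivative `-(1 - N₂) / (3 ε)` of the inverse of `𝓑_ε`. -/
def inverseDerivTwo (ε : ℝ) (hN₂ : IsMultiplier κ N₂) : CSharp ℓ 0 θ →ₗ[ℝ] CSharp ℓ 0 θ :=
  (-1 / (3 * ε)) • (LinearMap.id - cSharpMultiplier hN₂)

lemma circleLift_inverseDerivTwo (hN₂ : IsMultiplier κ N₂) (g : CSharp ℓ 0 θ) :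
    circleLift (inverseDerivTwo ε hN₂ g) =
      (-1 / (3 * ε)) • (circleLift g - N₂ (circleLift g)) := by
  rw [inverseDerivTwo, LinearMap.smul_apply, map_smul, LinearMap.sub_apply, map_sub,
    circleLift_cSharpMultiplier, LinearMap.id_apply]

lemma holderNorm_inverseDerivTwo_le (hε : 0 < ε) (hN₂ : IsMultiplier κ N₂) (g : CSharp ℓ 0 θ) :
    holderNorm 0 θ (inverseDerivTwo ε hN₂ g : Cell ℓ → ℝ) ≤
      1 / (3 * ε) * (1 + 2 * ‖N₂‖) * holderNorm 0 θ (g : Cell ℓ → ℝ) := by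
  calc holderSeminorm ℓ θ ((-1 / (3 * ε)) • (g - cSharpMultiplier hN₂ g))
      = 1 / (3 * ε) * holderSeminorm ℓ θ (g - cSharpMultiplier hN₂ g) := by
        rw [map_smul_eq_mul, neg_div, norm_neg, Real.norm_of_nonneg (by positivity)]
    _ ≤ 1 / (3 * ε) * (holderSeminorm ℓ θ g + 2 * ‖N₂‖ * holderSeminorm ℓ θ g) := by
        gcongr
        exact (map_sub_le_add _ _ _).trans
          (add_le_add_right (holderSeminorm_cSharpMultiplier_le hN₂ g) _)
    _ = _ := by rw [holderSeminorm_apply]; ring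

lemma coeff_circleLift_inverseDerivTwo (hε : 0 < ε)
    (hN₁ : IsMultiplier (fun n => freq ℓ n * rootSymbol ℓ ε (fun r => 1 / symbB r) n) N₁)
    (hN₂ : IsMultiplier (rootSymbol ℓ ε fun r => r / (2 * r ^ 2 - 1)) N₂) (g : CSharp ℓ 0 θ)
    (n : ℤ) :
    coeff n (circleLift (inverseDerivTwo ε hN₂ g)) = freq ℓ n * coeff n (N₁ (circleLift g)) := by
  rw [circleLift_inverseDerivTwo, coeff_smul, map_sub, hN₂, hN₁, ← mul_assoc,
    freq_sq_mul_inv_symbB hε]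
  ring

lemma exists_inverse (hε : 0 < ε) : ∃ (S : CSharp ℓ 0 θ →ₗ[ℝ] CSharp ℓ 2 θ) (C : ℝ),
    (∀ g n, coeff n (circleLift (S g)) =
      rootSymbol ℓ ε (fun r => 1 / symbB r) n * coeff n (circleLift g)) ∧
    ∀ g, holderNorm 2 θ (S g : Cell ℓ → ℝ) ≤ C * holderNorm 0 θ (g : Cell ℓ → ℝ) := by
  obtain ⟨N, hN⟩ := exists_isMultiplier_inv_symbB (ℓ := ℓ) hε
  obtain ⟨N₁, hN₁⟩ := exists_isMultiplier_freq_mul_rootSymbol (ℓ := ℓ) hε fun r => abs_inv_symbB_le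
  obtain ⟨N₂, hN₂⟩ := exists_isMultiplier_remainder (ℓ := ℓ) hε
  let S₁ : CSharp ℓ 0 θ →ₗ[ℝ] CSharp ℓ 1 θ :=
    primitive N₁ (inverseDerivTwo ε hN₂) (coeff_circleLift_inverseDerivTwo hε hN₁ hN₂)
  have hS₁ (g : CSharp ℓ 0 θ) (n : ℤ) :
      coeff n (circleLift (S₁ g)) = freq ℓ n * coeff n (N (circleLift g)) := by
    rw [circleLift_primitive, hN₁, hN, mul_assoc]
  exact ⟨primitive N S₁ hS₁, _, fun g n => by rw [circleLift_primitive, hN],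
    fun g => holderNorm_primitive_le hS₁
      (holderNorm_primitive_le _ (holderNorm_inverseDerivTwo_le hε hN₂ g))⟩

lemma exists_linearEquiv (hε : 0 < ε) (hθ : θ ≤ 1) (hK : IsMultiplier (rootSymbol ℓ ε symbK) K) :
    ∃ (B : CSharp ℓ 2 θ ≃ₗ[ℝ] CSharp ℓ 0 θ) (C : ℝ), ∀ ψ, B ψ = operatorB ε hθ hK ψ ∧
      holderNorm 2 θ (ψ : Cell ℓ → ℝ) ≤ C * holderNorm 0 θ (B ψ : Cell ℓ → ℝ) := by
  obtain ⟨S, C, hS, hC⟩ := exists_inverse (ℓ := ℓ) (θ := θ) hε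
  have hsymb (n : ℤ) : rootSymbol ℓ ε symbB n * rootSymbol ℓ ε (fun r => 1 / symbB r) n = 1 := by
    rw [rootSymbol, rootSymbol, ← Complex.ofReal_mul, mul_one_div_cancel
      (symbB_pos (one_le_modeRoot hε n)).ne', Complex.ofReal_one]
  have hright (g : CSharp ℓ 0 θ) : operatorB ε hθ hK (S g) = g :=
    circleLift_injective <| ext_coeff fun n => by
      rw [coeff_circleLift_operatorB hε, hS, ← mul_assoc, hsymb, one_mul]
  have hleft (ψ : CSharp ℓ 2 θ) : S (operatorB ε hθ hK ψ) = ψ :=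
    circleLift_injective <| ext_coeff fun n => by
      rw [hS, coeff_circleLift_operatorB hε, mul_left_comm, ← mul_assoc, hsymb, one_mul]
  refine ⟨.ofLinearMap (operatorB ε hθ hK) S (LinearMap.ext hright) (LinearMap.ext hleft), C,
    fun ψ => ⟨rfl, ?_⟩⟩
  have h := hC (operatorB ε hθ hK ψ)
  rw [hleft] at h
  exact h

end Inverse

end FrontB

end

open FrontB in
theorem mainTheorem9_general (ℓ₀ : ℝ) (hℓ₀ : 0 < ℓ₀) (ε : ℝ) (hε : 0 < ε) (θ : ℝ≥0) (hθ : θ ≤ 1) :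
    ∃ B : CSharp ℓ₀ 2 θ ≃ₗ[ℝ] CSharp ℓ₀ 0 θ,
      (∀ (ψ : CSharp ℓ₀ 2 θ) (g : Cell ℓ₀ → ℝ), GraphB ε (ψ : Cell ℓ₀ → ℝ) g ↔ g = B ψ) ∧
      ∃ C : ℝ, ∀ ψ : CSharp ℓ₀ 2 θ,
        holderNorm 0 θ (B ψ : Cell ℓ₀ → ℝ) ≤ C * holderNorm 2 θ (ψ : Cell ℓ₀ → ℝ) ∧
        holderNorm 2 θ (ψ : Cell ℓ₀ → ℝ) ≤ C * holderNorm 0 θ (B ψ : Cell ℓ₀ → ℝ) := by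
  have : Fact (0 < ℓ₀) := ⟨hℓ₀⟩
  obtain ⟨K, hK⟩ := exists_isMultiplier_symbK (ℓ := ℓ₀) hε
  obtain ⟨B, C, hB⟩ := exists_linearEquiv hε hθ hK
  obtain ⟨C', hC'⟩ := exists_holderNorm_operatorB_le hε hθ hK
  have hgraph (ψ : CSharp ℓ₀ 2 θ) : GraphB ε (ψ : Cell ℓ₀ → ℝ) (B ψ : Cell ℓ₀ → ℝ) := by
    rw [(hB ψ).1]
    exact graphB_operatorB hε hθ hK ψ
  refine ⟨B, fun ψ g => ⟨fun h => h.unique hε (hgraph ψ), fun h => h ▸ hgraph ψ⟩, max C' C,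
    fun ψ => ⟨?_, (hB ψ).2.trans
      (mul_le_mul_of_nonneg_right (le_max_right _ _) (holderNorm_nonneg _))⟩⟩
  rw [(hB ψ).1]
  exact (hC' ψ).trans (mul_le_mul_of_nonneg_right (le_max_left _ _) (holderNorm_nonneg _))

theorem mainTheorem9 (ℓ₀ : ℝ) (hℓ₀ : 0 < ℓ₀) (ε : ℝ) (hε : 0 < ε) (hε' : ε ≤ 1 / 2)
    (θ : ℝ≥0) (hθ : 0 < θ) (hθ' : θ < 1) :
    ∃ B : FrontB.CSharp ℓ₀ 2 θ ≃ₗ[ℝ] FrontB.CSharp ℓ₀ 0 θ,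
      (∀ (ψ : FrontB.CSharp ℓ₀ 2 θ) (g : FrontB.Cell ℓ₀ → ℝ),
        FrontB.GraphB ε (ψ : FrontB.Cell ℓ₀ → ℝ) g ↔ g = B ψ) ∧
      ∃ C : ℝ, ∀ ψ : FrontB.CSharp ℓ₀ 2 θ,
        FrontB.holderNorm 0 θ (B ψ : FrontB.Cell ℓ₀ → ℝ)
            ≤ C * FrontB.holderNorm 2 θ (ψ : FrontB.Cell ℓ₀ → ℝ) ∧
        FrontB.holderNorm 2 θ (ψ : FrontB.Cell ℓ₀ → ℝ)
            ≤ C * FrontB.holderNorm 0 θ (B ψ : FrontB.Cell ℓ₀ → ℝ) :=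
  mainTheorem9_general ℓ₀ hℓ₀ ε hε θ hθ'.le
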